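/- **Setting.** For each sample size $n$ we observe $X_t=f_t+\varepsilon_t$, $1\le t\le n$, with $f_t=f_0+\sum_{j=1}^{q_n}d_j\,\mathbb 1\{t\ge\theta_j+1\}$, change points $0=\theta_0<\theta_1<\dots<\theta_{q_n}<\theta_{q_n+1}=n$ and jumps $d_j\neq0$ (all depending on $n$; if there are no change points, $q_n=0$, the last two conditions only say $\theta_0=0$, $\theta_1=n$), and $|d_j|\le \bar d$ for all $j,n$. Put $\delta_j=\min(\theta_j-\theta_{j-1},\theta_{j+1}-\theta_j)$ and $D_n=\min_j d_j^2\delta_j$ ($D_n=\infty$ if $q_n=0$). **Errors.** $(\varepsilon_t)_{t\ge1}$ is a sequence of random variables with $\mathsf E\varepsilon_t=0$ and $0<c\le\mathrm{Var}(\varepsilon_t)\le C<\infty$, and it is ergodic: either it is stationary and ergodic in the usual sense, or (stationarity not being required) at least $n^{-1}\sum_{t\le n}(\varepsilon_t^2-\mathsf E\varepsilon_t^2)\to0$ in probability. There are sequences $\omega_n,\omega_n^{(1)},\omega_n^{(2)}$ with $\sqrt{\log n}=O(\omega_n)$, $\mathsf P(\mathcal M_n^{(11)})\to1$, and $\mathsf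 P(\mathcal M_n^{(12)}\cap\mathcal M_n^{(13)})\to1$ for all sequences $a_n,b_n$ with $1\le a_n,b_n\le D_n$ for all large $n$, where - $\mathcal M_n^{(11)}$: $(e-s)^{-1/2}\,|\sum_{t=s+1}^e\varepsilon_t|\le\omega_n$ for all $0\le s<e\le n$; - $\mathcal M_n^{(12)}$: for all $1\le j\le q_n$, $\frac{\sqrt{d_j^{-2}a_n}}{\ell}\,|\sum_{t=\theta_j-\ell+1}^{\theta_j}\varepsilon_t|\le\omega_n^{(1)}$ for $d_j^{-2}a_n\le\ell\le\theta_j-\theta_{j-1}$, and $\frac{\sqrt{d_j^{-2}a_n}}{\ell}\,|\sum_{t=\theta_j+1}^{\theta_j+\ell}\varepsilon_t|\le\omega_n^{(1)}$ for $d_j^{-2}a_n\le\ell\le\theta_{j+1}-\theta_j$; - $\mathcal M_n^{(13)}$: for all $1\le j\le q_n$ and $1\le\ell\le d_j^{-2}b_n$, both $|\sum_{t=\theta_j-\ell+1}^{\theta_j}\varepsilon_t|$ and $|\sum_{t=\theta_j+1}^{\theta_j+\ell}\varepsilon_t|$ are at most $\omega_n^{(2)}\sqrt{d_j^{-2}b_n}$.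 **Size of changes and penalty.** $\omega_n^2/D_n\to0$; the penalty $\xi_n>0$ satisfies $\xi_n/D_n\to0$ and $\omega_n^2/\xi_n\to0$. **Candidates.** $\mathcal K=\mathcal K_n\subset\{1,\dots,n-1\}$ is a random set, $Q_n=|\mathcal K_n|$, with $\omega_n^2Q_n/n\to0$ in probability. There is a sequence $\rho_n$, bounded away from $0$ for large $n$, with $\max(\omega_n^{(1)},\omega_n^{(2)})^2=O(\rho_n)$, $\rho_n=O(\omega_n^2)$ and $\mathsf P(\mathcal M_n^{(2)})\to1$, where $\mathcal M_n^{(2)}=\{\max_{j}\min_{k\in\mathcal K}d_j^2|k-\theta_j|\le\rho_n\}$. **Acceptable estimators.** Let $\nu_n\to\infty$ be any sequence with $\rho_n\nu_n/\xi_n\to0$. The acceptable candidates for $\theta_j$ are $\mathcal V_j'=\{k\in\mathcal K:\ d_j^2|k-\theta_j|\le\rho_n\nu_n\}$. **Pruning.** For a finite set $B$ let $\mathrm{RSS}(B)$ be the residual sum of squares of $X_1,\dots,X_n$ about the segment means, the segments being $(u,v]$ for consecutive $u<v$ in $B\cup\{0,n\}$. Let $0\le s<e\le n$ and $\mathcal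 D=\mathcal K\cap(s,e)$. Let $\mathcal C$ (active candidates) and $\mathcal A^{\mathrm{acc}}$ (accepted candidates) be subsets of $\mathcal K$ with $\mathcal C\cap(s,e)=\mathcal D$ and $\mathcal A^{\mathrm{acc}}\cap(s,e)=\emptyset$, such that $\mathcal C\cup\mathcal A^{\mathrm{acc}}=\mathcal K$; if $\max_{1\le t\le n}|f_t-f_0|\le H$ for a constant $H$ fixed in advance, this last requirement is dropped. For $A\subset\mathcal D$ put $$\mathrm{SC}(A)=\frac n2\log\frac{\mathrm{RSS}\big(A\cup\mathcal A^{\mathrm{acc}}\cup(\mathcal C\setminus\mathcal D)\cup\{s,e\}\big)}{n}+\big(|A|+|\mathcal A^{\mathrm{acc}}|+|\mathcal C\setminus\mathcal D|\big)\xi_n .$$ - (C1) $\mathcal F$ is the family of all $A\subset\mathcal D$ such that $\mathrm{SC}(B)\le\mathrm{SC}(B\cup\{k\})$ whenever $A\subset B\subset\mathcal D$ and $k\in\mathcal D\setminus B$. Let $m^*=\min_{A\in\mathcal F}|A|$. - (C2) $\hat\Theta^{(s,e)}$ minimises $\mathrm{SC}(A)$ over all $A$ obtained from some $A'\in\mathcal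 F$ with $m^*\le|A'|\le m^*+2$ by possibly deleting the smallest and/or the largest element of $A'$. Among several minimisers one of minimum cardinality is taken, remaining ties being broken arbitrarily. **Theorem.** There are constants $0<c^*<C^*<\infty$, depending only on $c$, $C$, $\bar d$ and $H$, such that the following holds under the above assumptions. Call $\theta_j$ *surely detectable* within $(s,e]$ if $d_j^2\min(\theta_j-s,e-\theta_j)\ge C^*\xi_n$, *detectable* if $d_j^2\min(\theta_j-s,e-\theta_j)\ge c^*\xi_n$, and *merely detectable* if it is detectable but not surely detectable. Let $\mathcal P_n^{(s,e)}$ be the event that, for all choices of $\mathcal C,\mathcal A^{\mathrm{acc}}$ as above and however ties are broken, 1. $|\hat\Theta^{(s,e)}\cap\mathcal V_j'|=1$ for every surely detectable $\theta_j$; 2. $|\hat\Theta^{(s,e)}\cap\mathcal V_j'|\le1$ for every merely detectable $\theta_j$; 3. every element of $\hat\Theta^{(s,e)}$ lies in $\mathcal V_j'$ for some detectable $\theta_j$. Then, for all sequences $a_n,b_n$ with $1\le a_n,b_n\le D_n$ for all large $n$ (entering $\mathcal M_n^{(12)}$ and $\mathcal M_n^{(13)}$ respectively), $$\mathsf P\Big(\bigcap_{0\le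 s<e\le n}\mathcal P_n^{(s,e)}\cap\mathcal M_n^{(11)}\cap\mathcal M_n^{(12)}\cap\mathcal M_n^{(13)}\cap\mathcal M_n^{(2)}\Big)\longrightarrow1\qquad(n\to\infty).$$ -/

import Mathlib

open MeasureTheory ProbabilityTheory Filter Topology Asymptotics

namespace LocalPruning

/-! ### The piecewise constant signal -/

/-- The signal of a sample of size `n`: `q` change points `θ 1 < ... < θ q` strictly between
`θ 0 = 0` and `θ (q + 1) = n`, with non-zero jumps `d 1, ..., d q` and initial level `base`.
Values of `θ` and `d` at other indices play no role. The case `q = 0` is allowed. -/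
structure Signal (n : ℕ) where
  q : ℕ
  θ : ℕ → ℕ
  d : ℕ → ℝ
  base : ℝ
  θ_zero : θ 0 = 0
  θ_last : θ (q + 1) = n
  θ_lt : ∀ j ∈ Finset.Icc 1 q, θ (j - 1) < θ j ∧ θ j < θ (j + 1)
  d_ne : ∀ j ∈ Finset.Icc 1 q, d j ≠ 0

/-- The mean `f t = f 0 + ∑ j, d j * 1{t ≥ θ j + 1}`. -/
noncomputable def Signal.mean {n : ℕ} (S : Signal n) (t : ℕ) : ℝ :=
  S.base + ∑ j ∈ Finset.Icc 1 S.q, S.d j * (if S.θ j + 1 ≤ t then 1 else 0)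

/-- The distance of the `j`-th change point to its nearest neighbour (`0` and `n` included). -/
def Signal.gap {n : ℕ} (S : Signal n) (j : ℕ) : ℕ :=
  min (S.θ j - S.θ (j - 1)) (S.θ (j + 1) - S.θ j)

/-- `D = min_j d_j ^ 2 * δ_j`, equal to `∞` if there is no change point. -/
noncomputable def Signal.strength {n : ℕ} (S : Signal n) : ENNReal :=
  ⨅ j ∈ Finset.Icc 1 S.q, ENNReal.ofReal (S.d j ^ 2 * (S.gap j : ℝ))

/-- The observations `X t = f t + ε t`. -/
noncomputable def Signal.obs {n : ℕ} (S : Signal n) (ε : ℕ → ℝ) (t : ℕ) : ℝ :=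
  S.mean t + ε t

/-! ### Errors -/

/-- Ergodicity of the errors `ε 1, ε 2, ...`. For a stationary sequence this is the usual notion:
the shift is measure preserving and ergodic for the law of the sequence. As stationarity of the
errors is not required, sequences are admitted as well whose time averages of squares are
asymptotically equal (in probability) to the ensemble averages. -/
def ErgodicErrors {Ω : Type*} [MeasurableSpace Ω] (μ : Measure Ω) (ε : ℕ → Ω → ℝ) : Prop :=
  Ergodic (fun (x : ℕ → ℝ) (t : ℕ) => x (t + 1)) (μ.map (fun ω t => ε (t + 1) ω)) ∨
  TendstoInMeasure μ
    (fun (n : ℕ) ω => (∑ t ∈ Finset.Icc 1 n, (ε t ω ^ 2 - ∫ ω', ε t ω' ^ 2 ∂μ)) / (n : ℝ))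
    atTop (fun _ => 0)

/-- The path `ε` satisfies the bound of the event `M^(11)`. -/
def NoiseAll (n : ℕ) (ε : ℕ → ℝ) (w : ℝ) : Prop :=
  ∀ s e : ℕ, s < e → e ≤ n →
    1 / Real.sqrt ((e : ℝ) - s) * |∑ t ∈ Finset.Ioc s e, ε t| ≤ w

/-- The path `ε` satisfies the bounds of the event `M^(12)` with parameter `a`. -/
def NoiseFar {n : ℕ} (S : Signal n) (ε : ℕ → ℝ) (a w : ℝ) : Prop :=
  ∀ j ∈ Finset.Icc 1 S.q,
    (∀ l : ℕ, a / S.d j ^ 2 ≤ l → l ≤ S.θ j - S.θ (j - 1) →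
      Real.sqrt (a / S.d j ^ 2) / l * |∑ t ∈ Finset.Ioc (S.θ j - l) (S.θ j), ε t| ≤ w) ∧
    (∀ l : ℕ, a / S.d j ^ 2 ≤ l → l ≤ S.θ (j + 1) - S.θ j →
      Real.sqrt (a / S.d j ^ 2) / l * |∑ t ∈ Finset.Ioc (S.θ j) (S.θ j + l), ε t| ≤ w)

/-- The path `ε` satisfies the bounds of the event `M^(13)` with parameter `b`. -/
def NoiseNear {n : ℕ} (S : Signal n) (ε : ℕ → ℝ) (b w : ℝ) : Prop :=
  ∀ j ∈ Finset.Icc 1 S.q, ∀ l : ℕ, 1 ≤ l → (l : ℝ) ≤ b / S.d j ^ 2 →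
    1 / Real.sqrt (b / S.d j ^ 2) * |∑ t ∈ Finset.Ioc (S.θ j - l) (S.θ j), ε t| ≤ w ∧
    1 / Real.sqrt (b / S.d j ^ 2) * |∑ t ∈ Finset.Ioc (S.θ j) (S.θ j + l), ε t| ≤ w

/-- The event `M^(2)`: every change point has a strictly valid candidate. -/
def HasValid {n : ℕ} (S : Signal n) (K : Finset ℕ) (ρ : ℝ) : Prop :=
  ∀ j ∈ Finset.Icc 1 S.q, ∃ k ∈ K, S.d j ^ 2 * |(k : ℝ) - S.θ j| ≤ ρ

/-! ### The Schwarz criterion -/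

/-- The mean of `x t` over `u < t ≤ v`. -/
noncomputable def segMean (x : ℕ → ℝ) (u v : ℕ) : ℝ :=
  (∑ t ∈ Finset.Ioc u v, x t) / ((v : ℝ) - u)

/-- The set `{0, n} ∪ A` of all break points of a fit. -/
def breaks (n : ℕ) (A : Finset ℕ) : Finset ℕ := insert 0 (insert n A)

/-- The pairs of consecutive elements of `{0, n} ∪ A`. -/
def segments (n : ℕ) (A : Finset ℕ) : Finset (ℕ × ℕ) :=
  (breaks n A ×ˢ breaks n A).filter
    (fun p : ℕ × ℕ => p.1 < p.2 ∧ ∀ c ∈ breaks n A, ¬ (p.1 < c ∧ c < p.2))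

/-- Residual sum of squares of the piecewise constant fit with breaks `A`. -/
noncomputable def rss (n : ℕ) (x : ℕ → ℝ) (A : Finset ℕ) : ℝ :=
  ∑ p ∈ segments n A, ∑ t ∈ Finset.Ioc p.1 p.2, (x t - segMean x p.1 p.2) ^ 2

/-- The Schwarz criterion `SC(A | act, acc, s, e)` for `A ⊆ D = act ∩ (s, e)`, where `act` are the
active and `acc` the accepted candidates. The end points `s` and `e` of the interval of
consideration are always break points of the fit; this changes nothing if they belong to
`act ∪ acc ∪ {0, n}`. -/
noncomputable def schwarz (n : ℕ) (x : ℕ → ℝ) (ξ : ℝ) (act acc : Finset ℕ) (s e : ℕ)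
    (A : Finset ℕ) : ℝ :=
  (n : ℝ) / 2 *
      Real.log (rss n x (A ∪ acc ∪ (act \ (act ∩ Finset.Ioo s e)) ∪ {s, e}) / n) +
    ((A.card : ℝ) + acc.card + (act \ (act ∩ Finset.Ioo s e)).card) * ξ

/-! ### The pruning algorithm -/

/-- Criterion (C1): the subsets `A` of `D` such that adding further candidates, one at a time,
never decreases the criterion. -/
def stable (SC : Finset ℕ → ℝ) (D : Finset ℕ) : Set (Finset ℕ) :=
  {A | A ⊆ D ∧ ∀ B : Finset ℕ, A ⊆ B → B ⊆ D → ∀ k ∈ D, k ∉ B → SC B ≤ SC (insert k B)}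

/-- The smallest cardinality of a set in `stable SC D` (which contains `D`). -/
noncomputable def minCard (SC : Finset ℕ → ℝ) (D : Finset ℕ) : ℕ :=
  sInf (Finset.card '' stable SC D)

/-- `A ⊆ B`, and `A` contains all elements of `B` except possibly the first and the last one. -/
def InnerSubset (A B : Finset ℕ) : Prop :=
  A ⊆ B ∧ ∀ k ∈ B, k ∉ A → (∀ x ∈ B, k ≤ x) ∨ (∀ x ∈ B, x ≤ k)

/-- The sets compared in criterion (C2). -/
def competitors (SC : Finset ℕ → ℝ) (D : Finset ℕ) : Set (Finset ℕ) :=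
  {A | ∃ B ∈ stable SC D, minCard SC D ≤ B.card ∧ B.card ≤ minCard SC D + 2 ∧ InnerSubset A B}

/-- `A` is a possible output of the pruning algorithm: it minimises the criterion over the
competitors and has minimal cardinality among the minimisers (remaining ties are broken
arbitrarily). -/
def IsPruned (SC : Finset ℕ → ℝ) (D A : Finset ℕ) : Prop :=
  A ∈ competitors SC D ∧
    ∀ B ∈ competitors SC D, SC A < SC B ∨ (SC A = SC B ∧ A.card ≤ B.card)

/-! ### Acceptable estimators and detectable change points -/

/-- The acceptable candidates for the `j`-th change point, `r` being the precision `ρ ν`. -/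
def Signal.acceptable {n : ℕ} (S : Signal n) (K : Finset ℕ) (r : ℝ) (j : ℕ) : Set ℕ :=
  {k | k ∈ K ∧ S.d j ^ 2 * |(k : ℝ) - S.θ j| ≤ r}

/-- Indices `j` with `d_j ^ 2 * min (θ_j - s) (e - θ_j) ≥ r`. With `r = C ξ` these are the surely
detectable, with `r = c ξ` the detectable change points within `(s, e]`. -/
def Signal.detectable {n : ℕ} (S : Signal n) (s e : ℕ) (r : ℝ) : Set ℕ :=
  {j | j ∈ Finset.Icc 1 S.q ∧ r ≤ S.d j ^ 2 * min ((S.θ j : ℝ) - s) ((e : ℝ) - S.θ j)}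

/-- The three assertions about an output `A` on `(s, e]`: exactly one acceptable candidate for every
surely detectable change point, at most one for every other detectable one, and nothing else. -/
def Signal.GoodOutput {n : ℕ} (S : Signal n) (K : Finset ℕ) (s e : ℕ) (rSure rDet r : ℝ)
    (A : Finset ℕ) : Prop :=
  (∀ j ∈ S.detectable s e rSure, ((A : Set ℕ) ∩ S.acceptable K r j).ncard = 1) ∧
  (∀ j ∈ S.detectable s e rDet \ S.detectable s e rSure,
    ((A : Set ℕ) ∩ S.acceptable K r j).ncard ≤ 1) ∧
  (A : Set ℕ) \ ⋃ j ∈ S.detectable s e rDet, S.acceptable K r j = ∅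

/-- `act` (active) and `acc` (accepted) are admissible arguments of the pruning algorithm on
`(s, e]` with all candidates of `K` in `(s, e)` as local candidates. Outside `(s, e)` either every
candidate is active or accepted, or else, if the signal stays within `H` of its initial level,
the active and accepted candidates are arbitrary. -/
def Signal.Admissible {n : ℕ} (S : Signal n) (H : ℝ) (K : Finset ℕ) (s e : ℕ)
    (act acc : Finset ℕ) : Prop :=
  act ⊆ K ∧ acc ⊆ K ∧ act ∩ Finset.Ioo s e = K ∩ Finset.Ioo s e ∧
  acc ∩ Finset.Ioo s e = ∅ ∧
  (act ∪ acc = K ∨ ∀ t ∈ Finset.Icc 1 n, |S.mean t - S.base| ≤ H)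

/-- The event `P^(s,e)` for the data given by the signal `S` and the error path `ε`: for all
admissible arguments, every possible output of the pruning algorithm is good. -/
def Signal.PruneEvent {n : ℕ} (S : Signal n) (ε : ℕ → ℝ) (ξ H : ℝ) (K : Finset ℕ)
    (rSure rDet r : ℝ) (s e : ℕ) : Prop :=
  ∀ act acc A : Finset ℕ, S.Admissible H K s e act acc →
    IsPruned (schwarz n (S.obs ε) ξ act acc s e) (K ∩ Finset.Ioo s e) A →
    S.GoodOutput K s e rSure rDet r A

end LocalPruning

/-!
On an event whose probability tends to one the data satisfy finitely many deterministic bounds, and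
these bounds alone force every output of the pruning algorithm to be good.

**The deterministic part.** A `GoodPath` is a sample for which the noise bounds hold with the
precision `r = ρ ν`, valid candidates exist, and the empirical second moment of the errors is of
order one; a single small number `η` controls all ratios that tend to zero. The residual sum of
squares of a fit then lies between `cl * n` and `Cu * n` (`GoodPath.rss_ge`, `GoodPath.rss_le`), the
upper bound requiring that every surely detectable change point has an element of the fit nearby:
such sets are called covering (`Covers`). Since adding a break `k` in `(u, v]` lowers the residual
sum of squares by `weight u k v * meanDiff x u k v ^ 2`, the criterion changes by about
`n / 2` times the relative change of the residual sum of squares, minus or plus the penalty `ξ` per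
break. This gives three local facts: a superfluous candidate raises the criterion by at least
`3 / 4 * ξ` (`GoodPath.crit_le_insert_of_edges`), a valid candidate for an uncovered surely
detectable change point lowers it (`GoodPath.rss_insert_add_le`, `GoodPath.crit_lt_of_rss`), and
moving an unacceptable candidate to a valid one lowers it, unless deleting it does
(`GoodPath.crit_insert_lt_insert`). The neighbourhoods of the change points used here are disjoint,
because the change points are separated by much more than `ξ / d_j ^ 2`.

Deleting and moving elements shows that a minimiser of the criterion among the covering sets is good
(`GoodPath.goodOutput_of_isCoveringMin`). It remains to see that the algorithm finds such a
minimiser. Stable sets are covering (`GoodPath.covers_of_stable`), and sets with an acceptable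
element for every detectable change point are stable (`GoodPath.mem_stable`). At most two change
points are detectable without being surely detectable, one at each end of `(s, e]`. Hence a
minimiser, together with valid candidates for the detectable change points that it misses, is a
stable set of at most `m* + 2` elements, and the added elements are its first or last ones: the
minimiser is a competitor (`GoodPath.mem_competitors_of_isCoveringMin`). Conversely, an output that
is not covering could be improved beyond the minimum, so every output is a minimiser
(`GoodPath.goodOutput_of_isPruned`).

**The probabilistic part.** The noise bounds with precision `r` are those of the hypotheses with
`a = b = r`, which is admissible since `1 ≤ r` and `r` is eventually below the strength of the
signal. The empirical second moment is controlled by the assumed law of large numbers or, for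
stationary ergodic errors, by the mean ergodic theorem in `L¹`
(`tendsto_eLpNorm_one_birkhoffAverage`). That theorem follows by approximation from von Neumann's
theorem in `L²`, since the functions that are invariant under an ergodic map are constant.
-/

namespace LocalPruning

/-! ### Segments of a fit and the effect of an additional break -/

/-- The residual sum of squares of `x` about its mean over `u < t ≤ v`. -/
noncomputable def segRss (x : ℕ → ℝ) (u v : ℕ) : ℝ :=
  ∑ t ∈ Finset.Ioc u v, (x t - segMean x u v) ^ 2

/-- The difference of the means of `x` to the right and to the left of `k` in `(u, v]`. -/
noncomputable def meanDiff (x : ℕ → ℝ) (u k v : ℕ) : ℝ := segMean x k v - segMean x u k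

/-- The weight `(k - u) (v - k) / (v - u)` with which a squared difference of means enters the
residual sum of squares. -/
noncomputable def weight (u k v : ℕ) : ℝ := ((k : ℝ) - u) * ((v : ℝ) - k) / ((v : ℝ) - u)

theorem rss_eq_sum_segRss (n : ℕ) (x : ℕ → ℝ) (A : Finset ℕ) :
    rss n x A = ∑ p ∈ segments n A, segRss x p.1 p.2 := rfl

theorem segRss_eq (x : ℕ → ℝ) {u v : ℕ} (h : u < v) :
    segRss x u v = ∑ t ∈ Finset.Ioc u v, x t ^ 2
      - (∑ t ∈ Finset.Ioc u v, x t) ^ 2 / ((v : ℝ) - u) := by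
  have hc : ((Finset.Ioc u v).card : ℝ) = (v : ℝ) - u := by
    rw [Nat.card_Ioc, Nat.cast_sub h.le]
  have hpos : (0 : ℝ) < (v : ℝ) - u := by
    have : (u : ℝ) < v := by exact_mod_cast h
    linarith
  unfold segRss
  simp only [sub_sq, Finset.sum_add_distrib, Finset.sum_sub_distrib, Finset.sum_const,
    nsmul_eq_mul, hc]
  rw [← Finset.sum_mul, ← Finset.mul_sum]
  unfold segMean
  field_simp
  ring

theorem sum_Ioc_add (g : ℕ → ℝ) {u k v : ℕ} (h1 : u ≤ k) (h2 : k ≤ v) :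
    ∑ t ∈ Finset.Ioc u k, g t + ∑ t ∈ Finset.Ioc k v, g t = ∑ t ∈ Finset.Ioc u v, g t := by
  rw [← Finset.sum_union (Finset.Ioc_disjoint_Ioc_of_le le_rfl), Finset.Ioc_union_Ioc_eq_Ioc h1 h2]

theorem segRss_split (x : ℕ → ℝ) {u k v : ℕ} (h1 : u < k) (h2 : k < v) :
    segRss x u v = segRss x u k + segRss x k v + weight u k v * meanDiff x u k v ^ 2 := by
  rw [segRss_eq x h1, segRss_eq x h2, segRss_eq x (h1.trans h2), ← sum_Ioc_add _ h1.le h2.le,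
    ← sum_Ioc_add x h1.le h2.le]
  unfold weight meanDiff segMean
  have h3 : (u : ℝ) < k := by exact_mod_cast h1
  have h4 : (k : ℝ) < v := by exact_mod_cast h2
  have h5 : (k : ℝ) - u ≠ 0 := by linarith
  have h6 : (v : ℝ) - k ≠ 0 := by linarith
  have h7 : (v : ℝ) - u ≠ 0 := by linarith
  field_simp
  ring

theorem weight_pos {u k v : ℕ} (h1 : u < k) (h2 : k < v) : 0 < weight u k v := by
  have h3 : (u : ℝ) < k := by exact_mod_cast h1
  have h4 : (k : ℝ) < v := by exact_mod_cast h2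
  unfold weight
  apply div_pos (mul_pos _ _) <;> linarith

theorem weight_le_left {u k v : ℕ} (h1 : u < k) (h2 : k < v) : weight u k v ≤ (k : ℝ) - u := by
  have h3 : (u : ℝ) < k := by exact_mod_cast h1
  have h4 : (k : ℝ) < v := by exact_mod_cast h2
  unfold weight
  rw [div_le_iff₀ (by linarith)]
  exact mul_le_mul_of_nonneg_left (by linarith) (by linarith)

theorem weight_le_right {u k v : ℕ} (h1 : u < k) (h2 : k < v) : weight u k v ≤ (v : ℝ) - k := by
  have h3 : (u : ℝ) < k := by exact_mod_cast h1
  have h4 : (k : ℝ) < v := by exact_mod_cast h2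
  unfold weight
  rw [div_le_iff₀ (by linarith), mul_comm]
  exact mul_le_mul_of_nonneg_left (by linarith) (by linarith)

theorem half_le_weight {u k v : ℕ} (h1 : u < k) (h2 : k < v) {L : ℝ} (hu : L ≤ (k : ℝ) - u)
    (hv : L ≤ (v : ℝ) - k) : L / 2 ≤ weight u k v := by
  have h3 : (u : ℝ) < k := by exact_mod_cast h1
  have h4 : (k : ℝ) < v := by exact_mod_cast h2
  unfold weight
  rw [le_div_iff₀ (by linarith)]
  nlinarith [mul_nonneg (sub_nonneg.2 hu) (sub_nonneg.2 h4.le),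
    mul_nonneg (sub_nonneg.2 hv) (sub_nonneg.2 h3.le)]

theorem zero_mem_breaks (n : ℕ) (A : Finset ℕ) : 0 ∈ breaks n A := Finset.mem_insert_self _ _

theorem last_mem_breaks (n : ℕ) (A : Finset ℕ) : n ∈ breaks n A :=
  Finset.mem_insert_of_mem (Finset.mem_insert_self _ _)

theorem subset_breaks (n : ℕ) (A : Finset ℕ) : A ⊆ breaks n A := fun _ h =>
  Finset.mem_insert_of_mem (Finset.mem_insert_of_mem h)

theorem breaks_insert (n k : ℕ) (A : Finset ℕ) : breaks n (insert k A) = insert k (breaks n A) := by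
  ext; simp only [breaks, Finset.mem_insert]; tauto

theorem mem_segments {n : ℕ} {A : Finset ℕ} {u v : ℕ} :
    (u, v) ∈ segments n A ↔ u ∈ breaks n A ∧ v ∈ breaks n A ∧ u < v ∧
      ∀ c ∈ breaks n A, c ≤ u ∨ v ≤ c := by
  simp only [segments, Finset.mem_filter, Finset.mem_product, and_assoc]
  have : ∀ c : ℕ, (¬ (u < c ∧ c < v)) ↔ (c ≤ u ∨ v ≤ c) := fun c => by omega
  simp only [this]

theorem segments_insert_of_mem {n k : ℕ} {A : Finset ℕ} (h : k ∈ breaks n A) :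
    segments n (insert k A) = segments n A := by
  unfold segments
  rw [breaks_insert, Finset.insert_eq_of_mem h]

theorem rss_insert_of_mem {n k : ℕ} {A : Finset ℕ} (x : ℕ → ℝ) (h : k ∈ breaks n A) :
    rss n x (insert k A) = rss n x A := by
  unfold rss
  rw [segments_insert_of_mem h]

theorem exists_segment {n k : ℕ} {A : Finset ℕ} (hk : k ∉ breaks n A) (hkn : k < n) :
    ∃ u v, (u, v) ∈ segments n A ∧ u < k ∧ k < v := by
  have hk0 : 0 < k := by
    rcases Nat.eq_zero_or_pos k with h | h
    · exact absurd (h ▸ zero_mem_breaks n A) hk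
    · exact h
  have hL : ((breaks n A).filter (· < k)).Nonempty :=
    ⟨0, Finset.mem_filter.2 ⟨zero_mem_breaks n A, hk0⟩⟩
  have hR : ((breaks n A).filter (k < ·)).Nonempty :=
    ⟨n, Finset.mem_filter.2 ⟨last_mem_breaks n A, hkn⟩⟩
  have hu := Finset.mem_filter.1 (Finset.max'_mem _ hL)
  have hv := Finset.mem_filter.1 (Finset.min'_mem _ hR)
  refine ⟨_, _, mem_segments.2 ⟨hu.1, hv.1, hu.2.trans hv.2, fun c hc => ?_⟩, hu.2, hv.2⟩
  rcases lt_trichotomy c k with h | h | h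
  · exact Or.inl (Finset.le_max' _ _ (Finset.mem_filter.2 ⟨hc, h⟩))
  · exact absurd (h ▸ hc) hk
  · exact Or.inr (Finset.min'_le _ _ (Finset.mem_filter.2 ⟨hc, h⟩))

theorem segments_insert {n k u v : ℕ} {A : Finset ℕ} (h : (u, v) ∈ segments n A) (h1 : u < k)
    (h2 : k < v) :
    segments n (insert k A) = insert (u, k) (insert (k, v) ((segments n A).erase (u, v))) := by
  obtain ⟨hu, hv, huv, hc⟩ := mem_segments.1 h
  ext ⟨a, b⟩
  simp only [Finset.mem_insert, Finset.mem_erase, mem_segments, breaks_insert, Prod.mk.injEq,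
    forall_eq_or_imp, ne_eq]
  constructor
  · rintro ⟨ha, hb, hab, hkab, hall⟩
    rcases ha with rfl | ha
    · right; left
      refine ⟨rfl, ?_⟩
      rcases hb with rfl | hb
      · omega
      · have := hc b hb
        have := hall v hv
        omega
    · rcases hb with rfl | hb
      · left
        refine ⟨?_, rfl⟩
        have := hc a ha
        have := hall u hu
        omega
      · right; right
        refine ⟨?_, ha, hb, hab, hall⟩
        rintro ⟨rfl, rfl⟩
        omega
  · rintro (⟨rfl, rfl⟩ | ⟨rfl, rfl⟩ | ⟨hne, ha, hb, hab, hall⟩)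
    · exact ⟨Or.inr hu, Or.inl rfl, h1, by omega, fun c hcc => by have := hc c hcc; omega⟩
    · exact ⟨Or.inl rfl, Or.inr hv, h2, by omega, fun c hcc => by have := hc c hcc; omega⟩
    · refine ⟨Or.inr ha, Or.inr hb, hab, ?_, hall⟩
      have := hc a ha
      have := hc b hb
      have := hall u hu
      have := hall v hv
      omega

/-- A new break `k` splits one segment `(u, v]` into `(u, k]` and `(k, v]`. -/
theorem sum_segments_insert {n k u v : ℕ} {A : Finset ℕ} (h : (u, v) ∈ segments n A) (h1 : u < k)
    (h2 : k < v) (φ : ℕ × ℕ → ℝ) :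
    ∑ p ∈ segments n (insert k A), φ p =
      ∑ p ∈ segments n A, φ p - φ (u, v) + φ (u, k) + φ (k, v) := by
  obtain ⟨-, -, -, hc⟩ := mem_segments.1 h
  rw [segments_insert h h1 h2, Finset.sum_insert, Finset.sum_insert, ← Finset.add_sum_erase _ _ h]
  · ring
  · simp only [Finset.mem_erase, mem_segments]
    rintro ⟨-, hk, -⟩
    have := hc k hk
    omega
  · simp only [Finset.mem_insert, Finset.mem_erase, mem_segments, Prod.mk.injEq]
    rintro (⟨h, -⟩ | ⟨-, -, hk, -⟩)
    · omega
    · have := hc k hk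
      omega

theorem rss_insert {n k u v : ℕ} {A : Finset ℕ} (x : ℕ → ℝ) (h : (u, v) ∈ segments n A)
    (h1 : u < k) (h2 : k < v) :
    rss n x (insert k A) = rss n x A - segRss x u v + segRss x u k + segRss x k v := by
  rw [rss_eq_sum_segRss, rss_eq_sum_segRss, sum_segments_insert h h1 h2]

theorem rss_eq_rss_insert_add {n k u v : ℕ} {A : Finset ℕ} (x : ℕ → ℝ)
    (h : (u, v) ∈ segments n A) (h1 : u < k) (h2 : k < v) :
    rss n x A = rss n x (insert k A) + weight u k v * meanDiff x u k v ^ 2 := by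
  rw [rss_insert x h h1 h2, segRss_split x h1 h2]
  ring

theorem rss_insert_le {n k : ℕ} {A : Finset ℕ} (x : ℕ → ℝ) (hk : k ≤ n) :
    rss n x (insert k A) ≤ rss n x A := by
  by_cases hb : k ∈ breaks n A
  · rw [rss_insert_of_mem x hb]
  · have hkn : k < n := lt_of_le_of_ne hk fun h => hb (h ▸ last_mem_breaks n A)
    obtain ⟨u, v, h, h1, h2⟩ := exists_segment hb hkn
    have := mul_nonneg (weight_pos h1 h2).le (sq_nonneg (meanDiff x u k v))
    linarith [rss_eq_rss_insert_add x h h1 h2]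

theorem rss_union_le {n : ℕ} (x : ℕ → ℝ) (A : Finset ℕ) {B : Finset ℕ} (hB : ∀ k ∈ B, k ≤ n) :
    rss n x (A ∪ B) ≤ rss n x A := by
  induction B using Finset.induction_on with
  | empty => simp
  | insert k B _ ih =>
    rw [Finset.union_insert]
    exact (rss_insert_le x (hB k (Finset.mem_insert_self _ _))).trans
      (ih fun k hk => hB k (Finset.mem_insert_of_mem hk))

theorem rss_anti {n : ℕ} (x : ℕ → ℝ) {A B : Finset ℕ} (hAB : A ⊆ B) (hB : ∀ k ∈ B, k ≤ n) :
    rss n x B ≤ rss n x A := by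
  rw [← Finset.union_eq_right.2 hAB]
  exact rss_union_le x A hB

theorem segments_empty {n : ℕ} (hn : 0 < n) : segments n ∅ = {(0, n)} := by
  ext ⟨a, b⟩
  simp only [mem_segments, breaks, Finset.mem_insert, Finset.notMem_empty, or_false,
    Finset.mem_singleton, Prod.mk.injEq, forall_eq_or_imp, forall_eq]
  omega

/-- The segments of a fit form a partition of the sample. -/
theorem sum_segments_sum_Ioc {n : ℕ} (hn : 0 < n) {A : Finset ℕ} (hA : ∀ k ∈ A, k ≤ n)
    (g : ℕ → ℝ) :
    ∑ p ∈ segments n A, ∑ t ∈ Finset.Ioc p.1 p.2, g t = ∑ t ∈ Finset.Ioc 0 n, g t := by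
  induction A using Finset.induction_on with
  | empty => simp [segments_empty hn]
  | insert k A _ ih =>
    have ih := ih fun k hk => hA k (Finset.mem_insert_of_mem hk)
    by_cases hb : k ∈ breaks n A
    · rw [segments_insert_of_mem hb, ih]
    · have hkn : k < n := lt_of_le_of_ne (hA k (Finset.mem_insert_self _ _))
        fun h => hb (h ▸ last_mem_breaks n A)
      obtain ⟨u, v, h, h1, h2⟩ := exists_segment hb hkn
      rw [sum_segments_insert h h1 h2, ih, ← sum_Ioc_add g h1.le h2.le]
      ring

theorem segRss_le (x : ℕ → ℝ) {u v : ℕ} (h : u < v) (m : ℝ) :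
    segRss x u v ≤ ∑ t ∈ Finset.Ioc u v, (x t - m) ^ 2 := by
  have hc : ((Finset.Ioc u v).card : ℝ) = (v : ℝ) - u := by
    rw [Nat.card_Ioc, Nat.cast_sub h.le]
  have hpos : (0 : ℝ) < (v : ℝ) - u := by
    have : (u : ℝ) < v := by exact_mod_cast h
    linarith
  rw [segRss_eq x h]
  simp only [sub_sq, Finset.sum_add_distrib, Finset.sum_sub_distrib, Finset.sum_const,
    nsmul_eq_mul, hc]
  rw [← Finset.sum_mul, ← Finset.mul_sum]
  set s := ∑ t ∈ Finset.Ioc u v, x t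
  have : ((v : ℝ) - u) * (s / ((v : ℝ) - u)) = s := by field_simp
  have h2 : s ^ 2 / ((v : ℝ) - u) = ((v : ℝ) - u) * (s / ((v : ℝ) - u)) ^ 2 := by field_simp
  rw [h2]
  have h3 := mul_nonneg hpos.le (sq_nonneg (s / ((v : ℝ) - u) - m))
  have h4 : ((v : ℝ) - u) * (s / ((v : ℝ) - u) - m) ^ 2 = ((v : ℝ) - u) * (s / ((v : ℝ) - u)) ^ 2
      - 2 * (((v : ℝ) - u) * (s / ((v : ℝ) - u))) * m + ((v : ℝ) - u) * m ^ 2 := by ring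
  rw [this] at h4
  linarith

/-- The residual sum of squares is at most the squared distance to any function that is constant on
the segments. -/
theorem rss_le_of_const {n : ℕ} (hn : 0 < n) {A : Finset ℕ} (hA : ∀ k ∈ A, k ≤ n) (x g : ℕ → ℝ)
    (hg : ∀ u v, (u, v) ∈ segments n A → ∀ t ∈ Finset.Ioc u v, g t = g v) :
    rss n x A ≤ ∑ t ∈ Finset.Ioc 0 n, (x t - g t) ^ 2 := by
  rw [← sum_segments_sum_Ioc hn hA, rss_eq_sum_segRss]
  refine Finset.sum_le_sum fun p hp => ?_
  obtain ⟨u, v⟩ := p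
  refine (segRss_le x (mem_segments.1 hp).2.2.1 (g v)).trans (le_of_eq ?_)
  exact Finset.sum_congr rfl fun t ht => by rw [hg u v hp t ht]

/-- If the mean of `x` over `P` is closer to `m` than to `m + M`, then `m` fits `x` better on `P`
than `m + M`. -/
theorem sum_sq_lt_of_move {P : Finset ℕ} (x : ℕ → ℝ) (m M : ℝ)
    (h : 2 * |∑ t ∈ P, (x t - m)| < P.card * |M|) :
    ∑ t ∈ P, (x t - m) ^ 2 < ∑ t ∈ P, (x t - (m + M)) ^ 2 := by
  have e : ∑ t ∈ P, (x t - (m + M)) ^ 2 =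
      ∑ t ∈ P, (x t - m) ^ 2 + (P.card * M ^ 2 - 2 * M * ∑ t ∈ P, (x t - m)) := by
    have : ∀ t, (x t - (m + M)) ^ 2 = (x t - m) ^ 2 + (M ^ 2 - 2 * M * (x t - m)) :=
      fun t => by ring
    simp only [this, Finset.sum_add_distrib, Finset.sum_sub_distrib, Finset.sum_const,
      nsmul_eq_mul, ← Finset.mul_sum]
  rw [e]
  have hM : 0 < |M| := by
    rcases eq_or_lt_of_le (abs_nonneg M) with h0 | h0
    · rw [← h0, mul_zero] at h
      linarith [abs_nonneg (∑ t ∈ P, (x t - m))]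
    · exact h0
  have h1 : M * ∑ t ∈ P, (x t - m) ≤ |M| * |∑ t ∈ P, (x t - m)| := by
    rw [← abs_mul]; exact le_abs_self _
  have h2 := mul_lt_mul_of_pos_left h hM
  have h3 : |M| * (P.card * |M|) = P.card * M ^ 2 := by rw [← sq_abs M]; ring
  linarith

theorem sum_sub_segMean (x : ℕ → ℝ) {a b : ℕ} (h : a < b) (m : ℝ) :
    ∑ t ∈ Finset.Ioc a b, (x t - m) = ((b : ℝ) - a) * (segMean x a b - m) := by
  have hc : ((Finset.Ioc a b).card : ℝ) = (b : ℝ) - a := by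
    rw [Nat.card_Ioc, Nat.cast_sub h.le]
  have hpos : (0 : ℝ) < (b : ℝ) - a := sub_pos.2 (by exact_mod_cast h)
  rw [Finset.sum_sub_distrib, Finset.sum_const, nsmul_eq_mul, hc]
  unfold segMean
  field_simp

/-- Moving a break from `y` to the right, to `k`, improves the fit if the mean over `(y, k]` is
closer to the mean on the left than to the mean on the right of `y`. -/
theorem segRss_move_right (x : ℕ → ℝ) {u y k v : ℕ} (h1 : u < y) (h2 : y < k) (h3 : k < v)
    (h : 2 * |meanDiff x u y k| < |meanDiff x u y v|) :
    segRss x u k + segRss x k v < segRss x u y + segRss x y v := by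
  have hc : ((Finset.Ioc y k).card : ℝ) = (k : ℝ) - y := by
    rw [Nat.card_Ioc, Nat.cast_sub h2.le]
  have hpos : (0 : ℝ) < (k : ℝ) - y := sub_pos.2 (by exact_mod_cast h2)
  have e1 := segRss_le x (h1.trans h2) (segMean x u y)
  have e2 := segRss_le x h3 (segMean x y v)
  have e3 := sum_sq_lt_of_move x (segMean x u y) (meanDiff x u y v)
    (P := Finset.Ioc y k) (by
      rw [hc, sum_sub_segMean x h2, abs_mul, abs_of_pos hpos]
      have := mul_lt_mul_of_pos_left h hpos
      unfold meanDiff at *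
      linarith)
  rw [show segMean x u y + meanDiff x u y v = segMean x y v by unfold meanDiff; ring] at e3
  rw [← sum_Ioc_add _ h1.le h2.le] at e1
  have e4 : segRss x y v = ∑ t ∈ Finset.Ioc y k, (x t - segMean x y v) ^ 2 +
      ∑ t ∈ Finset.Ioc k v, (x t - segMean x y v) ^ 2 := (sum_Ioc_add _ h2.le h3.le).symm
  rw [e4]
  unfold segRss at *
  linarith

/-- Moving a break from `y` to the left, to `k`, improves the fit if the mean over `(k, y]` is
closer to the mean on the right than to the mean on the left of `y`. -/
theorem segRss_move_left (x : ℕ → ℝ) {u k y v : ℕ} (h1 : u < k) (h2 : k < y) (h3 : y < v)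
    (h : 2 * |meanDiff x k y v| < |meanDiff x u y v|) :
    segRss x u k + segRss x k v < segRss x u y + segRss x y v := by
  have hc : ((Finset.Ioc k y).card : ℝ) = (y : ℝ) - k := by
    rw [Nat.card_Ioc, Nat.cast_sub h2.le]
  have hpos : (0 : ℝ) < (y : ℝ) - k := sub_pos.2 (by exact_mod_cast h2)
  have e1 := segRss_le x h1 (segMean x u y)
  have e2 := segRss_le x (h2.trans h3) (segMean x y v)
  have e3 := sum_sq_lt_of_move x (segMean x y v) (-meanDiff x u y v)
    (P := Finset.Ioc k y) (by
      rw [hc, sum_sub_segMean x h2, abs_mul, abs_of_pos hpos, abs_neg]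
      have := mul_lt_mul_of_pos_left h hpos
      unfold meanDiff at *
      rw [abs_sub_comm (segMean x y v) (segMean x k y)] at this
      linarith)
  rw [show segMean x y v + -meanDiff x u y v = segMean x u y by unfold meanDiff; ring] at e3
  rw [← sum_Ioc_add _ h2.le h3.le] at e2
  have e4 : segRss x u y = ∑ t ∈ Finset.Ioc u k, (x t - segMean x u y) ^ 2 +
      ∑ t ∈ Finset.Ioc k y, (x t - segMean x u y) ^ 2 := (sum_Ioc_add _ h1.le h2.le).symm
  rw [e4]
  unfold segRss at *
  linarith

/-! ### Step functions and differences of means -/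

/-- The step function `1{t ≥ θ + 1}`. -/
noncomputable def step (θ t : ℕ) : ℝ := if θ + 1 ≤ t then 1 else 0

theorem sum_step {u θ v : ℕ} (h1 : u ≤ θ) (h2 : θ ≤ v) :
    ∑ t ∈ Finset.Ioc u v, step θ t = (v : ℝ) - θ := by
  rw [← sum_Ioc_add _ h1 h2]
  have e1 : ∑ t ∈ Finset.Ioc u θ, step θ t = 0 :=
    Finset.sum_eq_zero fun t ht => by
      have := (Finset.mem_Ioc.1 ht).2
      exact if_neg (by omega)
  have e2 : ∑ t ∈ Finset.Ioc θ v, step θ t = ∑ t ∈ Finset.Ioc θ v, (1 : ℝ) :=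
    Finset.sum_congr rfl fun t ht => by
      have := (Finset.mem_Ioc.1 ht).1
      exact if_pos (by omega)
  rw [e1, e2]
  simp [Nat.cast_sub h2]

theorem sum_step_of_le {u θ v : ℕ} (h1 : θ ≤ u) (h2 : u ≤ v) :
    ∑ t ∈ Finset.Ioc u v, step θ t = (v : ℝ) - u := by
  have e2 : ∑ t ∈ Finset.Ioc u v, step θ t = ∑ t ∈ Finset.Ioc u v, (1 : ℝ) :=
    Finset.sum_congr rfl fun t ht => by
      have := (Finset.mem_Ioc.1 ht).1
      exact if_pos (by omega)
  rw [e2]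
  simp [Nat.cast_sub h2]

theorem sum_step_of_ge {u θ v : ℕ} (h : v ≤ θ) : ∑ t ∈ Finset.Ioc u v, step θ t = 0 :=
  Finset.sum_eq_zero fun t ht => by
    have := (Finset.mem_Ioc.1 ht).2
    exact if_neg (by omega)

theorem cast_sub_pos {u v : ℕ} (h : u < v) : (0 : ℝ) < (v : ℝ) - u :=
  sub_pos.2 (by exact_mod_cast h)

theorem meanDiff_step_outside {u k v θ : ℕ} (h1 : u < k) (h2 : k < v) (h : ¬ (u < θ ∧ θ < v)) :
    meanDiff (step θ) u k v = 0 := by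
  unfold meanDiff segMean
  rcases le_or_gt θ u with h3 | h3
  · rw [sum_step_of_le h3 h1.le, sum_step_of_le (h3.trans h1.le) h2.le,
      div_self (cast_sub_pos h1).ne', div_self (cast_sub_pos h2).ne', sub_self]
  · have h4 : v ≤ θ := by omega
    rw [sum_step_of_ge h4, sum_step_of_ge (h2.le.trans h4)]
    simp

theorem meanDiff_step_left {u k v θ : ℕ} (h1 : u < k) (h2 : k < v) (h3 : u ≤ θ) (h4 : θ ≤ k) :
    meanDiff (step θ) u k v = ((θ : ℝ) - u) / ((k : ℝ) - u) := by
  unfold meanDiff segMean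
  rw [sum_step h3 h4, sum_step_of_le h4 h2.le, div_self (cast_sub_pos h2).ne']
  have := cast_sub_pos h1
  field_simp
  ring

theorem meanDiff_step_right {u k v θ : ℕ} (h3 : k ≤ θ) (h4 : θ ≤ v) :
    meanDiff (step θ) u k v = ((v : ℝ) - θ) / ((v : ℝ) - k) := by
  unfold meanDiff segMean
  rw [sum_step h3 h4, sum_step_of_ge h3]
  simp

theorem meanDiff_step_nonneg {u k v θ : ℕ} (h1 : u < k) (h2 : k < v) (h3 : u ≤ θ) (h4 : θ ≤ v) :
    0 ≤ meanDiff (step θ) u k v := by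
  have hu : (u : ℝ) ≤ θ := by exact_mod_cast h3
  have hv : (θ : ℝ) ≤ v := by exact_mod_cast h4
  rcases le_total θ k with h | h
  · rw [meanDiff_step_left h1 h2 h3 h]
    exact div_nonneg (by linarith) (cast_sub_pos h1).le
  · rw [meanDiff_step_right h h4]
    exact div_nonneg (by linarith) (cast_sub_pos h2).le

theorem meanDiff_step_le_one {u k v θ : ℕ} (h1 : u < k) (h2 : k < v) (h3 : u ≤ θ) (h4 : θ ≤ v) :
    meanDiff (step θ) u k v ≤ 1 := by
  rcases le_total θ k with h | h
  · have : (θ : ℝ) ≤ k := by exact_mod_cast h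
    rw [meanDiff_step_left h1 h2 h3 h, div_le_one (cast_sub_pos h1)]
    linarith
  · have : (k : ℝ) ≤ θ := by exact_mod_cast h
    rw [meanDiff_step_right h h4, div_le_one (cast_sub_pos h2)]
    linarith

theorem weight_mul_meanDiff_step_left_le {u k v θ : ℕ} (h1 : u < k) (h2 : k < v) (h3 : u ≤ θ)
    (h4 : θ ≤ k) :
    weight u k v * meanDiff (step θ) u k v ^ 2 ≤ ((θ : ℝ) - u) ^ 2 / ((k : ℝ) - u) := by
  have hp := cast_sub_pos h1
  refine (mul_le_mul_of_nonneg_right (weight_le_left h1 h2) (sq_nonneg _)).trans (le_of_eq ?_)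
  rw [meanDiff_step_left h1 h2 h3 h4]
  field_simp

theorem weight_mul_meanDiff_step_right_le {u k v θ : ℕ} (h1 : u < k) (h2 : k < v) (h3 : k ≤ θ)
    (h4 : θ ≤ v) :
    weight u k v * meanDiff (step θ) u k v ^ 2 ≤ ((v : ℝ) - θ) ^ 2 / ((v : ℝ) - k) := by
  have hp := cast_sub_pos h2
  refine (mul_le_mul_of_nonneg_right (weight_le_right h1 h2) (sq_nonneg _)).trans (le_of_eq ?_)
  rw [meanDiff_step_right h3 h4]
  field_simp

/-- A unit step close to an end of the segment is hardly visible at any `k`. -/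
theorem weight_mul_meanDiff_step_le_min {u k v θ : ℕ} (h1 : u < k) (h2 : k < v) (h3 : u ≤ θ)
    (h4 : θ ≤ v) :
    weight u k v * meanDiff (step θ) u k v ^ 2 ≤ min ((θ : ℝ) - u) ((v : ℝ) - θ) := by
  have hu : (u : ℝ) ≤ θ := by exact_mod_cast h3
  have hv : (θ : ℝ) ≤ v := by exact_mod_cast h4
  have hm : meanDiff (step θ) u k v ^ 2 ≤ 1 :=
    pow_le_one₀ (meanDiff_step_nonneg h1 h2 h3 h4) (meanDiff_step_le_one h1 h2 h3 h4)
  have hw := (weight_pos h1 h2).le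
  rcases le_total θ k with h | h
  · have hk : (θ : ℝ) ≤ k := by exact_mod_cast h
    refine le_min ((weight_mul_meanDiff_step_left_le h1 h2 h3 h).trans ?_) ?_
    · rw [div_le_iff₀ (cast_sub_pos h1)]
      nlinarith
    · have := mul_le_mul_of_nonneg_left hm hw
      linarith [weight_le_right h1 h2]
  · have hk : (k : ℝ) ≤ θ := by exact_mod_cast h
    refine le_min ?_ ((weight_mul_meanDiff_step_right_le h1 h2 h h4).trans ?_)
    · have := mul_le_mul_of_nonneg_left hm hw
      linarith [weight_le_left h1 h2]
    · rw [div_le_iff₀ (cast_sub_pos h2)]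
      nlinarith

/-- A step within `τ` of an end of the segment, at a distance of at least `ζ > τ` from `k`. -/
theorem meanDiff_step_far {u k v θ : ℕ} (h1 : u < k) (h2 : k < v) (h3 : u ≤ θ) (h4 : θ ≤ v)
    {τ ζ : ℝ} (hτ : min ((θ : ℝ) - u) ((v : ℝ) - θ) ≤ τ) (hζ : ζ ≤ |(k : ℝ) - θ|) (hτζ : τ < ζ) :
    meanDiff (step θ) u k v ≤ τ / ζ ∧ weight u k v * meanDiff (step θ) u k v ^ 2 ≤ τ ^ 2 / ζ := by
  have hu : (u : ℝ) ≤ θ := by exact_mod_cast h3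
  have hv : (θ : ℝ) ≤ v := by exact_mod_cast h4
  have hk1 := cast_sub_pos h1
  have hk2 := cast_sub_pos h2
  have hτ0 : 0 ≤ τ := (le_min (by linarith) (by linarith)).trans hτ
  rcases le_total θ k with h | h
  · have hk : (θ : ℝ) ≤ k := by exact_mod_cast h
    rw [abs_of_nonneg (by linarith)] at hζ
    have hle : (θ : ℝ) - u ≤ τ := by
      rcases min_le_iff.1 hτ with h | h
      · exact h
      · linarith
    constructor
    · rw [meanDiff_step_left h1 h2 h3 h]
      exact div_le_div₀ hτ0 hle (by linarith) (by linarith)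
    · refine (weight_mul_meanDiff_step_left_le h1 h2 h3 h).trans ?_
      exact div_le_div₀ (sq_nonneg _) (pow_le_pow_left₀ (by linarith) hle 2) (by linarith)
        (by linarith)
  · have hk : (k : ℝ) ≤ θ := by exact_mod_cast h
    rw [abs_of_nonpos (by linarith)] at hζ
    have hle : (v : ℝ) - θ ≤ τ := by
      rcases min_le_iff.1 hτ with h | h
      · linarith
      · exact h
    constructor
    · rw [meanDiff_step_right h h4]
      exact div_le_div₀ hτ0 hle (by linarith) (by linarith)
    · refine (weight_mul_meanDiff_step_right_le h1 h2 h h4).trans ?_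
      exact div_le_div₀ (sq_nonneg _) (pow_le_pow_left₀ (by linarith) hle 2) (by linarith)
        (by linarith)

theorem segMean_obs {n : ℕ} (S : Signal n) (ε : ℕ → ℝ) {u v : ℕ} (h : u < v) :
    segMean (S.obs ε) u v =
      S.base + ∑ i ∈ Finset.Icc 1 S.q, S.d i * segMean (step (S.θ i)) u v + segMean ε u v := by
  have hp := (cast_sub_pos h).ne'
  have hc : ((Finset.Ioc u v).card : ℝ) = (v : ℝ) - u := by
    rw [Nat.card_Ioc, Nat.cast_sub h.le]
  unfold segMean Signal.obs Signal.mean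
  simp only [Finset.sum_add_distrib, Finset.sum_const, nsmul_eq_mul, hc, add_div,
    mul_div_cancel_left₀ _ hp]
  rw [Finset.sum_comm, Finset.sum_div]
  congr 2
  refine Finset.sum_congr rfl fun i _ => ?_
  rw [← Finset.mul_sum, mul_div_assoc]
  rfl

theorem meanDiff_obs {n : ℕ} (S : Signal n) (ε : ℕ → ℝ) {u k v : ℕ} (h1 : u < k) (h2 : k < v) :
    meanDiff (S.obs ε) u k v =
      ∑ i ∈ Finset.Icc 1 S.q, S.d i * meanDiff (step (S.θ i)) u k v + meanDiff ε u k v := by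
  unfold meanDiff
  rw [segMean_obs S ε h1, segMean_obs S ε h2]
  simp only [mul_sub, Finset.sum_sub_distrib]
  ring

theorem abs_segMean_le_of_noiseAll {n : ℕ} {ε : ℕ → ℝ} {w : ℝ} (hε : NoiseAll n ε w) {u v : ℕ}
    (h : u < v) (hv : v ≤ n) : |segMean ε u v| ≤ w / Real.sqrt ((v : ℝ) - u) := by
  have hp := cast_sub_pos h
  have hs := Real.sqrt_pos.2 hp
  have := hε u v h hv
  unfold segMean
  rw [abs_div, abs_of_pos hp, le_div_iff₀ hs]
  calc _ = 1 / Real.sqrt ((v : ℝ) - u) * |∑ t ∈ Finset.Ioc u v, ε t| := by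
        nth_rewrite 1 [← Real.mul_self_sqrt hp.le]
        field_simp
    _ ≤ w := this

theorem sqrt_weight_mul_abs_meanDiff_le {n : ℕ} {ε : ℕ → ℝ} {w : ℝ} (hε : NoiseAll n ε w)
    {u k v : ℕ} (h1 : u < k) (h2 : k < v) (hv : v ≤ n) :
    Real.sqrt (weight u k v) * |meanDiff ε u k v| ≤ 2 * w := by
  have e1 := abs_segMean_le_of_noiseAll hε h1 (h2.le.trans hv)
  have e2 := abs_segMean_le_of_noiseAll hε h2 hv
  have s1 := Real.sqrt_pos.2 (cast_sub_pos h1)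
  have s2 := Real.sqrt_pos.2 (cast_sub_pos h2)
  rw [le_div_iff₀ s1] at e1
  rw [le_div_iff₀ s2] at e2
  have w1 := Real.sqrt_le_sqrt (weight_le_left h1 h2)
  have w2 := Real.sqrt_le_sqrt (weight_le_right h1 h2)
  have h3 : |meanDiff ε u k v| ≤ |segMean ε k v| + |segMean ε u k| := abs_sub _ _
  have h4 := mul_le_mul_of_nonneg_left h3 (Real.sqrt_nonneg (weight u k v))
  have h5 := mul_le_mul_of_nonneg_right w1 (abs_nonneg (segMean ε u k))
  have h6 := mul_le_mul_of_nonneg_right w2 (abs_nonneg (segMean ε k v))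
  nlinarith

/-! ### Separation of the change points -/

namespace Signal

variable {n : ℕ} (S : Signal n)

/-- The distance of `k` from the `j`-th change point on the scale `1 / d_j ^ 2`. -/
noncomputable def scaledDist (j k : ℕ) : ℝ := S.d j ^ 2 * |(k : ℝ) - S.θ j|

/-- All change points satisfy `D ≤ d_j ^ 2 * δ_j`. -/
def Separated (D : ℝ) : Prop := ∀ j ∈ Finset.Icc 1 S.q, D ≤ S.d j ^ 2 * (S.gap j : ℝ)

variable {S}

theorem d_sq_pos {j : ℕ} (hj : j ∈ Finset.Icc 1 S.q) : 0 < S.d j ^ 2 := by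
  have := S.d_ne j hj
  positivity

theorem θ_lt_of_lt {i j : ℕ} (hij : i < j) (hj : j ∈ Finset.Icc 1 S.q) : S.θ i < S.θ j := by
  induction j, hij using Nat.le_induction with
  | base => simpa using (S.θ_lt _ hj).1
  | succ m hm ih =>
    have h1 := (S.θ_lt _ hj).1
    have h2 := ih (by rw [Finset.mem_Icc] at *; omega)
    simp only [Nat.add_sub_cancel] at h1
    omega

theorem gap_le_abs {i j : ℕ} (hi : i ∈ Finset.Icc 1 S.q) (hj : j ∈ Finset.Icc 1 S.q)
    (hij : i ≠ j) : (S.gap i : ℝ) ≤ |(S.θ i : ℝ) - S.θ j| := by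
  rcases lt_or_gt_of_ne hij with h | h
  · have h1 : S.gap i ≤ S.θ (i + 1) - S.θ i := min_le_right _ _
    have h2 : S.θ (i + 1) ≤ S.θ j := by
      rcases eq_or_lt_of_le (Nat.succ_le_of_lt h) with h | h
      · rw [← h]
      · exact (θ_lt_of_lt h hj).le
    have h3 := θ_lt_of_lt h hj
    have h4 : S.gap i + S.θ i ≤ S.θ j := by
      have := (S.θ_lt i hi).2
      omega
    have h5 : (S.gap i : ℝ) + S.θ i ≤ S.θ j := by exact_mod_cast h4
    rw [abs_sub_comm]
    exact le_trans (by linarith) (le_abs_self _)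
  · have h1 : S.gap i ≤ S.θ i - S.θ (i - 1) := min_le_left _ _
    have h2 : S.θ j ≤ S.θ (i - 1) := by
      rcases eq_or_lt_of_le (Nat.le_sub_one_of_lt h) with h | h
      · rw [← h]
      · exact (θ_lt_of_lt h (by rw [Finset.mem_Icc] at *; omega)).le
    have h4 : S.gap i + S.θ j ≤ S.θ i := by
      have := (S.θ_lt i hi).1
      omega
    have h5 : (S.gap i : ℝ) + S.θ j ≤ S.θ i := by exact_mod_cast h4
    exact le_trans (by linarith) (le_abs_self _)

variable {D : ℝ}

theorem Separated.le_dist (h : S.Separated D) {i j : ℕ} (hi : i ∈ Finset.Icc 1 S.q)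
    (hj : j ∈ Finset.Icc 1 S.q) (hij : i ≠ j) : D ≤ S.d i ^ 2 * |(S.θ i : ℝ) - S.θ j| :=
  (h i hi).trans (mul_le_mul_of_nonneg_left (gap_le_abs hi hj hij) (sq_nonneg _))

/-- Near one change point, all other ones are far away. -/
theorem Separated.far (h : S.Separated D) {i j y : ℕ} (hi : i ∈ Finset.Icc 1 S.q)
    (hj : j ∈ Finset.Icc 1 S.q) (hij : i ≠ j) (hy : S.scaledDist j y ≤ D / 4) :
    |(y : ℝ) - S.θ j| ≤ |(S.θ i : ℝ) - S.θ j| / 4 ∧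
      3 / 4 * |(S.θ i : ℝ) - S.θ j| ≤ |(y : ℝ) - S.θ i| := by
  have h1 := h.le_dist hj hi hij.symm
  have hd := d_sq_pos hj
  rw [abs_sub_comm] at h1
  have h2 : |(y : ℝ) - S.θ j| ≤ |(S.θ i : ℝ) - S.θ j| / 4 := by
    unfold scaledDist at hy
    by_contra hc
    push Not at hc
    nlinarith [mul_lt_mul_of_pos_left hc hd]
  refine ⟨h2, ?_⟩
  have h3 := abs_sub_le (S.θ i : ℝ) y (S.θ j)
  rw [abs_sub_comm (S.θ i : ℝ) y] at h3
  linarith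

theorem Separated.far_scaledDist (h : S.Separated D) {i j y : ℕ} (hi : i ∈ Finset.Icc 1 S.q)
    (hj : j ∈ Finset.Icc 1 S.q) (hij : i ≠ j) (hy : S.scaledDist j y ≤ D / 4) :
    3 / 4 * D ≤ S.scaledDist i y := by
  have h1 := (h.far hi hj hij hy).2
  have h2 := h.le_dist hi hj hij
  have := mul_le_mul_of_nonneg_left h1 (sq_nonneg (S.d i))
  unfold scaledDist
  linarith

theorem Separated.far_mul (h : S.Separated D) (hD : 0 ≤ D) {i j y : ℕ}
    (hi : i ∈ Finset.Icc 1 S.q) (hj : j ∈ Finset.Icc 1 S.q) (hij : i ≠ j)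
    (hy : S.scaledDist j y ≤ D / 4) :
    3 / 4 * D ≤ |S.d i| * |S.d j| * |(y : ℝ) - S.θ i| := by
  have h1 := (h.far hi hj hij hy).2
  have h2 := h.le_dist hi hj hij
  have h3 := h.le_dist hj hi hij.symm
  rw [abs_sub_comm] at h3
  have h4 : D ≤ |S.d i| * |S.d j| * |(S.θ i : ℝ) - S.θ j| := by
    refine (sq_le_sq₀ hD (by positivity)).1 ?_
    have := mul_le_mul h2 h3 hD (by positivity)
    rw [mul_pow, mul_pow, sq_abs, sq_abs]
    nlinarith
  have := mul_le_mul_of_nonneg_left h1 (mul_nonneg (abs_nonneg (S.d i)) (abs_nonneg (S.d j)))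
  linarith

/-- At most two separated change points in `(u, v)` are close to an end. -/
theorem Separated.card_edge_le (h : S.Separated D) {τ : ℝ} (hτ : τ < D) {u v : ℕ}
    {I : Finset ℕ} (hI : ∀ i ∈ I, i ∈ Finset.Icc 1 S.q ∧ u < S.θ i ∧ S.θ i < v ∧
      S.d i ^ 2 * min ((S.θ i : ℝ) - u) ((v : ℝ) - S.θ i) ≤ τ) : I.card ≤ 2 := by
  classical
  have hL : (I.filter fun i => S.d i ^ 2 * ((S.θ i : ℝ) - u) ≤ τ).card ≤ 1 := by
    refine Finset.card_le_one.2 fun a ha b hb => ?_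
    by_contra hab
    wlog hlt : S.θ a ≤ S.θ b generalizing a b
    · exact this b hb a ha (Ne.symm hab) (le_of_not_ge hlt)
    rw [Finset.mem_filter] at ha hb
    have h1 := h.le_dist (hI b hb.1).1 (hI a ha.1).1 (Ne.symm hab)
    have h2 : (S.θ a : ℝ) ≤ S.θ b := by exact_mod_cast hlt
    have h3 : (u : ℝ) < S.θ a := by exact_mod_cast (hI a ha.1).2.1
    rw [abs_of_nonneg (by linarith)] at h1
    have := mul_le_mul_of_nonneg_left (sub_le_sub_left h3.le (S.θ b : ℝ)) (sq_nonneg (S.d b))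
    linarith [hb.2]
  have hR : (I.filter fun i => S.d i ^ 2 * ((v : ℝ) - S.θ i) ≤ τ).card ≤ 1 := by
    refine Finset.card_le_one.2 fun a ha b hb => ?_
    by_contra hab
    wlog hlt : S.θ a ≤ S.θ b generalizing a b
    · exact this b hb a ha (Ne.symm hab) (le_of_not_ge hlt)
    rw [Finset.mem_filter] at ha hb
    have h1 := h.le_dist (hI a ha.1).1 (hI b hb.1).1 hab
    have h2 : (S.θ a : ℝ) ≤ S.θ b := by exact_mod_cast hlt
    have h3 : (S.θ b : ℝ) < v := by exact_mod_cast (hI b hb.1).2.2.1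
    rw [abs_of_nonpos (by linarith)] at h1
    have := mul_le_mul_of_nonneg_left (sub_le_sub_right h3.le (S.θ a : ℝ)) (sq_nonneg (S.d a))
    linarith [ha.2]
  have hsub : I ⊆ (I.filter fun i => S.d i ^ 2 * ((S.θ i : ℝ) - u) ≤ τ) ∪
      I.filter fun i => S.d i ^ 2 * ((v : ℝ) - S.θ i) ≤ τ := fun i hi => by
    have h4 := (hI i hi).2.2.2
    rw [mul_min_of_nonneg _ _ (sq_nonneg _)] at h4
    rw [Finset.mem_union, Finset.mem_filter, Finset.mem_filter]
    rcases min_le_iff.1 h4 with h | h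
    · exact Or.inl ⟨hi, h⟩
    · exact Or.inr ⟨hi, h⟩
  have := (Finset.card_le_card hsub).trans (Finset.card_union_le _ _)
  omega

theorem Separated.abs_sum_le (h : S.Separated D) {τ : ℝ} (hτ : τ < D) {u v : ℕ}
    {I : Finset ℕ} (hI : I ⊆ Finset.Icc 1 S.q) {a : ℕ → ℝ} {B : ℝ} (hB : 0 ≤ B)
    (h0 : ∀ i ∈ I, ¬ (u < S.θ i ∧ S.θ i < v) → a i = 0)
    (h1 : ∀ i ∈ I, u < S.θ i → S.θ i < v →
      S.d i ^ 2 * min ((S.θ i : ℝ) - u) ((v : ℝ) - S.θ i) ≤ τ ∧ |a i| ≤ B) :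
    |∑ i ∈ I, a i| ≤ 2 * B := by
  classical
  have e : ∑ i ∈ I, a i = ∑ i ∈ I.filter fun i => u < S.θ i ∧ S.θ i < v, a i := by
    rw [Finset.sum_filter]
    exact Finset.sum_congr rfl fun i hi => by
      split_ifs with hc
      · rfl
      · exact h0 i hi hc
  have hc := h.card_edge_le hτ (u := u) (v := v)
    (I := I.filter fun i => u < S.θ i ∧ S.θ i < v) fun i hi => by
      rw [Finset.mem_filter] at hi
      exact ⟨hI hi.1, hi.2.1, hi.2.2, (h1 i hi.1 hi.2.1 hi.2.2).1⟩
  rw [e]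
  refine (Finset.abs_sum_le_sum_abs _ _).trans
    ((Finset.sum_le_card_nsmul _ _ B fun i hi => ?_).trans ?_)
  · rw [Finset.mem_filter] at hi
    exact (h1 i hi.1 hi.2.1 hi.2.2).2
  · rw [nsmul_eq_mul]
    exact mul_le_mul_of_nonneg_right (by exact_mod_cast hc) hB

end Signal

/-! ### The effect of a single break -/

namespace Signal

variable {n : ℕ} {S : Signal n} {D : ℝ}

/-- Change points that are close to an end of the segment, or moderately close to an end but far
from `k`, contribute little to the statistic at `k`. -/
theorem Separated.abs_sum_cusum_le (h : S.Separated D) {c τ : ℝ} (hc : 0 < c) (hcτ : c ≤ τ)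
    (hτ : τ < D / 4) (hfar : 4 * τ ^ 2 ≤ c * D) {u k v : ℕ} (h1 : u < k) (h2 : k < v)
    {I : Finset ℕ} (hI : I ⊆ Finset.Icc 1 S.q)
    (hedge : ∀ i ∈ I, u < S.θ i → S.θ i < v →
      S.d i ^ 2 * min ((S.θ i : ℝ) - u) ((v : ℝ) - S.θ i) ≤ c ∨
      S.d i ^ 2 * min ((S.θ i : ℝ) - u) ((v : ℝ) - S.θ i) ≤ τ ∧ D / 4 ≤ S.scaledDist i k) :
    |∑ i ∈ I, S.d i * (Real.sqrt (weight u k v) * meanDiff (step (S.θ i)) u k v)| ≤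
      2 * Real.sqrt c := by
  have hD : 0 < D := by linarith
  refine h.abs_sum_le (τ := τ) (by linarith) hI (Real.sqrt_nonneg _) (u := u) (v := v)
    (fun i hi hout => by rw [meanDiff_step_outside h1 h2 hout]; simp) fun i hi hui hiv => ?_
  have hd := d_sq_pos (hI hi)
  refine ⟨?_, Real.abs_le_sqrt ?_⟩
  · rcases hedge i hi hui hiv with h | h
    · exact h.trans hcτ
    · exact h.1
  · rw [mul_pow, mul_pow, Real.sq_sqrt (weight_pos h1 h2).le]
    rcases hedge i hi hui hiv with h | ⟨h, hk⟩
    · exact (mul_le_mul_of_nonneg_left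
        (weight_mul_meanDiff_step_le_min h1 h2 hui.le hiv.le) hd.le).trans h
    · have h3 := (meanDiff_step_far h1 h2 hui.le hiv.le (τ := τ / S.d i ^ 2)
        (ζ := D / 4 / S.d i ^ 2) (by rw [le_div_iff₀ hd]; linarith)
        (by rw [div_le_iff₀ hd]; unfold scaledDist at hk; linarith)
        (div_lt_div_of_pos_right hτ hd)).2
      refine (mul_le_mul_of_nonneg_left h3 hd.le).trans ?_
      have e : S.d i ^ 2 * ((τ / S.d i ^ 2) ^ 2 / (D / 4 / S.d i ^ 2)) = 4 * τ ^ 2 / D := by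
        have := S.d_ne i (hI hi)
        field_simp
      rw [e, div_le_iff₀ hD]
      exact hfar

/-- The statistic at `k` is the sum of the contributions of the steps and of the noise. -/
theorem sqrt_weight_mul_meanDiff_obs (S : Signal n) (ε : ℕ → ℝ) {u k v : ℕ} (h1 : u < k)
    (h2 : k < v) :
    Real.sqrt (weight u k v) * meanDiff (S.obs ε) u k v =
      ∑ i ∈ Finset.Icc 1 S.q,
        S.d i * (Real.sqrt (weight u k v) * meanDiff (step (S.θ i)) u k v) +
      Real.sqrt (weight u k v) * meanDiff ε u k v := by
  rw [meanDiff_obs S ε h1 h2, mul_add, Finset.mul_sum]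
  congr 1
  exact Finset.sum_congr rfl fun i _ => by ring

theorem two_mul_le_sqrt {w c : ℝ} (hwc : 4 * w ^ 2 ≤ c) : 2 * w ≤ Real.sqrt c :=
  Real.le_sqrt_of_sq_le (by linarith [mul_pow (2 : ℝ) w 2])

/-- A superfluous break improves the residual sum of squares by little. -/
theorem Separated.weight_mul_meanDiff_sq_le (h : S.Separated D) {c τ w : ℝ} (hc : 0 < c)
    (hcτ : c ≤ τ) (hτ : τ < D / 4) (hfar : 4 * τ ^ 2 ≤ c * D) (hwc : 4 * w ^ 2 ≤ c)
    {ε : ℕ → ℝ} (hε : NoiseAll n ε w) {u k v : ℕ} (h1 : u < k) (h2 : k < v) (hv : v ≤ n)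
    (hedge : ∀ i ∈ Finset.Icc 1 S.q, u < S.θ i → S.θ i < v →
      S.d i ^ 2 * min ((S.θ i : ℝ) - u) ((v : ℝ) - S.θ i) ≤ c ∨
      S.d i ^ 2 * min ((S.θ i : ℝ) - u) ((v : ℝ) - S.θ i) ≤ τ ∧ D / 4 ≤ S.scaledDist i k) :
    weight u k v * meanDiff (S.obs ε) u k v ^ 2 ≤ 9 * c := by
  have e1 := h.abs_sum_cusum_le hc hcτ hτ hfar h1 h2 (Finset.Subset.refl _) hedge
  have e2 := sqrt_weight_mul_abs_meanDiff_le hε h1 h2 hv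
  have e3 := two_mul_le_sqrt hwc
  have e4 : |Real.sqrt (weight u k v) * meanDiff (S.obs ε) u k v| ≤ 3 * Real.sqrt c := by
    rw [sqrt_weight_mul_meanDiff_obs S ε h1 h2]
    refine (abs_add_le _ _).trans ?_
    rw [abs_mul, abs_of_nonneg (Real.sqrt_nonneg (weight u k v))]
    linarith
  have e5 := pow_le_pow_left₀ (abs_nonneg _) e4 2
  rw [sq_abs, mul_pow, mul_pow, Real.sq_sqrt (weight_pos h1 h2).le, Real.sq_sqrt hc.le] at e5
  linarith

/-- Near `θ_j`, the other change points contribute little to a difference of means. -/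
theorem Separated.abs_sum_meanDiff_le (h : S.Separated D) {τ : ℝ} (hτ0 : 0 ≤ τ)
    (hτ : τ < D / 4) {u y v j : ℕ} (h1 : u < y) (h2 : y < v) (hj : j ∈ Finset.Icc 1 S.q)
    (hy : S.scaledDist j y ≤ D / 4)
    (hedge : ∀ i ∈ Finset.Icc 1 S.q, i ≠ j → u < S.θ i → S.θ i < v →
      S.d i ^ 2 * min ((S.θ i : ℝ) - u) ((v : ℝ) - S.θ i) ≤ τ) :
    |∑ i ∈ (Finset.Icc 1 S.q).erase j, S.d i * meanDiff (step (S.θ i)) u y v| ≤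
      |S.d j| * (8 * τ / (3 * D)) := by
  have hD : 0 < D := by linarith
  have hdj : 0 < |S.d j| := abs_pos.2 (S.d_ne j hj)
  have := h.abs_sum_le (τ := τ) (by linarith) (Finset.erase_subset j (Finset.Icc 1 S.q))
    (u := u) (v := v) (a := fun i => S.d i * meanDiff (step (S.θ i)) u y v)
    (B := |S.d j| * (4 * τ / (3 * D))) (by positivity)
    (fun i hi hout => by simp only [meanDiff_step_outside h1 h2 hout, mul_zero])
    fun i hi hui hiv => by
      obtain ⟨hij, hi⟩ := Finset.mem_erase.1 hi
      have hd := d_sq_pos hi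
      have hdi : 0 < |S.d i| := abs_pos.2 (S.d_ne i hi)
      have he := hedge i hi hij hui hiv
      refine ⟨he, ?_⟩
      have hfar := h.far_scaledDist hi hj hij hy
      have hmul := h.far_mul hD.le hi hj hij hy
      unfold scaledDist at hfar
      have hpos : 0 < |(y : ℝ) - S.θ i| := by
        by_contra hc
        have : |(y : ℝ) - S.θ i| = 0 := le_antisymm (not_lt.1 hc) (abs_nonneg _)
        rw [this] at hfar
        linarith
      have h3 := (meanDiff_step_far h1 h2 hui.le hiv.le (τ := τ / S.d i ^ 2)
        (ζ := |(y : ℝ) - S.θ i|) (by rw [le_div_iff₀ hd]; linarith) le_rfl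
        (by rw [div_lt_iff₀ hd]; linarith)).1
      rw [abs_mul, abs_of_nonneg (meanDiff_step_nonneg h1 h2 hui.le hiv.le)]
      refine (mul_le_mul_of_nonneg_left h3 hdi.le).trans ?_
      have e : |S.d i| * (τ / S.d i ^ 2 / |(y : ℝ) - S.θ i|) =
          τ / (|S.d i| * |(y : ℝ) - S.θ i|) := by
        rw [← sq_abs (S.d i)]
        field_simp
      rw [e, div_le_iff₀ (by positivity)]
      have e2 : |S.d j| * (4 * τ / (3 * D)) * (|S.d i| * |(y : ℝ) - S.θ i|) =
        (4 * τ / (3 * D)) * (|S.d i| * |S.d j| * |(y : ℝ) - S.θ i|) := by ring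
      rw [e2]
      refine le_trans (le_of_eq ?_) (mul_le_mul_of_nonneg_left hmul (by positivity))
      field_simp
  refine this.trans (le_of_eq ?_)
  ring

theorem abs_segMean_le_mul {ε : ℕ → ℝ} {w : ℝ} (hw : 0 ≤ w) (hε : NoiseAll n ε w) {u v : ℕ}
    (h1 : u < v) (hv : v ≤ n) {d L : ℝ} (hL : 0 < L) (h : L ≤ d ^ 2 * ((v : ℝ) - u)) :
    |segMean ε u v| ≤ |d| * (w / Real.sqrt L) := by
  have hp := cast_sub_pos h1
  have h2 := Real.sqrt_le_sqrt h
  rw [Real.sqrt_mul (sq_nonneg _), Real.sqrt_sq_eq_abs] at h2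
  refine (abs_segMean_le_of_noiseAll hε h1 hv).trans ?_
  have s1 := Real.sqrt_pos.2 hp
  have s2 := Real.sqrt_pos.2 hL
  rw [← mul_div_assoc, div_le_div_iff₀ s1 s2]
  nlinarith [mul_le_mul_of_nonneg_left h2 hw]

/-- Near `θ_j`, the difference of means is essentially that of the `j`-th step. -/
theorem Separated.abs_meanDiff_sub_le (h : S.Separated D) {τ w : ℝ} (hτ0 : 0 ≤ τ)
    (hτ : τ < D / 4) {ε : ℕ → ℝ} (hw : 0 ≤ w) (hε : NoiseAll n ε w) {u y v j : ℕ} (h1 : u < y)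
    (h2 : y < v) (hv : v ≤ n) (hj : j ∈ Finset.Icc 1 S.q) (hy : S.scaledDist j y ≤ D / 4)
    (hedge : ∀ i ∈ Finset.Icc 1 S.q, i ≠ j → u < S.θ i → S.θ i < v →
      S.d i ^ 2 * min ((S.θ i : ℝ) - u) ((v : ℝ) - S.θ i) ≤ τ)
    {L : ℝ} (hL : 0 < L) (hLu : L ≤ S.d j ^ 2 * ((y : ℝ) - u))
    (hLv : L ≤ S.d j ^ 2 * ((v : ℝ) - y)) :
    |meanDiff (S.obs ε) u y v - S.d j * meanDiff (step (S.θ j)) u y v| ≤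
      |S.d j| * (8 * τ / (3 * D) + 2 * (w / Real.sqrt L)) := by
  have e1 := h.abs_sum_meanDiff_le hτ0 hτ h1 h2 hj hy hedge
  have e2 := abs_segMean_le_mul hw hε h1 (h2.le.trans hv) hL hLu
  have e3 := abs_segMean_le_mul hw hε h2 hv hL hLv
  have e4 : |meanDiff ε u y v| ≤ |segMean ε y v| + |segMean ε u y| := abs_sub _ _
  rw [meanDiff_obs S ε h1 h2, ← Finset.add_sum_erase _ _ hj, add_assoc, add_sub_cancel_left]
  refine (abs_add_le _ _).trans ?_
  linarith

/-- A valid candidate for a change point that is not covered by the fit improves the residual sum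
of squares substantially. -/
theorem Separated.le_weight_mul_meanDiff_sq (h : S.Separated D) {τ w ρ : ℝ} (hτ0 : 0 ≤ τ)
    (hτ : τ < D / 4) {ε : ℕ → ℝ} (hw : 0 ≤ w) (hε : NoiseAll n ε w) {u k v j : ℕ} (h1 : u < k)
    (h2 : k < v) (hv : v ≤ n) (hj : j ∈ Finset.Icc 1 S.q) (hk : S.scaledDist j k ≤ ρ)
    (hρD : ρ ≤ D / 4)
    (hedge : ∀ i ∈ Finset.Icc 1 S.q, i ≠ j → u < S.θ i → S.θ i < v →
      S.d i ^ 2 * min ((S.θ i : ℝ) - u) ((v : ℝ) - S.θ i) ≤ τ)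
    {L : ℝ} (hL : 0 < L) (hρL : 4 * ρ ≤ L) (hLu : L ≤ S.d j ^ 2 * ((S.θ j : ℝ) - u))
    (hLv : L ≤ S.d j ^ 2 * ((v : ℝ) - S.θ j))
    (hsmall : 8 * τ / (3 * D) + 2 * (w / Real.sqrt (L / 2)) ≤ 1 / 4) :
    L / 16 ≤ weight u k v * meanDiff (S.obs ε) u k v ^ 2 := by
  have hd := d_sq_pos hj
  have hdj : 0 < |S.d j| := abs_pos.2 (S.d_ne j hj)
  have hkρ : S.d j ^ 2 * |(k : ℝ) - S.θ j| ≤ ρ := hk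
  have a1 := mul_le_mul_of_nonneg_left (le_abs_self ((k : ℝ) - S.θ j)) hd.le
  have a2 := mul_le_mul_of_nonneg_left (neg_abs_le ((k : ℝ) - S.θ j)) hd.le
  have hku : L / 2 ≤ S.d j ^ 2 * ((k : ℝ) - u) := by linarith
  have hkv : L / 2 ≤ S.d j ^ 2 * ((v : ℝ) - k) := by linarith
  have huθ : u < S.θ j := by
    have : (0 : ℝ) < (S.θ j : ℝ) - u := pos_of_mul_pos_right (hL.trans_le hLu) hd.le
    exact_mod_cast sub_pos.1 this
  have hθv : S.θ j < v := by
    have : (0 : ℝ) < (v : ℝ) - S.θ j := pos_of_mul_pos_right (hL.trans_le hLv) hd.le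
    exact_mod_cast sub_pos.1 this
  have e := h.abs_meanDiff_sub_le hτ0 hτ hw hε h1 h2 hv hj (hk.trans hρD) hedge
    (half_pos hL) hku hkv
  have hm : 3 / 4 ≤ meanDiff (step (S.θ j)) u k v := by
    rcases le_total (S.θ j) k with hc | hc
    · rw [meanDiff_step_left h1 h2 huθ.le hc, le_div_iff₀ (cast_sub_pos h1)]
      refine le_of_mul_le_mul_left ?_ hd
      linarith
    · rw [meanDiff_step_right hc hθv.le, le_div_iff₀ (cast_sub_pos h2)]
      refine le_of_mul_le_mul_left ?_ hd
      linarith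
  have hM : |S.d j| / 2 ≤ |meanDiff (S.obs ε) u k v| := by
    have b1 : |S.d j| * (3 / 4) ≤ |S.d j * meanDiff (step (S.θ j)) u k v| := by
      rw [abs_mul, abs_of_nonneg (by linarith : 0 ≤ meanDiff (step (S.θ j)) u k v)]
      exact mul_le_mul_of_nonneg_left hm hdj.le
    have b2 := abs_sub_abs_le_abs_sub (S.d j * meanDiff (step (S.θ j)) u k v)
      (meanDiff (S.obs ε) u k v)
    rw [abs_sub_comm] at b2
    have b3 := mul_le_mul_of_nonneg_left hsmall hdj.le
    linarith
  have hW : L / 2 / S.d j ^ 2 / 2 ≤ weight u k v :=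
    half_le_weight h1 h2 (by rw [div_le_iff₀ hd]; linarith) (by rw [div_le_iff₀ hd]; linarith)
  have hM2 := pow_le_pow_left₀ (by positivity) hM 2
  rw [sq_abs, div_pow, sq_abs] at hM2
  refine le_trans (le_of_eq ?_) (mul_le_mul hW hM2 (by positivity) (weight_pos h1 h2).le)
  have := S.d_ne j hj
  field_simp
  norm_num

end Signal

/-- The partial sums of the errors. -/
noncomputable def psum (ε : ℕ → ℝ) (m : ℕ) : ℝ := ∑ t ∈ Finset.Ioc 0 m, ε t

theorem sum_Ioc_eq_psum_sub (ε : ℕ → ℝ) {a b : ℕ} (h : a ≤ b) :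
    ∑ t ∈ Finset.Ioc a b, ε t = psum ε b - psum ε a := by
  unfold psum
  rw [← sum_Ioc_add ε (Nat.zero_le a) h]
  ring

namespace Signal

variable {n : ℕ} {S : Signal n} {D : ℝ}

/-- Moving a break `y` that is near, but not acceptably near to `θ_j` to a valid candidate `k`
improves the residual sum of squares, provided that the fit sees the jump at `y`. -/
theorem Separated.segRss_move_lt (h : S.Separated D) {τ w ρ r η μ : ℝ} (hτ0 : 0 ≤ τ)
    (hτ : τ < D / 4) {ε : ℕ → ℝ} (hw : 0 ≤ w) (hε : NoiseAll n ε w) {u k y v j : ℕ}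
    (huk : u < k) (hkv : k < v) (huy : u < y) (hyv : y < v) (hv : v ≤ n)
    (hj : j ∈ Finset.Icc 1 S.q)
    (hk : S.scaledDist j k ≤ ρ) (hr : 0 < r) (hη : η ≤ 1 / 2) (hρr : ρ ≤ η * r)
    (hyr : r ≤ S.scaledDist j y) (hy : S.scaledDist j y ≤ D / 4)
    (hedge : ∀ i ∈ Finset.Icc 1 S.q, i ≠ j → u < S.θ i → S.θ i < v →
      S.d i ^ 2 * min ((S.θ i : ℝ) - u) ((v : ℝ) - S.θ i) ≤ τ)
    {L : ℝ} (hL : 0 < L) (hLu : L ≤ S.d j ^ 2 * ((y : ℝ) - u))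
    (hLv : L ≤ S.d j ^ 2 * ((v : ℝ) - y))
    (hfar : |psum ε y - psum ε (S.θ j)| ≤ η * |S.d j| * |(y : ℝ) - S.θ j|)
    (hnear : |psum ε k - psum ε (S.θ j)| ≤ η * r / |S.d j|)
    (hμ : μ ≤ meanDiff (step (S.θ j)) u y v)
    (hsmall : 12 * η + 8 * τ / D + 4 * (w / Real.sqrt L) < μ) :
    segRss (S.obs ε) u k + segRss (S.obs ε) k v <
      segRss (S.obs ε) u y + segRss (S.obs ε) y v := by
  have hD : 0 < D := by linarith
  have hd := d_sq_pos hj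
  have hdj : 0 < |S.d j| := abs_pos.2 (S.d_ne j hj)
  have hρ0 : 0 ≤ ρ := le_trans (mul_nonneg hd.le (abs_nonneg _)) hk
  have hη0 : 0 ≤ η := by
    by_contra hc
    linarith [mul_neg_of_neg_of_pos (not_le.1 hc) hr]
  unfold scaledDist at hk hyr
  set A : ℝ := |(y : ℝ) - S.θ j| with hA
  set B : ℝ := |(k : ℝ) - S.θ j| with hB
  have hBA : B ≤ η * A := by
    refine le_of_mul_le_mul_left ?_ hd
    have := mul_le_mul_of_nonneg_left hyr hη0
    linarith
  have hApos : 0 < A := pos_of_mul_pos_right (hr.trans_le hyr) hd.le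
  have hB2 : B ≤ A / 2 := hBA.trans (by
    linarith [mul_le_mul_of_nonneg_right hη hApos.le])
  -- the errors between `y` and `k`
  have hnoise : |psum ε y - psum ε k| ≤ 2 * η * |S.d j| * A := by
    have e1 : η * r / |S.d j| ≤ η * |S.d j| * A := by
      rw [div_le_iff₀ hdj]
      have := mul_le_mul_of_nonneg_left hyr hη0
      rw [← sq_abs] at this
      linarith
    have e2 := abs_sub_le (psum ε y) (psum ε (S.θ j)) (psum ε k)
    rw [abs_sub_comm (psum ε (S.θ j)) (psum ε k)] at e2
    linarith
  have hM : |S.d j| * (μ - 8 * τ / (3 * D) - 2 * (w / Real.sqrt L)) ≤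
      |meanDiff (S.obs ε) u y v| := by
    have e := h.abs_meanDiff_sub_le hτ0 hτ hw hε huy hyv hv hj hy hedge hL hLu hLv
    have b1 : |S.d j| * μ ≤ |S.d j * meanDiff (step (S.θ j)) u y v| := by
      rw [abs_mul]
      exact mul_le_mul_of_nonneg_left (hμ.trans (le_abs_self _)) hdj.le
    have b2 := abs_sub_abs_le_abs_sub (S.d j * meanDiff (step (S.θ j)) u y v)
      (meanDiff (S.obs ε) u y v)
    rw [abs_sub_comm] at b2
    linarith
  -- it remains to bound the difference of means across `y` when one side is cut off at `k`
  have hfin : ∀ x : ℝ, x ≤ |S.d j| * (6 * η + 8 * τ / (3 * D) + w / Real.sqrt L) →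
      2 * x < |meanDiff (S.obs ε) u y v| := fun x hx => by
    refine lt_of_lt_of_le ?_ hM
    have e : 8 * τ / D = 3 * (8 * τ / (3 * D)) := by field_simp
    rw [e] at hsmall
    have hwL : 0 ≤ w / Real.sqrt L := by positivity
    have := mul_lt_mul_of_pos_left hsmall hdj
    nlinarith
  rcases lt_or_gt_of_ne (show y ≠ S.θ j by
    rintro h0
    rw [hA, h0, sub_self, abs_zero] at hApos
    exact lt_irrefl _ hApos) with hyθ | hyθ
  · have hyθ' : (y : ℝ) < S.θ j := by exact_mod_cast hyθ
    have hA' : A = S.θ j - y := by rw [hA, abs_of_neg (by linarith)]; ring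
    have hB1 : (k : ℝ) - S.θ j ≤ B := le_abs_self _
    have hB3 : -B ≤ (k : ℝ) - S.θ j := neg_abs_le _
    have hyk' : A / 2 ≤ (k : ℝ) - y := by linarith
    have hyk : y < k := by
      have : (y : ℝ) < k := by linarith
      exact_mod_cast this
    refine segRss_move_right _ huy hyk hkv (hfin _ ?_)
    have e1 := h.abs_sum_meanDiff_le hτ0 hτ huy hyk hj hy fun i hi hij hui hik =>
      (mul_le_mul_of_nonneg_left (min_le_min_left _ (by
        have : (k : ℝ) ≤ v := by exact_mod_cast hkv.le
        linarith)) (sq_nonneg _)).trans (hedge i hi hij hui (hik.trans hkv))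
    have e2 := abs_segMean_le_mul hw hε huy (hyv.le.trans hv) hL hLu
    have e3 : |segMean ε y k| ≤ |S.d j| * (4 * η) := by
      unfold segMean
      rw [sum_Ioc_eq_psum_sub ε hyk.le, abs_div, abs_of_pos (cast_sub_pos hyk),
        div_le_iff₀ (cast_sub_pos hyk), abs_sub_comm]
      refine hnoise.trans ?_
      have := mul_le_mul_of_nonneg_left hyk' (by positivity : 0 ≤ 4 * η * |S.d j|)
      linarith
    have e4 : |S.d j * meanDiff (step (S.θ j)) u y k| ≤ |S.d j| * (2 * η) := by
      rw [abs_mul]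
      refine mul_le_mul_of_nonneg_left ?_ hdj.le
      rcases le_or_gt k (S.θ j) with hc | hc
      · rw [meanDiff_step_outside huy hyk (by omega), abs_zero]
        positivity
      · have hc' : (S.θ j : ℝ) < k := by exact_mod_cast hc
        rw [meanDiff_step_right hyθ.le hc.le,
          abs_of_nonneg (div_nonneg (by linarith) (by linarith)), div_le_iff₀ (by linarith)]
        have := mul_le_mul_of_nonneg_left hyk' hη0
        linarith
    have e5 : |meanDiff ε u y k| ≤ |segMean ε y k| + |segMean ε u y| := abs_sub _ _
    rw [meanDiff_obs S ε huy hyk, ← Finset.add_sum_erase _ _ hj]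
    refine (abs_add_le _ _).trans ((add_le_add_left (abs_add_le _ _) _).trans ?_)
    linarith
  · have hyθ' : (S.θ j : ℝ) < y := by exact_mod_cast hyθ
    have hA' : A = y - S.θ j := by rw [hA, abs_of_pos (by linarith)]
    have hB1 : (k : ℝ) - S.θ j ≤ B := le_abs_self _
    have hB3 : -B ≤ (k : ℝ) - S.θ j := neg_abs_le _
    have hyk' : A / 2 ≤ (y : ℝ) - k := by linarith
    have hyk : k < y := by
      have : (k : ℝ) < y := by linarith
      exact_mod_cast this
    refine segRss_move_left _ huk hyk hyv (hfin _ ?_)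
    have e1 := h.abs_sum_meanDiff_le hτ0 hτ hyk hyv hj hy fun i hi hij hki hiv =>
      (mul_le_mul_of_nonneg_left (min_le_min_right _ (by
        have : (u : ℝ) ≤ k := by exact_mod_cast huk.le
        linarith)) (sq_nonneg _)).trans (hedge i hi hij (huk.trans hki) hiv)
    have e2 := abs_segMean_le_mul hw hε hyv hv hL hLv
    have e3 : |segMean ε k y| ≤ |S.d j| * (4 * η) := by
      unfold segMean
      rw [sum_Ioc_eq_psum_sub ε hyk.le, abs_div, abs_of_pos (cast_sub_pos hyk),
        div_le_iff₀ (cast_sub_pos hyk)]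
      refine hnoise.trans ?_
      have := mul_le_mul_of_nonneg_left hyk' (by positivity : 0 ≤ 4 * η * |S.d j|)
      linarith
    have e4 : |S.d j * meanDiff (step (S.θ j)) k y v| ≤ |S.d j| * (2 * η) := by
      rw [abs_mul]
      refine mul_le_mul_of_nonneg_left ?_ hdj.le
      rcases le_or_gt (S.θ j) k with hc | hc
      · rw [meanDiff_step_outside hyk hyv (by omega), abs_zero]
        positivity
      · have hc' : (k : ℝ) < S.θ j := by exact_mod_cast hc
        rw [meanDiff_step_left hyk hyv hc.le hyθ.le,
          abs_of_nonneg (div_nonneg (by linarith) (by linarith)), div_le_iff₀ (by linarith)]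
        have := mul_le_mul_of_nonneg_left hyk' hη0
        linarith
    have e5 : |meanDiff ε k y v| ≤ |segMean ε y v| + |segMean ε k y| := abs_sub _ _
    rw [meanDiff_obs S ε hyk hyv, ← Finset.add_sum_erase _ _ hj]
    refine (abs_add_le _ _).trans ((add_le_add_left (abs_add_le _ _) _).trans ?_)
    linarith

end Signal

/-! ### Bounds for the residual sum of squares -/

/-- Fitting pure noise reduces its energy by at most `w ^ 2` for the overall mean and `4 * w ^ 2`
for each further break. -/
theorem rss_noise_ge {n : ℕ} (hn : 0 < n) {ε : ℕ → ℝ} {w : ℝ} (hε : NoiseAll n ε w)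
    {A : Finset ℕ} (hA : ∀ k ∈ A, k ≤ n) :
    ∑ t ∈ Finset.Ioc 0 n, ε t ^ 2 - w ^ 2 * (1 + 4 * A.card) ≤ rss n ε A := by
  induction A using Finset.induction_on with
  | empty =>
    rw [rss_eq_sum_segRss, segments_empty hn, Finset.sum_singleton, segRss_eq ε hn]
    have h1 := abs_segMean_le_of_noiseAll hε hn le_rfl
    have hp := cast_sub_pos hn
    have hs := Real.sqrt_pos.2 hp
    rw [le_div_iff₀ hs] at h1
    have h2 := pow_le_pow_left₀ (by positivity) h1 2
    rw [mul_pow, sq_abs, Real.sq_sqrt hp.le] at h2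
    have h3 : (∑ t ∈ Finset.Ioc 0 n, ε t) ^ 2 / ((n : ℝ) - (0 : ℕ)) =
        segMean ε 0 n ^ 2 * ((n : ℝ) - (0 : ℕ)) := by
      unfold segMean
      field_simp
    rw [h3]
    simp only [Finset.card_empty, Nat.cast_zero] at *
    linarith
  | insert k A hk ih =>
    have ih := ih fun k hk => hA k (Finset.mem_insert_of_mem hk)
    rw [Finset.card_insert_of_notMem hk]
    push_cast
    by_cases hb : k ∈ breaks n A
    · rw [rss_insert_of_mem ε hb]
      linarith [sq_nonneg w]
    · have hkn : k < n := lt_of_le_of_ne (hA k (Finset.mem_insert_self _ _))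
        fun h => hb (h ▸ last_mem_breaks n A)
      obtain ⟨u, v, h, h1, h2⟩ := exists_segment hb hkn
      have hv : v ≤ n := by
        have := (mem_segments.1 h).2.2.2 n (last_mem_breaks n A)
        omega
      have e1 := rss_eq_rss_insert_add ε h h1 h2
      have e2 := pow_le_pow_left₀ (by positivity) (sqrt_weight_mul_abs_meanDiff_le hε h1 h2 hv) 2
      rw [mul_pow, sq_abs, Real.sq_sqrt (weight_pos h1 h2).le] at e2
      linarith

namespace Signal

variable {n : ℕ} {S : Signal n} {D : ℝ}

theorem mean_eq (S : Signal n) (t : ℕ) :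
    S.mean t = S.base + ∑ i ∈ Finset.Icc 1 S.q, S.d i * step (S.θ i) t := rfl

theorem segRss_obs_eq (S : Signal n) (ε : ℕ → ℝ) {u v : ℕ} (huv : u < v)
    (h : ∀ i ∈ Finset.Icc 1 S.q, S.θ i ≤ u ∨ v ≤ S.θ i) :
    segRss (S.obs ε) u v = segRss ε u v := by
  refine Finset.sum_congr rfl fun t ht => ?_
  rw [Finset.mem_Ioc] at ht
  have e : ∑ i ∈ Finset.Icc 1 S.q, S.d i * step (S.θ i) t =
      ∑ i ∈ Finset.Icc 1 S.q, S.d i * segMean (step (S.θ i)) u v := by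
    refine Finset.sum_congr rfl fun i hi => ?_
    congr 1
    unfold segMean
    rcases h i hi with h1 | h1
    · rw [sum_step_of_le h1 huv.le, div_self (cast_sub_pos huv).ne']
      exact if_pos (by omega)
    · rw [sum_step_of_ge h1, zero_div]
      exact if_neg (by omega)
  rw [segMean_obs S ε huv, obs, mean_eq, e]
  ring

theorem θ_lt_last {j : ℕ} (hj : j ∈ Finset.Icc 1 S.q) : S.θ j < n := by
  rw [Finset.mem_Icc] at hj
  have h1 := (S.θ_lt S.q (Finset.mem_Icc.2 ⟨by omega, le_rfl⟩)).2
  rw [S.θ_last] at h1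
  rcases eq_or_lt_of_le hj.2 with h | h
  · rw [h]; exact h1
  · exact (θ_lt_of_lt h (Finset.mem_Icc.2 ⟨by omega, le_rfl⟩)).trans h1

/-- A fit that has all change points among its breaks fits pure noise, and further breaks only lower
the residual sum of squares. -/
theorem rss_obs_ge (S : Signal n) (hn : 0 < n) {ε : ℕ → ℝ} {w : ℝ} (hε : NoiseAll n ε w)
    {A : Finset ℕ} (hA : ∀ k ∈ A, k ≤ n) :
    ∑ t ∈ Finset.Ioc 0 n, ε t ^ 2 - w ^ 2 * (1 + 4 * (A.card + S.q)) ≤ rss n (S.obs ε) A := by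
  have hΘ : ∀ k ∈ (Finset.Icc 1 S.q).image S.θ, k ≤ n := fun k hk => by
    obtain ⟨i, hi, rfl⟩ := Finset.mem_image.1 hk
    exact (θ_lt_last hi).le
  have hall : ∀ k ∈ A ∪ (Finset.Icc 1 S.q).image S.θ, k ≤ n := fun k hk =>
    (Finset.mem_union.1 hk).elim (hA k) (hΘ k)
  refine le_trans ?_ (rss_union_le (S.obs ε) A hΘ)
  have e : rss n (S.obs ε) (A ∪ (Finset.Icc 1 S.q).image S.θ) =
      rss n ε (A ∪ (Finset.Icc 1 S.q).image S.θ) := by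
    rw [rss_eq_sum_segRss, rss_eq_sum_segRss]
    refine Finset.sum_congr rfl fun p hp => ?_
    obtain ⟨u, v⟩ := p
    obtain ⟨-, -, huv, hc⟩ := mem_segments.1 hp
    exact S.segRss_obs_eq ε huv fun i hi => hc _ (subset_breaks _ _
      (Finset.mem_union_right _ (Finset.mem_image_of_mem _ hi)))
  rw [e]
  refine le_trans ?_ (rss_noise_ge hn hε hall)
  have hcard : ((A ∪ (Finset.Icc 1 S.q).image S.θ).card : ℝ) ≤ A.card + S.q := by
    have h1 := Finset.card_union_le A ((Finset.Icc 1 S.q).image S.θ)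
    have h2 := Finset.card_image_le (s := Finset.Icc 1 S.q) (f := S.θ)
    rw [Nat.card_Icc] at h2
    exact_mod_cast h1.trans (by omega)
  have := mul_le_mul_of_nonneg_left hcard (sq_nonneg w)
  linarith

theorem sum_sq_obs_sub_le (S : Signal n) (ε g : ℕ → ℝ) :
    ∑ t ∈ Finset.Ioc 0 n, (S.obs ε t - g t) ^ 2 ≤
      2 * ∑ t ∈ Finset.Ioc 0 n, ε t ^ 2 + 2 * ∑ t ∈ Finset.Ioc 0 n, (S.mean t - g t) ^ 2 := by
  rw [Finset.mul_sum, Finset.mul_sum, ← Finset.sum_add_distrib]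
  refine Finset.sum_le_sum fun t _ => ?_
  unfold obs
  nlinarith [sq_nonneg (S.mean t - g t - ε t)]

/-- The residual sum of squares for a signal that stays within `H` of its initial level. -/
theorem rss_obs_le_of_bounded (S : Signal n) (hn : 0 < n) (ε : ℕ → ℝ) {A : Finset ℕ}
    (hA : ∀ k ∈ A, k ≤ n) {H : ℝ} (hH : ∀ t ∈ Finset.Icc 1 n, |S.mean t - S.base| ≤ H) :
    rss n (S.obs ε) A ≤ 2 * ∑ t ∈ Finset.Ioc 0 n, ε t ^ 2 + 2 * (n * H ^ 2) := by
  refine (rss_le_of_const hn hA _ (fun _ => S.base) fun _ _ _ _ _ => rfl).trans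
    ((S.sum_sq_obs_sub_le ε _).trans ?_)
  have : ∑ t ∈ Finset.Ioc 0 n, (S.mean t - S.base) ^ 2 ≤ ∑ t ∈ Finset.Ioc 0 n, H ^ 2 :=
    Finset.sum_le_sum fun t ht => by
      have h1 := hH t (by rw [Finset.mem_Ioc] at ht; rw [Finset.mem_Icc]; omega)
      rw [← sq_abs]
      exact pow_le_pow_left₀ (abs_nonneg _) h1 2
  rw [Finset.sum_const, Nat.card_Ioc, nsmul_eq_mul] at this
  simp only [Nat.sub_zero] at this
  linarith

/-- Two unit steps differ at as many times as their locations are apart. -/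
theorem sum_sq_step_sub_le (m a b : ℕ) :
    ∑ t ∈ Finset.Ioc 0 m, (step a t - step b t) ^ 2 ≤ |(b : ℝ) - a| := by
  wlog hab : a ≤ b generalizing a b
  · have := this b a (le_of_not_ge hab)
    rw [abs_sub_comm]
    refine le_trans (le_of_eq (Finset.sum_congr rfl fun t _ => ?_)) this
    ring
  have h1 : ∀ t ∈ Finset.Ioc 0 m, (step a t - step b t) ^ 2 =
      if t ∈ Finset.Ioc a b then 1 else 0 := fun t _ => by
    unfold step
    simp only [Finset.mem_Ioc]
    split_ifs <;> first | omega | norm_num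
  rw [Finset.sum_congr rfl h1, ← Finset.sum_filter, Finset.sum_const, nsmul_eq_mul, mul_one]
  have h2 : (((Finset.Ioc 0 m).filter (· ∈ Finset.Ioc a b)).card : ℝ) ≤
      ((Finset.Ioc a b).card : ℝ) :=
    by exact_mod_cast Finset.card_le_card fun t ht => (Finset.mem_filter.1 ht).2
  rw [Nat.card_Ioc, Nat.cast_sub hab] at h2
  exact h2.trans (le_abs_self _)

/-- The residual sum of squares if there is a break near every change point. -/
theorem Separated.rss_obs_le_of_covered (h : S.Separated D) (hn : 0 < n) (ε : ℕ → ℝ)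
    {A : Finset ℕ} (hA : ∀ k ∈ A, k ≤ n) {τ : ℝ} (hτ : τ ≤ D / 4) (hD : 0 < D)
    (hcov : ∀ i ∈ Finset.Icc 1 S.q, ∃ b ∈ breaks n A, S.scaledDist i b ≤ τ) :
    rss n (S.obs ε) A ≤ 2 * ∑ t ∈ Finset.Ioc 0 n, ε t ^ 2 + 2 * (S.q * τ) := by
  choose! b hb hbτ using hcov
  -- the fit: the signal with its change points moved to the breaks
  set g : ℕ → ℝ := fun t => S.base + ∑ i ∈ Finset.Icc 1 S.q, S.d i * step (b i) t with hg
  refine (rss_le_of_const hn hA _ g fun u v huv t ht => ?_).trans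
    ((S.sum_sq_obs_sub_le ε g).trans ?_)
  · simp only [hg]
    congr 1
    refine Finset.sum_congr rfl fun i hi => ?_
    have h1 := (mem_segments.1 huv).2.2.2 _ (hb i hi)
    rw [Finset.mem_Ioc] at ht
    unfold step
    congr 1
    split_ifs <;> first | rfl | omega
  · have hoff : ∀ t, ∀ i ∈ Finset.Icc 1 S.q, ∀ j ∈ Finset.Icc 1 S.q, i ≠ j →
        (step (S.θ i) t - step (b i) t) * (step (S.θ j) t - step (b j) t) = 0 := by
      intro t i hi j hj hij
      have key : ∀ k ∈ Finset.Icc 1 S.q, step (S.θ k) t - step (b k) t ≠ 0 →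
          S.scaledDist k t ≤ D / 4 := fun k hk hne => by
        refine le_trans (mul_le_mul_of_nonneg_left ?_ (sq_nonneg _)) ((hbτ k hk).trans hτ)
        unfold step at hne
        split_ifs at hne with h1 h2 h2
        · simp at hne
        · have e1 : (t : ℝ) ≤ b k := by exact_mod_cast (by omega : t ≤ b k)
          have e2 : (S.θ k : ℝ) ≤ t := by exact_mod_cast (by omega : S.θ k ≤ t)
          rw [abs_of_nonneg (by linarith), abs_of_nonneg (by linarith)]
          linarith
        · have e1 : (b k : ℝ) ≤ t := by exact_mod_cast (by omega : b k ≤ t)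
          have e2 : (t : ℝ) ≤ S.θ k := by exact_mod_cast (by omega : t ≤ S.θ k)
          rw [abs_of_nonpos (by linarith), abs_of_nonpos (by linarith)]
          linarith
        · simp at hne
      by_contra hne
      have h1 := key i hi (left_ne_zero_of_mul hne)
      have h2 := key j hj (right_ne_zero_of_mul hne)
      have := h.far_scaledDist hi hj hij h2
      linarith
    have hsq : ∀ t, (S.mean t - g t) ^ 2 =
        ∑ i ∈ Finset.Icc 1 S.q, S.d i ^ 2 * (step (S.θ i) t - step (b i) t) ^ 2 := fun t => by
      have e1 : S.mean t - g t =
          ∑ i ∈ Finset.Icc 1 S.q, S.d i * (step (S.θ i) t - step (b i) t) := by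
        simp only [hg, mean_eq, mul_sub, Finset.sum_sub_distrib]
        ring
      rw [e1, sq, Finset.sum_mul_sum]
      refine Finset.sum_congr rfl fun i hi => ?_
      rw [Finset.sum_eq_single_of_mem i hi]
      · ring
      · intro j hj hji
        have := hoff t i hi j hj hji.symm
        linear_combination S.d i * S.d j * this
    have hsum : ∑ t ∈ Finset.Ioc 0 n, (S.mean t - g t) ^ 2 ≤ S.q * τ := by
      simp only [hsq]
      rw [Finset.sum_comm]
      refine (Finset.sum_le_card_nsmul _ _ τ fun i hi => ?_).trans (by simp)
      rw [← Finset.mul_sum]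
      exact (mul_le_mul_of_nonneg_left (sum_sq_step_sub_le n (S.θ i) (b i)) (sq_nonneg _)).trans
        (hbτ i hi)
    linarith

/-- The number of separated change points of bounded size. -/
theorem Separated.card_mul_le (h : S.Separated D) {M : ℝ}
    (hM : ∀ j ∈ Finset.Icc 1 S.q, |S.d j| ≤ M) : S.q * D ≤ M ^ 2 * n := by
  have h1 : ∀ m ≤ S.q, ∑ j ∈ Finset.Icc 1 m, S.gap j ≤ S.θ m := by
    intro m
    induction m with
    | zero => simp
    | succ m ih =>
      intro hm
      rw [Finset.sum_Icc_succ_top (by omega)]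
      have h2 := (S.θ_lt (m + 1) (Finset.mem_Icc.2 ⟨by omega, hm⟩)).1
      have h3 : S.gap (m + 1) ≤ S.θ (m + 1) - S.θ (m + 1 - 1) := min_le_left _ _
      simp only [Nat.add_sub_cancel] at h2 h3
      have := ih (by omega)
      omega
  have h2 : S.θ S.q ≤ n := by
    rcases Nat.eq_zero_or_pos S.q with hq | hq
    · rw [hq, S.θ_zero]; exact Nat.zero_le n
    · exact (θ_lt_last (Finset.mem_Icc.2 ⟨hq, le_rfl⟩)).le
  have h3 : ((∑ j ∈ Finset.Icc 1 S.q, S.gap j : ℕ) : ℝ) ≤ n := by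
    exact_mod_cast (h1 S.q le_rfl).trans h2
  have h4 : ∑ j ∈ Finset.Icc 1 S.q, D ≤ ∑ j ∈ Finset.Icc 1 S.q, M ^ 2 * (S.gap j : ℝ) := by
    refine Finset.sum_le_sum fun j hj => (h j hj).trans ?_
    refine mul_le_mul_of_nonneg_right ?_ (Nat.cast_nonneg _)
    rw [← sq_abs]
    exact pow_le_pow_left₀ (abs_nonneg _) (hM j hj) 2
  rw [← Finset.mul_sum, Finset.sum_const, nsmul_eq_mul, Nat.card_Icc] at h4
  push_cast at h3
  simp only [Nat.add_sub_cancel] at h4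
  exact h4.trans (mul_le_mul_of_nonneg_left h3 (sq_nonneg M))

end Signal

/-! ### Good paths and the pruning criterion -/

/-- Relations between the constants: `c` and `C` are the thresholds of detectability and sure
detectability in units of the penalty, `cl` and `Cu` bound the residual variance, `M` bounds the
jumps, and `η` is a small number that controls all remaining quantities. -/
structure Constants (c C cl Cu M η : ℝ) : Prop where
  c_pos : 0 < c
  Cu_pos : 0 < Cu
  c_le : 32 * c ≤ cl
  le_C : 512 * Cu ≤ C
  two_c_le : 2 * c ≤ C
  η_pos : 0 < η
  η_le_half : η ≤ 1 / 2
  η_le_c : 4 * η ≤ c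
  η_mul_C : 4 * C * η < 1
  η_mul_C_sq : 4 * C ^ 2 * η ≤ c
  η_add : 8 * C * η / 3 + 2 * Real.sqrt (η / (C / 4)) ≤ 1 / 4
  η_move : 12 * η + 8 * C * η + 4 * Real.sqrt (η / c) < c / (2 * C)
  η_low : 13 * η + 4 * η ^ 2 * M ^ 2 ≤ cl
  η_up : 2 * C * η * M ^ 2 ≤ 1
  η_len : 16 * η * M ^ 2 ≤ 1

/-- A sample for which the errors and the candidates behave well. `ρ` is the precision of valid,
`r` that of acceptable candidates. -/
structure GoodPath {n : ℕ} (S : Signal n) (ε : ℕ → ℝ) (K : Finset ℕ)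
    (ξ ρ r w η M cl Cu H : ℝ) : Prop where
  ξ_pos : 0 < ξ
  r_pos : 0 < r
  r_le : r ≤ η * ξ
  ρ_le : ρ ≤ η * r
  w_nonneg : 0 ≤ w
  w_sq_le : w ^ 2 ≤ η * ξ
  separated : S.Separated (ξ / η)
  d_le : ∀ j ∈ Finset.Icc 1 S.q, |S.d j| ≤ M
  noise : NoiseAll n ε w
  noise_far : ∀ j ∈ Finset.Icc 1 S.q, ∀ y, r ≤ S.scaledDist j y → S.scaledDist j y ≤ ξ / η / 4 →
    |psum ε y - psum ε (S.θ j)| ≤ η * |S.d j| * |(y : ℝ) - S.θ j|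
  noise_near : ∀ j ∈ Finset.Icc 1 S.q, ∀ k, S.scaledDist j k ≤ ρ →
    |psum ε k - psum ε (S.θ j)| ≤ η * r / |S.d j|
  K_subset : K ⊆ Finset.Ioo 0 n
  valid : HasValid S K ρ
  card_le : w ^ 2 * K.card ≤ η * n
  energy_ge : 2 * cl * n ≤ ∑ t ∈ Finset.Ioc 0 n, ε t ^ 2
  energy_le : 2 * ∑ t ∈ Finset.Ioc 0 n, ε t ^ 2 ≤ (Cu - 2 * H ^ 2 - 1) * n

/-- The breaks `O` that are held fixed while the candidates in `(s, e)` are pruned. -/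
structure Window {n : ℕ} (S : Signal n) (K O : Finset ℕ) (s e : ℕ) (H : ℝ) : Prop where
  lt : s < e
  le : e ≤ n
  left_mem : s ∈ O
  right_mem : e ∈ O
  disjoint : ∀ k ∈ O, ¬ (s < k ∧ k < e)
  subset : O ⊆ K ∪ {s, e}
  cover : (∀ k ∈ K, ¬ (s < k ∧ k < e) → k ∈ O) ∨ ∀ t ∈ Finset.Icc 1 n, |S.mean t - S.base| ≤ H

/-- The Schwarz criterion with fixed breaks `O` and an offset `N` in the number of breaks. -/
noncomputable def crit (n : ℕ) (x : ℕ → ℝ) (ξ : ℝ) (O : Finset ℕ) (N : ℝ) (A : Finset ℕ) : ℝ :=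
  (n : ℝ) / 2 * Real.log (rss n x (A ∪ O) / n) + (A.card + N) * ξ

section

variable {n : ℕ} {S : Signal n} {ε : ℕ → ℝ} {K O A : Finset ℕ} {s e : ℕ}
  {ξ ρ r w η M cl Cu H c C N : ℝ}

namespace Constants

variable (hc : Constants c C cl Cu M η)
include hc

theorem C_pos : 0 < C := by linarith [hc.c_pos, hc.two_c_le]

theorem cl_pos : 0 < cl := by linarith [hc.c_pos, hc.c_le]

theorem far_le (ξ : ℝ) : 4 * (C * ξ) ^ 2 ≤ c * ξ * (ξ / η) := by
  have e : c * ξ * (ξ / η) = c * ξ ^ 2 / η := by ring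
  rw [e, le_div_iff₀ hc.η_pos]
  linarith [mul_le_mul_of_nonneg_left hc.η_mul_C_sq (sq_nonneg ξ)]

end Constants

namespace GoodPath

variable (hg : GoodPath S ε K ξ ρ r w η M cl Cu H) (hc : Constants c C cl Cu M η)
include hg hc

theorem D_pos : 0 < ξ / η := div_pos hg.ξ_pos hc.η_pos

theorem C_mul_lt : C * ξ < ξ / η / 4 := by
  have h1 := hc.η_pos
  rw [div_div, lt_div_iff₀ (by positivity)]
  nlinarith [mul_lt_mul_of_pos_left hc.η_mul_C hg.ξ_pos]

theorem c_mul_le : 2 * (c * ξ) ≤ C * ξ := by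
  have := mul_le_mul_of_nonneg_right hc.two_c_le hg.ξ_pos.le
  linarith

theorem c_mul_pos : 0 < c * ξ := mul_pos hc.c_pos hg.ξ_pos

theorem four_r_le : 4 * r ≤ c * ξ := by
  have := mul_le_mul_of_nonneg_right hc.η_le_c hg.ξ_pos.le
  linarith [hg.r_le]

theorem two_ρ_le : 2 * ρ ≤ r := by
  have := mul_le_mul_of_nonneg_right hc.η_le_half hg.r_pos.le
  linarith [hg.ρ_le]

theorem four_w_sq_le : 4 * w ^ 2 ≤ c * ξ := by
  have := mul_le_mul_of_nonneg_right hc.η_le_c hg.ξ_pos.le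
  linarith [hg.w_sq_le]

theorem w_div_sqrt_le {L : ℝ} (hL : 0 < L) : w / Real.sqrt (L * ξ) ≤ Real.sqrt (η / L) := by
  have hξ := hg.ξ_pos
  have h1 : w ≤ Real.sqrt (η * ξ) := Real.le_sqrt_of_sq_le hg.w_sq_le
  have h2 : η / L = η * ξ / (L * ξ) := by field_simp
  rw [h2, Real.sqrt_div (by have := hc.η_pos; positivity)]
  gcongr

theorem C_mul_div : C * ξ / (ξ / η) = C * η := by
  have := hg.ξ_pos
  have := hc.η_pos
  field_simp

theorem q_mul_le : S.q * ξ ≤ η * M ^ 2 * n := by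
  have h1 := hg.separated.card_mul_le hg.d_le
  have h2 := mul_le_mul_of_nonneg_left h1 hc.η_pos.le
  have := hc.η_pos
  have e : η * (S.q * (ξ / η)) = S.q * ξ := by field_simp
  linarith

theorem ξ_le_n {j : ℕ} (hj : j ∈ Finset.Icc 1 S.q) : 16 * ξ ≤ n := by
  have h1 := hg.q_mul_le hc
  have h2 : (1 : ℝ) ≤ S.q := by
    rw [Finset.mem_Icc] at hj
    exact_mod_cast hj.1.trans hj.2
  have h3 := mul_le_mul_of_nonneg_right h2 hg.ξ_pos.le
  have h4 := mul_le_mul_of_nonneg_right hc.η_len (Nat.cast_nonneg (α := ℝ) n)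
  linarith

end GoodPath

theorem Window.le_of_mem (hW : Window S K O s e H) (hK : K ⊆ Finset.Ioo 0 n)
    (hA : A ⊆ K) {k : ℕ} (hk : k ∈ A ∪ O) : k ≤ n := by
  have h1 := hW.lt
  have h2 := hW.le
  have hKn : ∀ k ∈ K, k ≤ n := fun k hk => (Finset.mem_Ioo.1 (hK hk)).2.le
  rcases Finset.mem_union.1 hk with h | h
  · exact hKn k (hA h)
  · have := hW.subset h
    simp only [Finset.mem_union, Finset.mem_insert, Finset.mem_singleton] at this
    rcases this with h | rfl | rfl
    · exact hKn k h
    · omega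
    · omega

/-- The segment of the fit in which a further candidate lies. -/
theorem Window.exists_segment (hW : Window S K O s e H) {x : ℕ}
    (hx : x ∈ Finset.Ioo s e) (hxA : x ∉ A) :
    ∃ u v, (u, v) ∈ segments n (A ∪ O) ∧ u < x ∧ x < v ∧ s ≤ u ∧ v ≤ e ∧ (u = s ∨ u ∈ A) ∧
      (v = e ∨ v ∈ A) ∧ ∀ k ∈ A, k ≤ u ∨ v ≤ k := by
  have hle := hW.le
  rw [Finset.mem_Ioo] at hx
  have hmem : ∀ b ∈ breaks n (A ∪ O), s < b → b < e → b ∈ A := fun b hb h1 h2 => by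
    simp only [breaks, Finset.mem_insert, Finset.mem_union] at hb
    rcases hb with h | h | h | h
    · omega
    · omega
    · exact h
    · exact absurd ⟨h1, h2⟩ (hW.disjoint b h)
  obtain ⟨u, v, huv, h1, h2⟩ := LocalPruning.exists_segment (n := n) (k := x) (A := A ∪ O)
    (fun hb => hxA (hmem x hb hx.1 hx.2)) (by omega)
  obtain ⟨hu, hv, -, hall⟩ := mem_segments.1 huv
  have hs := hall s (subset_breaks _ _ (Finset.mem_union_right _ hW.left_mem))
  have he := hall e (subset_breaks _ _ (Finset.mem_union_right _ hW.right_mem))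
  refine ⟨u, v, huv, h1, h2, by omega, by omega, ?_, ?_, fun k hk =>
    hall k (subset_breaks _ _ (Finset.mem_union_left _ hk))⟩
  · by_cases h : u = s
    · exact Or.inl h
    · exact Or.inr (hmem u hu (by omega) (by omega))
  · by_cases h : v = e
    · exact Or.inl h
    · exact Or.inr (hmem v hv (by omega) (by omega))

/-- The part of the noise that is fitted by the change points and at most `K.card + 2` further
breaks is negligible compared to its energy. Without candidates, `w ^ 2 / n` need not be small. -/
theorem GoodPath.rss_ge (hg : GoodPath S ε K ξ ρ r w η M cl Cu H) (hc : Constants c C cl Cu M η)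
    (hW : Window S K O s e H) (hA : A ⊆ K) (hK : K.Nonempty) :
    cl * n ≤ rss n (S.obs ε) (A ∪ O) := by
  have hn : 0 < n := by have h1 := hW.lt; have := hW.le; omega
  have h1 := S.rss_obs_ge hn hg.noise (A := A ∪ O) fun k hk => hW.le_of_mem hg.K_subset hA hk
  have h2 : ((A ∪ O).card : ℝ) ≤ K.card + 2 := by
    have e1 := Finset.card_le_card
      (Finset.union_subset (hA.trans Finset.subset_union_left) hW.subset)
    have e2 := Finset.card_union_le K {s, e}
    have e3 := Finset.card_le_two (a := s) (b := e)
    exact_mod_cast e1.trans (e2.trans (by omega))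
  have h3 : (1 : ℝ) ≤ K.card := by exact_mod_cast hK.card_pos
  have h4 : w ^ 2 * (1 + 4 * ((A ∪ O).card + S.q)) ≤ 13 * (w ^ 2 * K.card) + 4 * (w ^ 2 * S.q) := by
    have := mul_le_mul_of_nonneg_left
      (by linarith : 1 + 4 * (((A ∪ O).card : ℝ) + S.q) ≤ 13 * K.card + 4 * S.q) (sq_nonneg w)
    linarith
  have h5 : w ^ 2 * S.q ≤ η * (η * M ^ 2 * n) := by
    have e1 := mul_le_mul_of_nonneg_right hg.w_sq_le (Nat.cast_nonneg (α := ℝ) S.q)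
    have e2 := mul_le_mul_of_nonneg_left (hg.q_mul_le hc) hc.η_pos.le
    linarith
  have h6 := mul_le_mul_of_nonneg_right hc.η_low (Nat.cast_nonneg (α := ℝ) n)
  have h7 := hg.card_le
  have h8 := hg.energy_ge
  nlinarith

/-- Any upper bound on the distance of a candidate in the fit to a change point bounds the distance
of the change point to the end of the segment it lies in. -/
theorem edge_le_of_mem {u v i k : ℕ} (hk : k ≤ u ∨ v ≤ k) (hu : u < S.θ i) (hv : S.θ i < v) :
    S.d i ^ 2 * min ((S.θ i : ℝ) - u) ((v : ℝ) - S.θ i) ≤ S.scaledDist i k := by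
  refine mul_le_mul_of_nonneg_left ?_ (sq_nonneg _)
  have hu' : (u : ℝ) < S.θ i := by exact_mod_cast hu
  have hv' : (S.θ i : ℝ) < v := by exact_mod_cast hv
  rcases hk with h | h
  · have : (k : ℝ) ≤ u := by exact_mod_cast h
    rw [abs_of_nonpos (by linarith)]
    exact (min_le_left _ _).trans (by linarith)
  · have : (v : ℝ) ≤ k := by exact_mod_cast h
    rw [abs_of_nonneg (by linarith)]
    exact (min_le_right _ _).trans (by linarith)

theorem edge_le_of_not_detectable {u v i : ℕ} {t : ℝ} (hi : i ∈ Finset.Icc 1 S.q)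
    (h : i ∉ S.detectable s e t) (hsu : s ≤ u) (hve : v ≤ e) :
    S.d i ^ 2 * min ((S.θ i : ℝ) - u) ((v : ℝ) - S.θ i) ≤ t := by
  have h1 : ¬ t ≤ S.d i ^ 2 * min ((S.θ i : ℝ) - s) ((e : ℝ) - S.θ i) := fun h2 => h ⟨hi, h2⟩
  refine le_trans (mul_le_mul_of_nonneg_left ?_ (sq_nonneg _)) (not_le.1 h1).le
  have hu' : (s : ℝ) ≤ u := by exact_mod_cast hsu
  have hv' : (v : ℝ) ≤ e := by exact_mod_cast hve
  exact min_le_min (by linarith) (by linarith)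

theorem lt_θ_of_detectable {i : ℕ} {t : ℝ} (ht : 0 < t) (h : i ∈ S.detectable s e t) :
    s < S.θ i ∧ S.θ i < e := by
  have h1 := pos_of_mul_pos_right (ht.trans_le h.2) (sq_nonneg _)
  obtain ⟨h2, h3⟩ := lt_min_iff.1 h1
  exact ⟨by exact_mod_cast sub_pos.1 h2, by exact_mod_cast sub_pos.1 h3⟩

theorem detectable_dist {i : ℕ} {t : ℝ} (h : i ∈ S.detectable s e t) :
    t ≤ S.d i ^ 2 * ((S.θ i : ℝ) - s) ∧ t ≤ S.d i ^ 2 * ((e : ℝ) - S.θ i) := by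
  have := h.2
  rw [mul_min_of_nonneg _ _ (sq_nonneg _)] at this
  exact le_min_iff.1 this

theorem detectable_anti {i : ℕ} {t t' : ℝ} (htt : t' ≤ t) (h : i ∈ S.detectable s e t) :
    i ∈ S.detectable s e t' := ⟨h.1, htt.trans h.2⟩

/-- Between `u` and `v` lie all `k` that are closer to `θ_i` than `u` and `v` are. -/
theorem lt_of_scaledDist_lt {u v i k : ℕ} {t : ℝ} (hu : t ≤ S.d i ^ 2 * ((S.θ i : ℝ) - u))
    (hv : t ≤ S.d i ^ 2 * ((v : ℝ) - S.θ i)) (hk : S.scaledDist i k < t) : u < k ∧ k < v := by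
  unfold Signal.scaledDist at hk
  have h1 := lt_of_mul_lt_mul_left (hk.trans_le hu) (sq_nonneg _)
  have h2 := lt_of_mul_lt_mul_left (hk.trans_le hv) (sq_nonneg _)
  rw [abs_lt] at h1 h2
  constructor
  · have : (u : ℝ) < k := by linarith
    exact_mod_cast this
  · have : (k : ℝ) < v := by linarith
    exact_mod_cast this

theorem mem_Ioo_of_detectable {i k : ℕ} {t : ℝ} (h : i ∈ S.detectable s e t)
    (hk : S.scaledDist i k < t) : k ∈ Finset.Ioo s e :=
  Finset.mem_Ioo.2 (lt_of_scaledDist_lt (detectable_dist h).1 (detectable_dist h).2 hk)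

/-- Every surely detectable change point with index in `I` has an element of `A` nearby. The radius
is half of the threshold of sure detectability, so that the elements nearby lie in the window. -/
def Covers (S : Signal n) (s e : ℕ) (C ξ : ℝ) (A : Finset ℕ) (I : Set ℕ) : Prop :=
  ∀ i ∈ S.detectable s e (C * ξ), i ∈ I → ∃ k ∈ A, S.scaledDist i k ≤ C / 2 * ξ

theorem Covers.mono {B : Finset ℕ} {I : Set ℕ} (h : Covers S s e C ξ A I) (hAB : A ⊆ B) :
    Covers S s e C ξ B I := fun i hi hI =>
  let ⟨k, hk, h1⟩ := h i hi hI
  ⟨k, hAB hk, h1⟩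

theorem GoodPath.half_C_mul_le (hg : GoodPath S ε K ξ ρ r w η M cl Cu H)
    (hc : Constants c C cl Cu M η) : C / 2 * ξ ≤ C * ξ := by
  have := mul_pos hc.C_pos hg.ξ_pos
  linarith

theorem GoodPath.edge_le_of_covers (hg : GoodPath S ε K ξ ρ r w η M cl Cu H)
    (hc : Constants c C cl Cu M η) {I : Set ℕ} (hA : Covers S s e C ξ A I) {u v : ℕ}
    (hsu : s ≤ u) (hve : v ≤ e) (hall : ∀ k ∈ A, k ≤ u ∨ v ≤ k) {i : ℕ}
    (hi : i ∈ Finset.Icc 1 S.q) (hiI : i ∈ I) (hu : u < S.θ i) (hv : S.θ i < v) :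
    S.d i ^ 2 * min ((S.θ i : ℝ) - u) ((v : ℝ) - S.θ i) ≤ C * ξ := by
  by_cases h : i ∈ S.detectable s e (C * ξ)
  · obtain ⟨k, hk, h1⟩ := hA i h hiI
    exact (edge_le_of_mem (hall k hk) hu hv).trans (h1.trans (hg.half_C_mul_le hc))
  · exact edge_le_of_not_detectable hi h hsu hve

/-- The fixed breaks and a covering set together come within `C * ξ / d_i ^ 2` of every change point
`θ_i`, so that the signal is fitted well. If the signal is bounded, even a constant fit will do. -/
theorem GoodPath.rss_le (hg : GoodPath S ε K ξ ρ r w η M cl Cu H) (hc : Constants c C cl Cu M η)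
    (hW : Window S K O s e H) (hA : A ⊆ K) (hcov : Covers S s e C ξ A Set.univ) :
    rss n (S.obs ε) (A ∪ O) ≤ Cu * n := by
  have hn : 0 < n := by have h1 := hW.lt; have := hW.le; omega
  have hmem : ∀ k ∈ A ∪ O, k ≤ n := fun k hk => hW.le_of_mem hg.K_subset hA hk
  have hen := hg.energy_le
  have hn' : (0 : ℝ) < n := by exact_mod_cast hn
  rcases hW.cover with hK | hH
  · have hs : s ∈ breaks n (A ∪ O) :=
      subset_breaks _ _ (Finset.mem_union_right _ hW.left_mem)
    have he : e ∈ breaks n (A ∪ O) :=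
      subset_breaks _ _ (Finset.mem_union_right _ hW.right_mem)
    have h1 := hg.separated.rss_obs_le_of_covered hn ε hmem (hg.C_mul_lt hc).le (hg.D_pos hc)
      fun i hi => by
        by_cases hsure : i ∈ S.detectable s e (C * ξ)
        · obtain ⟨k, hk, h1⟩ := hcov i hsure (Set.mem_univ _)
          exact ⟨k, subset_breaks _ _ (Finset.mem_union_left _ hk),
            h1.trans (hg.half_C_mul_le hc)⟩
        -- otherwise an end of the window is close to `θ_i`, or else a fixed break is
        · have hnot : ¬ C * ξ ≤ S.d i ^ 2 * min ((S.θ i : ℝ) - s) ((e : ℝ) - S.θ i) :=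
            fun h2 => hsure ⟨hi, h2⟩
          rw [mul_min_of_nonneg _ _ (sq_nonneg _), le_min_iff, not_and_or, not_le, not_le] at hnot
          obtain ⟨k, hk, hkρ⟩ := hg.valid i hi
          have hρ : ρ ≤ C * ξ := by
            linarith [hg.two_ρ_le hc, hg.four_r_le hc, hg.c_mul_le hc, hg.c_mul_pos hc, hg.r_pos]
          by_cases hin : s < k ∧ k < e
          · have hk1 : (s : ℝ) < k := by exact_mod_cast hin.1
            have hk2 : (k : ℝ) < e := by exact_mod_cast hin.2
            rcases le_or_gt (S.θ i : ℝ) s with h2 | h2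
            · refine ⟨s, hs, le_trans ?_ (hkρ.trans hρ)⟩
              refine mul_le_mul_of_nonneg_left ?_ (sq_nonneg _)
              rw [abs_of_nonneg (by linarith), abs_of_nonneg (by linarith)]
              linarith
            · rcases le_or_gt (e : ℝ) (S.θ i) with h3 | h3
              · refine ⟨e, he, le_trans ?_ (hkρ.trans hρ)⟩
                refine mul_le_mul_of_nonneg_left ?_ (sq_nonneg _)
                rw [abs_of_nonpos (by linarith), abs_of_nonpos (by linarith)]
                linarith
              · rcases hnot with h4 | h4
                · refine ⟨s, hs, ?_⟩
                  unfold Signal.scaledDist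
                  rw [abs_of_nonpos (by linarith), neg_sub]
                  exact h4.le
                · refine ⟨e, he, ?_⟩
                  unfold Signal.scaledDist
                  rw [abs_of_nonneg (by linarith)]
                  exact h4.le
          · exact ⟨k, subset_breaks _ _ (Finset.mem_union_right _ (hK k hk hin)),
              le_trans hkρ hρ⟩
    have h2 := mul_le_mul_of_nonneg_left (hg.q_mul_le hc) hc.C_pos.le
    have h3 := mul_le_mul_of_nonneg_right hc.η_up hn'.le
    nlinarith [mul_nonneg hn'.le (sq_nonneg H)]
  · have := S.rss_obs_le_of_bounded hn ε hmem hH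
    nlinarith

/-- A gain of at most `16 * (c * ξ)` in the residual sum of squares does not pay for the penalty: it
changes the logarithmic term by at most `ξ / 4`. -/
theorem GoodPath.crit_le_insert_sub (hg : GoodPath S ε K ξ ρ r w η M cl Cu H)
    (hc : Constants c C cl Cu M η) (hW : Window S K O s e H) (hA : A ⊆ K) {x u v : ℕ}
    (hx : x ∈ K) (hxA : x ∉ A) (huv : (u, v) ∈ segments n (A ∪ O)) (h1 : u < x) (h2 : x < v)
    (hT : weight u x v * meanDiff (S.obs ε) u x v ^ 2 ≤ 16 * (c * ξ)) :
    crit n (S.obs ε) ξ O N A ≤ crit n (S.obs ε) ξ O N (insert x A) - 3 / 4 * ξ := by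
  have hn : (0 : ℝ) < n := by
    have h1 := hW.lt
    have h2 := hW.le
    exact_mod_cast (by omega : 0 < n)
  have hcl := hc.cl_pos
  have hξ := hg.ξ_pos
  have hR := hg.rss_ge hc hW (Finset.insert_subset hx hA) ⟨x, hx⟩
  have hRpos : 0 < rss n (S.obs ε) (insert x A ∪ O) := lt_of_lt_of_le (by positivity) hR
  have e1 := rss_eq_rss_insert_add (S.obs ε) huv h1 h2
  rw [← Finset.insert_union] at e1
  unfold crit
  rw [e1, Finset.card_insert_of_notMem hxA]
  set R := rss n (S.obs ε) (insert x A ∪ O)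
  set T := weight u x v * meanDiff (S.obs ε) u x v ^ 2
  have hT0 : 0 ≤ T := mul_nonneg (weight_pos h1 h2).le (sq_nonneg _)
  have e2 : Real.log ((R + T) / n) = Real.log (R / n) + Real.log (1 + T / R) := by
    rw [← Real.log_mul (by positivity) (by positivity)]
    congr 1
    field_simp
  have e3 : Real.log (1 + T / R) ≤ T / R := by
    have := Real.log_le_sub_one_of_pos (by positivity : 0 < 1 + T / R)
    linarith
  have e4 : (n : ℝ) / 2 * (T / R) ≤ ξ / 4 := by
    rw [← mul_div_assoc, div_le_iff₀ hRpos]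
    have a1 := mul_le_mul_of_nonneg_left hT (by positivity : 0 ≤ (n : ℝ) / 2)
    have a2 := mul_le_mul_of_nonneg_left hR (by positivity : 0 ≤ ξ / 4)
    have a3 := mul_le_mul_of_nonneg_right hc.c_le (by positivity : 0 ≤ ξ * n / 4)
    linarith
  have e5 := mul_le_mul_of_nonneg_left e3 (by positivity : 0 ≤ (n : ℝ) / 2)
  rw [e2]
  push_cast
  linarith

/-- A gain of `16 * Cu * ξ` in the residual sum of squares changes the logarithmic term by at least
`4 * ξ`, which more than pays for two further breaks. -/
theorem GoodPath.crit_lt_of_rss (hg : GoodPath S ε K ξ ρ r w η M cl Cu H)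
    (hc : Constants c C cl Cu M η) (hW : Window S K O s e H) {B : Finset ℕ} (hB : B ⊆ K)
    (hK : K.Nonempty) (hup : rss n (S.obs ε) (B ∪ O) ≤ Cu * n) (hn16 : 16 * ξ ≤ n)
    (hrss : rss n (S.obs ε) (B ∪ O) + 16 * Cu * ξ ≤ rss n (S.obs ε) (A ∪ O))
    (hcard : B.card ≤ A.card + 2) :
    crit n (S.obs ε) ξ O N B < crit n (S.obs ε) ξ O N A := by
  have hξ := hg.ξ_pos
  have hn : (0 : ℝ) < n := by linarith
  have hcl := hc.cl_pos
  have hCu := hc.Cu_pos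
  have hR := hg.rss_ge hc hW hB hK
  have hRpos : 0 < rss n (S.obs ε) (B ∪ O) := lt_of_lt_of_le (by positivity) hR
  unfold crit
  set R := rss n (S.obs ε) (B ∪ O)
  set R' := rss n (S.obs ε) (A ∪ O)
  have hR' : 0 < R' := by nlinarith
  have e2 : Real.log (R' / n) = Real.log (R / n) + Real.log (R' / R) := by
    rw [← Real.log_mul (by positivity) (by positivity)]
    congr 1
    field_simp
  have e3 : 1 - (R' / R)⁻¹ ≤ Real.log (R' / R) := Real.one_sub_inv_le_log_of_pos (by positivity)
  have e4 : 8 * ξ / n ≤ 1 - (R' / R)⁻¹ := by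
    rw [inv_div, div_le_iff₀ hn, sub_mul, one_mul, div_mul_eq_mul_div]
    have : R * n / R' ≤ n - 8 * ξ := by
      rw [div_le_iff₀ hR']
      have a1 := mul_le_mul_of_nonneg_left hrss (by linarith : 0 ≤ (n : ℝ) - 8 * ξ)
      have a2 := mul_le_mul_of_nonneg_left hup (by linarith : 0 ≤ 8 * ξ)
      have a3 := mul_le_mul_of_nonneg_left hn16 (by positivity : 0 ≤ 8 * Cu * ξ)
      nlinarith
    linarith
  have e5 := mul_le_mul_of_nonneg_left (e4.trans e3) (by positivity : 0 ≤ (n : ℝ) / 2)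
  have e6 : (n : ℝ) / 2 * (8 * ξ / n) = 4 * ξ := by field_simp; norm_num
  rw [e6] at e5
  rw [e2]
  have e7 : (B.card : ℝ) ≤ A.card + 2 := by exact_mod_cast hcard
  have e8 := mul_le_mul_of_nonneg_right e7 hξ.le
  linarith

/-- Adding a superfluous candidate increases the criterion. -/
theorem GoodPath.crit_le_insert_of_edges (hg : GoodPath S ε K ξ ρ r w η M cl Cu H)
    (hc : Constants c C cl Cu M η) (hW : Window S K O s e H) (hA : A ⊆ K ∩ Finset.Ioo s e) {x : ℕ}
    (hx : x ∈ K ∩ Finset.Ioo s e) (hxA : x ∉ A)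
    (h : ∀ i ∈ S.detectable s e (c * ξ), (∃ k ∈ A, S.scaledDist i k ≤ c * ξ) ∨
      (i ∈ S.detectable s e (C * ξ) → ∃ k ∈ A, S.scaledDist i k ≤ C / 2 * ξ) ∧
        ξ / η / 4 ≤ S.scaledDist i x) :
    crit n (S.obs ε) ξ O N A ≤ crit n (S.obs ε) ξ O N (insert x A) - 3 / 4 * ξ := by
  obtain ⟨hxK, hxI⟩ := Finset.mem_inter.1 hx
  obtain ⟨u, v, huv, h1, h2, hsu, hve, -, -, hall⟩ := hW.exists_segment hxI hxA
  refine hg.crit_le_insert_sub hc hW (hA.trans Finset.inter_subset_left) hxK hxA huv h1 h2 ?_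
  have hcξ := hg.c_mul_pos hc
  refine (hg.separated.weight_mul_meanDiff_sq_le hcξ (by linarith [hg.c_mul_le hc])
    (hg.C_mul_lt hc) (hc.far_le ξ) (hg.four_w_sq_le hc) hg.noise h1 h2 (hve.trans hW.le)
    fun i hi hu hv => ?_).trans (by linarith)
  by_cases hdet : i ∈ S.detectable s e (c * ξ)
  · rcases h i hdet with ⟨k, hk, hki⟩ | ⟨h3, h4⟩
    · exact Or.inl ((edge_le_of_mem (hall k hk) hu hv).trans hki)
    · refine Or.inr ⟨?_, h4⟩
      by_cases hsure : i ∈ S.detectable s e (C * ξ)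
      · obtain ⟨k, hk, hki⟩ := h3 hsure
        exact (edge_le_of_mem (hall k hk) hu hv).trans (hki.trans (hg.half_C_mul_le hc))
      · exact edge_le_of_not_detectable hi hsure hsu hve
  · exact Or.inl (edge_le_of_not_detectable hi hdet hsu hve)

/-- Adding a valid candidate for a surely detectable change point that is not covered improves the
residual sum of squares substantially. -/
theorem GoodPath.rss_insert_add_le (hg : GoodPath S ε K ξ ρ r w η M cl Cu H)
    (hc : Constants c C cl Cu M η) (hW : Window S K O s e H) (hA : A ⊆ K ∩ Finset.Ioo s e)
    {j k : ℕ} (hj : j ∈ S.detectable s e (C * ξ)) (hjA : ∀ k ∈ A, C / 2 * ξ < S.scaledDist j k)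
    (hk : S.scaledDist j k ≤ ρ) (hcov : Covers S s e C ξ A {j}ᶜ) :
    rss n (S.obs ε) (insert k A ∪ O) + 16 * Cu * ξ ≤ rss n (S.obs ε) (A ∪ O) := by
  have hξ := hg.ξ_pos
  have hCξ : 0 < C * ξ := mul_pos hc.C_pos hξ
  have hcξ := hg.c_mul_pos hc
  have hρ : 8 * ρ ≤ c * ξ := by linarith [hg.two_ρ_le hc, hg.four_r_le hc]
  have hcC := hg.c_mul_le hc
  have hkI : k ∈ Finset.Ioo s e := mem_Ioo_of_detectable hj (by linarith)
  have hkA : k ∉ A := fun h => by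
    have := hjA k h
    linarith
  obtain ⟨u, v, huv, h1, h2, hsu, hve, hu, hv, hall⟩ := hW.exists_segment hkI hkA
  have hd := Signal.d_sq_pos hj.1
  obtain ⟨hjs, hje⟩ := detectable_dist hj
  have a1 := mul_le_mul_of_nonneg_left (le_abs_self ((k : ℝ) - S.θ j)) hd.le
  have a2 := mul_le_mul_of_nonneg_left (neg_abs_le ((k : ℝ) - S.θ j)) hd.le
  have hk' : S.d j ^ 2 * |(k : ℝ) - S.θ j| ≤ ρ := hk
  have hu' : (u : ℝ) < k := by exact_mod_cast h1
  have hv' : (k : ℝ) < v := by exact_mod_cast h2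
  have a3 := mul_lt_mul_of_pos_left hu' hd
  have a4 := mul_lt_mul_of_pos_left hv' hd
  have hLu : C / 2 * ξ ≤ S.d j ^ 2 * ((S.θ j : ℝ) - u) := by
    rcases hu with rfl | hu
    · linarith
    · have := hjA u hu
      unfold Signal.scaledDist at this
      rcases le_total (u : ℝ) (S.θ j) with h | h
      · rw [abs_of_nonpos (by linarith)] at this
        linarith
      · rw [abs_of_nonneg (by linarith)] at this
        linarith
  have hLv : C / 2 * ξ ≤ S.d j ^ 2 * ((v : ℝ) - S.θ j) := by
    rcases hv with rfl | hv
    · linarith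
    · have := hjA v hv
      unfold Signal.scaledDist at this
      rcases le_total (v : ℝ) (S.θ j) with h | h
      · rw [abs_of_nonpos (by linarith)] at this
        linarith
      · rw [abs_of_nonneg (by linarith)] at this
        linarith
  have hsmall : 8 * (C * ξ) / (3 * (ξ / η)) + 2 * (w / Real.sqrt (C / 2 * ξ / 2)) ≤ 1 / 4 := by
    have b1 := hg.w_div_sqrt_le hc (L := C / 4) (by linarith [hc.C_pos])
    have b2 : C / 2 * ξ / 2 = C / 4 * ξ := by ring
    have b3 : 8 * (C * ξ) / (3 * (ξ / η)) = 8 / 3 * (C * ξ / (ξ / η)) := by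
      have := hc.η_pos
      field_simp
    rw [b2, b3, hg.C_mul_div hc]
    linarith [hc.η_add]
  have hT := hg.separated.le_weight_mul_meanDiff_sq hCξ.le (hg.C_mul_lt hc) hg.w_nonneg hg.noise
    h1 h2 (hve.trans hW.le) hj.1 hk (by linarith [hg.C_mul_lt hc])
    (fun i hi hij hui hiv => hg.edge_le_of_covers hc hcov hsu hve hall hi hij hui hiv)
    (by linarith) (by linarith) hLu hLv hsmall
  have e1 := rss_eq_rss_insert_add (S.obs ε) huv h1 h2
  rw [← Finset.insert_union] at e1
  have h5 := mul_le_mul_of_nonneg_right hc.le_C hξ.le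
  linarith

/-- If `y` is the only element near `θ_j`, but not acceptable, then it is better to move it to a
valid candidate, unless `θ_j` is not surely detectable and it is better to delete `y`. -/
theorem GoodPath.crit_insert_lt_insert (hg : GoodPath S ε K ξ ρ r w η M cl Cu H)
    (hc : Constants c C cl Cu M η) (hW : Window S K O s e H) (hA : A ⊆ K ∩ Finset.Ioo s e)
    {j y k : ℕ} (hj : j ∈ S.detectable s e (c * ξ))
    (hjA : ∀ k ∈ A, ξ / η / 4 ≤ S.scaledDist j k) (hy : y ∈ K ∩ Finset.Ioo s e)
    (hyr : r < S.scaledDist j y) (hyz : S.scaledDist j y < ξ / η / 4) (hkK : k ∈ K)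
    (hk : S.scaledDist j k ≤ ρ) (hcov : Covers S s e C ξ A {j}ᶜ)
    (hcase : S.scaledDist j y ≤ C / 2 * ξ ∧ j ∈ S.detectable s e (C * ξ) ∨
      j ∉ S.detectable s e (C * ξ) ∧ ¬ crit n (S.obs ε) ξ O N A <
        crit n (S.obs ε) ξ O N (insert y A)) :
    crit n (S.obs ε) ξ O N (insert k A) < crit n (S.obs ε) ξ O N (insert y A) := by
  have hξ := hg.ξ_pos
  have hCξ : 0 < C * ξ := mul_pos hc.C_pos hξ
  have hcξ := hg.c_mul_pos hc
  have hρ : 8 * ρ ≤ c * ξ := by linarith [hg.two_ρ_le hc, hg.four_r_le hc]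
  have hcC := hg.c_mul_le hc
  have hCD := hg.C_mul_lt hc
  have hd := Signal.d_sq_pos hj.1
  obtain ⟨hyK, hyI⟩ := Finset.mem_inter.1 hy
  have hyA : y ∉ A := fun h => by
    have := hjA y h
    linarith
  have hkA : k ∉ A := fun h => by
    have := hjA k h
    linarith
  obtain ⟨u, v, huv, h1, h2, hsu, hve, hu, hv, hall⟩ := hW.exists_segment hyI hyA
  have hu' : (u : ℝ) < y := by exact_mod_cast h1
  have hv' : (y : ℝ) < v := by exact_mod_cast h2
  have hyz' : S.d j ^ 2 * |(y : ℝ) - S.θ j| < ξ / η / 4 := hyz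
  have a1 := mul_le_mul_of_nonneg_left (le_abs_self ((y : ℝ) - S.θ j)) hd.le
  have a2 := mul_le_mul_of_nonneg_left (neg_abs_le ((y : ℝ) - S.θ j)) hd.le
  have a3 := mul_lt_mul_of_pos_left hu' hd
  have a4 := mul_lt_mul_of_pos_left hv' hd
  -- the ends of the segment are at least as far from `θ_j` as detectability permits
  have hLu : ∀ t ≤ C * ξ, j ∈ S.detectable s e t → t ≤ S.d j ^ 2 * ((S.θ j : ℝ) - u) := by
    intro t ht hjt
    rcases hu with rfl | hu
    · exact (detectable_dist hjt).1
    · have := hjA u hu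
      unfold Signal.scaledDist at this
      rcases le_total (u : ℝ) (S.θ j) with h | h
      · rw [abs_of_nonpos (by linarith)] at this
        linarith
      · rw [abs_of_nonneg (by linarith)] at this
        linarith
  have hLv : ∀ t ≤ C * ξ, j ∈ S.detectable s e t → t ≤ S.d j ^ 2 * ((v : ℝ) - S.θ j) := by
    intro t ht hjt
    rcases hv with rfl | hv
    · exact (detectable_dist hjt).2
    · have := hjA v hv
      unfold Signal.scaledDist at this
      rcases le_total (v : ℝ) (S.θ j) with h | h
      · rw [abs_of_nonpos (by linarith)] at this
        linarith
      · rw [abs_of_nonneg (by linarith)] at this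
        linarith
  have hLu1 := hLu _ (by linarith) hj
  have hLv1 := hLv _ (by linarith) hj
  have huθ : u < S.θ j := by
    have := pos_of_mul_pos_right (hcξ.trans_le hLu1) hd.le
    exact_mod_cast sub_pos.1 this
  have hθv : S.θ j < v := by
    have := pos_of_mul_pos_right (hcξ.trans_le hLv1) hd.le
    exact_mod_cast sub_pos.1 this
  have huθ' : (u : ℝ) < S.θ j := by exact_mod_cast huθ
  have hθv' : (S.θ j : ℝ) < v := by exact_mod_cast hθv
  obtain ⟨huk, hkv⟩ := lt_of_scaledDist_lt hLu1 hLv1 (by linarith : S.scaledDist j k < c * ξ)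
  have hedge : ∀ i ∈ Finset.Icc 1 S.q, i ≠ j → u < S.θ i → S.θ i < v →
      S.d i ^ 2 * min ((S.θ i : ℝ) - u) ((v : ℝ) - S.θ i) ≤ C * ξ := fun i hi hij hui hiv =>
    hg.edge_le_of_covers hc hcov hsu hve hall hi hij hui hiv
  have hcCle : c / (2 * C) ≤ 1 / 4 := by
    have := hc.C_pos
    rw [div_le_iff₀ (by positivity)]
    linarith [hc.two_c_le]
  -- the jump is visible at `y`
  have hvis : c / (2 * C) ≤ meanDiff (step (S.θ j)) u y v ∧
      c * ξ ≤ S.d j ^ 2 * ((y : ℝ) - u) ∧ c * ξ ≤ S.d j ^ 2 * ((v : ℝ) - y) := by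
    rcases hcase with ⟨hyκ, hsure⟩ | ⟨hnot, hcrit⟩
    · have b1 := hLu _ le_rfl hsure
      have b2 := hLv _ le_rfl hsure
      have hyκ' : S.d j ^ 2 * |(y : ℝ) - S.θ j| ≤ C / 2 * ξ := hyκ
      refine ⟨hcCle.trans ?_, by linarith, by linarith⟩
      rcases le_total (S.θ j) y with h | h
      · rw [meanDiff_step_left h1 h2 huθ.le h, le_div_iff₀ (by linarith)]
        refine le_of_mul_le_mul_left ?_ hd
        linarith
      · rw [meanDiff_step_right h hθv.le, le_div_iff₀ (by linarith)]
        refine le_of_mul_le_mul_left ?_ hd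
        linarith
    · have hT : 16 * (c * ξ) < weight u y v * meanDiff (S.obs ε) u y v ^ 2 := by
        by_contra hT
        have := hg.crit_le_insert_sub (N := N) hc hW (hA.trans Finset.inter_subset_left) hyK hyA
          huv h1 h2 (not_lt.1 hT)
        exact hcrit (by linarith)
      -- the contribution of the `j`-th step to the statistic at `y`
      have hstat : c * ξ ≤ S.d j ^ 2 * (weight u y v * meanDiff (step (S.θ j)) u y v ^ 2) := by
        have e1 := hg.separated.abs_sum_cusum_le hcξ (by linarith) hCD (hc.far_le ξ) h1 h2
          (Finset.erase_subset j (Finset.Icc 1 S.q)) fun i hi hui hiv => by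
            obtain ⟨hij, hi⟩ := Finset.mem_erase.1 hi
            have := hg.separated.far_scaledDist hi hj.1 hij hyz.le
            exact Or.inr ⟨hedge i hi hij hui hiv, by linarith [hg.D_pos hc]⟩
        have e2 := sqrt_weight_mul_abs_meanDiff_le hg.noise h1 h2 (hve.trans hW.le)
        have e3 := Signal.two_mul_le_sqrt (hg.four_w_sq_le hc)
        have e4 := Signal.sqrt_weight_mul_meanDiff_obs S ε h1 h2
        rw [← Finset.add_sum_erase _ _ hj.1] at e4
        have e5 : 4 * Real.sqrt (c * ξ) <
            |Real.sqrt (weight u y v) * meanDiff (S.obs ε) u y v| := by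
          refine lt_of_pow_lt_pow_left₀ 2 (abs_nonneg _) ?_
          rw [sq_abs, mul_pow, mul_pow, Real.sq_sqrt (weight_pos h1 h2).le, Real.sq_sqrt hcξ.le]
          linarith
        have e6 := abs_add_le (S.d j * (Real.sqrt (weight u y v) * meanDiff (step (S.θ j)) u y v) +
          ∑ i ∈ (Finset.Icc 1 S.q).erase j,
            S.d i * (Real.sqrt (weight u y v) * meanDiff (step (S.θ i)) u y v))
          (Real.sqrt (weight u y v) * meanDiff ε u y v)
        have e7 := abs_add_le
          (S.d j * (Real.sqrt (weight u y v) * meanDiff (step (S.θ j)) u y v))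
          (∑ i ∈ (Finset.Icc 1 S.q).erase j,
            S.d i * (Real.sqrt (weight u y v) * meanDiff (step (S.θ i)) u y v))
        rw [← e4, abs_mul (Real.sqrt (weight u y v)) (meanDiff ε u y v),
          abs_of_nonneg (Real.sqrt_nonneg (weight u y v))] at e6
        have e8 : Real.sqrt (c * ξ) ≤
            |S.d j * (Real.sqrt (weight u y v) * meanDiff (step (S.θ j)) u y v)| := by linarith
        have e9 := pow_le_pow_left₀ (Real.sqrt_nonneg _) e8 2
        rw [sq_abs, mul_pow, mul_pow, Real.sq_sqrt (weight_pos h1 h2).le, Real.sq_sqrt hcξ.le] at e9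
        exact e9
      have hm1 : meanDiff (step (S.θ j)) u y v ^ 2 ≤ 1 :=
        pow_le_one₀ (meanDiff_step_nonneg h1 h2 huθ.le hθv.le)
          (meanDiff_step_le_one h1 h2 huθ.le hθv.le)
      have hW1 : weight u y v * meanDiff (step (S.θ j)) u y v ^ 2 ≤ weight u y v := by
        have := mul_le_mul_of_nonneg_left hm1 (weight_pos h1 h2).le
        linarith
      refine ⟨?_, hstat.trans (mul_le_mul_of_nonneg_left
        (hW1.trans (weight_le_left h1 h2)) hd.le), hstat.trans (mul_le_mul_of_nonneg_left
        (hW1.trans (weight_le_right h1 h2)) hd.le)⟩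
      have hnot2 : ¬ C * ξ ≤ S.d j ^ 2 * min ((S.θ j : ℝ) - s) ((e : ℝ) - S.θ j) :=
        fun h2 => hnot ⟨hj.1, h2⟩
      rw [mul_min_of_nonneg _ _ (sq_nonneg _), le_min_iff, not_and_or, not_le, not_le] at hnot2
      have hC := hc.C_pos
      have hsu' : (s : ℝ) ≤ u := by exact_mod_cast hsu
      have hve' : (v : ℝ) ≤ e := by exact_mod_cast hve
      have b1 := mul_le_mul_of_nonneg_left hsu' hd.le
      have b2 := mul_le_mul_of_nonneg_left hve' hd.le
      rcases le_total (S.θ j) y with h | h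
      · have h' : (S.θ j : ℝ) ≤ y := by exact_mod_cast h
        have b3 := weight_mul_meanDiff_step_left_le h1 h2 huθ.le h
        rw [meanDiff_step_left h1 h2 huθ.le h] at hstat b3 ⊢
        rw [div_le_div_iff₀ (by positivity) (by linarith)]
        rcases le_or_gt (S.d j ^ 2 * ((S.θ j : ℝ) - u)) (2 * (C * ξ)) with h3 | h3
        · have b4 := hstat.trans (mul_le_mul_of_nonneg_left b3 hd.le)
          rw [← mul_div_assoc, le_div_iff₀ (by linarith)] at b4
          refine le_of_mul_le_mul_left ?_ hξ
          have b5 := mul_le_mul_of_nonneg_right h3 (by linarith : 0 ≤ (S.θ j : ℝ) - u)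
          linarith
        · have b4 : S.d j ^ 2 * ((y : ℝ) - S.θ j) ≤ C * ξ := by
            rcases hnot2 with h4 | h4
            · linarith
            · linarith
          refine le_of_mul_le_mul_left ?_ hd
          have b5 := mul_le_mul_of_nonneg_right hc.two_c_le
            (mul_nonneg hd.le (by linarith : 0 ≤ (y : ℝ) - u))
          have b6 : S.d j ^ 2 * ((y : ℝ) - u) ≤ 2 * (S.d j ^ 2 * ((S.θ j : ℝ) - u)) := by linarith
          have b7 := mul_le_mul_of_nonneg_left b6 hC.le
          have b8 := mul_nonneg hC.le (hcξ.le.trans hLu1)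
          linarith
      · have h' : (y : ℝ) ≤ S.θ j := by exact_mod_cast h
        have b3 := weight_mul_meanDiff_step_right_le h1 h2 h hθv.le
        rw [meanDiff_step_right h hθv.le] at hstat b3 ⊢
        rw [div_le_div_iff₀ (by positivity) (by linarith)]
        rcases le_or_gt (S.d j ^ 2 * ((v : ℝ) - S.θ j)) (2 * (C * ξ)) with h3 | h3
        · have b4 := hstat.trans (mul_le_mul_of_nonneg_left b3 hd.le)
          rw [← mul_div_assoc, le_div_iff₀ (by linarith)] at b4
          refine le_of_mul_le_mul_left ?_ hξ
          have b5 := mul_le_mul_of_nonneg_right h3 (by linarith : 0 ≤ (v : ℝ) - S.θ j)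
          linarith
        · have b4 : S.d j ^ 2 * ((S.θ j : ℝ) - y) ≤ C * ξ := by
            rcases hnot2 with h4 | h4
            · linarith
            · linarith
          refine le_of_mul_le_mul_left ?_ hd
          have b5 := mul_le_mul_of_nonneg_right hc.two_c_le
            (mul_nonneg hd.le (by linarith : 0 ≤ (v : ℝ) - y))
          have b6 : S.d j ^ 2 * ((v : ℝ) - y) ≤ 2 * (S.d j ^ 2 * ((v : ℝ) - S.θ j)) := by linarith
          have b7 := mul_le_mul_of_nonneg_left b6 hC.le
          have b8 := mul_nonneg hC.le (hcξ.le.trans hLv1)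
          linarith
  obtain ⟨hμ, hyu, hyv⟩ := hvis
  have hsmall : 12 * η + 8 * (C * ξ) / (ξ / η) + 4 * (w / Real.sqrt (c * ξ)) < c / (2 * C) := by
    have b1 := hg.w_div_sqrt_le hc hc.c_pos
    have b3 : 8 * (C * ξ) / (ξ / η) = 8 * (C * ξ / (ξ / η)) := by ring
    rw [b3, hg.C_mul_div hc]
    linarith [hc.η_move]
  have hmove := hg.separated.segRss_move_lt hCξ.le hCD hg.w_nonneg hg.noise huk hkv h1 h2
    (hve.trans hW.le) hj.1 hk hg.r_pos hc.η_le_half hg.ρ_le hyr.le hyz.le hedge hcξ hyu hyv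
    (hg.noise_far j hj.1 y hyr.le hyz.le) (hg.noise_near j hj.1 k hk) hμ hsmall
  have e1 := rss_insert (S.obs ε) huv huk hkv
  have e2 := rss_insert (S.obs ε) huv h1 h2
  rw [← Finset.insert_union] at e1 e2
  have hlt : rss n (S.obs ε) (insert k A ∪ O) < rss n (S.obs ε) (insert y A ∪ O) := by linarith
  have hR := hg.rss_ge hc hW (Finset.insert_subset hkK (hA.trans Finset.inter_subset_left))
    ⟨k, hkK⟩
  have hn : (0 : ℝ) < n := by
    have h1 := hW.lt
    have h2 := hW.le
    exact_mod_cast (by omega : 0 < n)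
  have hRpos : 0 < rss n (S.obs ε) (insert k A ∪ O) :=
    lt_of_lt_of_le (mul_pos hc.cl_pos hn) hR
  unfold crit
  rw [Finset.card_insert_of_notMem hkA, Finset.card_insert_of_notMem hyA]
  have := Real.log_lt_log (div_pos hRpos hn) (div_lt_div_of_pos_right hlt hn)
  have := mul_lt_mul_of_pos_left this (half_pos hn)
  linarith

end

/-! ### Minimisers of the criterion -/

theorem InnerSubset.card_le {A B : Finset ℕ} (h : InnerSubset A B) : B.card ≤ A.card + 2 := by
  have h1 : ((B \ A).filter fun k => ∀ x ∈ B, k ≤ x).card ≤ 1 :=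
    Finset.card_le_one.2 fun a ha b hb => by
      simp only [Finset.mem_filter, Finset.mem_sdiff] at ha hb
      exact le_antisymm (ha.2 b hb.1.1) (hb.2 a ha.1.1)
  have h2 : ((B \ A).filter fun k => ∀ x ∈ B, x ≤ k).card ≤ 1 :=
    Finset.card_le_one.2 fun a ha b hb => by
      simp only [Finset.mem_filter, Finset.mem_sdiff] at ha hb
      exact le_antisymm (hb.2 a ha.1.1) (ha.2 b hb.1.1)
  have h3 : B ⊆ A ∪ (((B \ A).filter fun k => ∀ x ∈ B, k ≤ x) ∪
      (B \ A).filter fun k => ∀ x ∈ B, x ≤ k) := fun k hk => by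
    by_cases hkA : k ∈ A
    · exact Finset.mem_union_left _ hkA
    · refine Finset.mem_union_right _ ?_
      simp only [Finset.mem_union, Finset.mem_filter, Finset.mem_sdiff]
      rcases h.2 k hk hkA with h | h
      · exact Or.inl ⟨⟨hk, hkA⟩, h⟩
      · exact Or.inr ⟨⟨hk, hkA⟩, h⟩
  have h4 := Finset.card_le_card h3
  have h5 := Finset.card_union_le A (((B \ A).filter fun k => ∀ x ∈ B, k ≤ x) ∪
      (B \ A).filter fun k => ∀ x ∈ B, x ≤ k)
  have h6 := Finset.card_union_le ((B \ A).filter fun k => ∀ x ∈ B, k ≤ x)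
      ((B \ A).filter fun k => ∀ x ∈ B, x ≤ k)
  omega

section

variable {n : ℕ} {S : Signal n} {ε : ℕ → ℝ} {K O A : Finset ℕ} {s e : ℕ}
  {ξ ρ r w η M cl Cu H c C N : ℝ}

/-- `A` minimises the criterion among all sets of local candidates that are near every surely
detectable change point. -/
def IsCoveringMin (S : Signal n) (ε : ℕ → ℝ) (K O : Finset ℕ) (s e : ℕ) (C ξ N : ℝ)
    (A : Finset ℕ) : Prop :=
  A ⊆ K ∩ Finset.Ioo s e ∧ Covers S s e C ξ A Set.univ ∧
    ∀ B ⊆ K ∩ Finset.Ioo s e, Covers S s e C ξ B Set.univ →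
      crit n (S.obs ε) ξ O N A ≤ crit n (S.obs ε) ξ O N B

namespace GoodPath

variable (hg : GoodPath S ε K ξ ρ r w η M cl Cu H) (hc : Constants c C cl Cu M η)
include hg hc

theorem half_C_lt : C / 2 * ξ < ξ / η / 4 := (hg.half_C_mul_le hc).trans_lt (hg.C_mul_lt hc)

theorem r_le_half_C : r ≤ C / 2 * ξ := by
  linarith [hg.four_r_le hc, hg.c_mul_le hc, hg.r_pos]

theorem ρ_le_r : ρ ≤ r := by
  linarith [hg.two_ρ_le hc, hg.r_pos]

theorem exists_valid {j : ℕ} (hj : j ∈ S.detectable s e (c * ξ)) :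
    ∃ k ∈ K ∩ Finset.Ioo s e, S.scaledDist j k ≤ ρ := by
  obtain ⟨k, hk, hkρ⟩ := hg.valid j hj.1
  refine ⟨k, Finset.mem_inter.2 ⟨hk, mem_Ioo_of_detectable hj ?_⟩, hkρ⟩
  refine lt_of_le_of_lt (show S.scaledDist j k ≤ ρ from hkρ) ?_
  linarith [hg.ρ_le_r hc, hg.four_r_le hc, hg.r_pos]

theorem detectable_of_sure {j : ℕ} (hj : j ∈ S.detectable s e (C * ξ)) :
    j ∈ S.detectable s e (c * ξ) :=
  detectable_anti (by linarith [hg.c_mul_le hc, hg.c_mul_pos hc]) hj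

/-- The neighbourhoods of the change points are disjoint. -/
theorem eq_of_near {i j k : ℕ} (hi : i ∈ Finset.Icc 1 S.q) (hj : j ∈ Finset.Icc 1 S.q)
    (hki : S.scaledDist i k < ξ / η / 4) (hkj : S.scaledDist j k < ξ / η / 4) : i = j := by
  by_contra hij
  have := hg.separated.far_scaledDist hi hj hij hkj.le
  linarith [hg.D_pos hc]

/-- A stable set is near every surely detectable change point. -/
theorem covers_of_stable (hW : Window S K O s e H)
    (hA : A ∈ stable (crit n (S.obs ε) ξ O N) (K ∩ Finset.Ioo s e)) :
    Covers S s e C ξ A Set.univ := by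
  by_contra hcov
  unfold Covers at hcov
  push Not at hcov
  obtain ⟨j, hj, -, hjA⟩ := hcov
  -- stability fails at the set `B ⊇ A` of all candidates that are not near `θ_j`
  set B := (K ∩ Finset.Ioo s e).filter fun k => C / 2 * ξ < S.scaledDist j k with hB
  have hBD : B ⊆ K ∩ Finset.Ioo s e := Finset.filter_subset _ _
  obtain ⟨k, hk, hkρ⟩ := hg.exists_valid hc (hg.detectable_of_sure hc hj)
  have hkj : S.scaledDist j k ≤ C / 2 * ξ :=
    hkρ.trans ((hg.ρ_le_r hc).trans (hg.r_le_half_C hc))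
  have hkB : k ∉ B := fun h => absurd (Finset.mem_filter.1 h).2 (not_lt.2 hkj)
  have hst := hA.2 B (fun x hx => Finset.mem_filter.2 ⟨hA.1 hx, hjA x hx⟩) hBD k hk hkB
  have hBcov : Covers S s e C ξ B {j}ᶜ := fun i hi hij => by
    obtain ⟨l, hl, hlρ⟩ := hg.exists_valid hc (hg.detectable_of_sure hc hi)
    have hli : S.scaledDist i l ≤ C / 2 * ξ :=
      hlρ.trans ((hg.ρ_le_r hc).trans (hg.r_le_half_C hc))
    refine ⟨l, Finset.mem_filter.2 ⟨hl, ?_⟩, hli⟩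
    by_contra hlj
    exact hij (hg.eq_of_near hc hi.1 hj.1 (hli.trans_lt (hg.half_C_lt hc))
      ((not_lt.1 hlj).trans_lt (hg.half_C_lt hc)))
  have hcov : Covers S s e C ξ (insert k B) Set.univ := fun i hi _ => by
    by_cases hij : i = j
    · exact ⟨k, Finset.mem_insert_self _ _, hij ▸ hkj⟩
    · exact hBcov.mono (Finset.subset_insert _ _) i hi hij
  have hrss := hg.rss_insert_add_le hc hW hBD hj (fun x hx => (Finset.mem_filter.1 hx).2) hkρ hBcov
  have hsub : insert k B ⊆ K := (Finset.insert_subset hk hBD).trans Finset.inter_subset_left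
  have := hg.crit_lt_of_rss (N := N) hc hW hsub ⟨k, (Finset.mem_inter.1 hk).1⟩
    (hg.rss_le hc hW hsub hcov) (hg.ξ_le_n hc hj.1) hrss
    ((Finset.card_insert_le _ _).trans (by omega))
  linarith

/-- A set with acceptable elements for all detectable change points is stable. -/
theorem mem_stable (hW : Window S K O s e H) (hA : A ⊆ K ∩ Finset.Ioo s e)
    (h : ∀ j ∈ S.detectable s e (c * ξ), ∃ k ∈ A, S.scaledDist j k ≤ r) :
    A ∈ stable (crit n (S.obs ε) ξ O N) (K ∩ Finset.Ioo s e) := by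
  refine ⟨hA, fun B hAB hB k hk hkB => ?_⟩
  have := hg.crit_le_insert_of_edges (N := N) hc hW hB hk hkB fun i hi => by
    obtain ⟨l, hl, hlr⟩ := h i hi
    exact Or.inl ⟨l, hAB hl, by linarith [hg.four_r_le hc, hg.r_pos]⟩
  linarith [hg.ξ_pos]

/-- Elements near `θ_j` are superfluous in the presence of an acceptable one. -/
theorem crit_erase_le (hW : Window S K O s e H) (hA : A ⊆ K ∩ Finset.Ioo s e) {j p x : ℕ}
    (hj : j ∈ Finset.Icc 1 S.q) (hp : p ∈ A) (hpr : S.scaledDist j p ≤ r) (hx : x ∈ A)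
    (hxp : x ≠ p) (hxj : S.scaledDist j x < ξ / η / 4) (hcov : Covers S s e C ξ A {j}ᶜ) :
    crit n (S.obs ε) ξ O N (A.erase x) ≤ crit n (S.obs ε) ξ O N A - 3 / 4 * ξ := by
  have := hg.crit_le_insert_of_edges (N := N) hc hW ((Finset.erase_subset x A).trans hA) (hA hx)
    (Finset.notMem_erase _ _) fun i hi => by
      by_cases hij : i = j
      · subst hij
        exact Or.inl ⟨p, Finset.mem_erase.2 ⟨hxp.symm, hp⟩,
          by linarith [hg.four_r_le hc, hg.r_pos]⟩
      · have hfar := hg.separated.far_scaledDist hi.1 hj hij hxj.le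
        refine Or.inr ⟨fun hsure => ?_, by linarith [hg.D_pos hc]⟩
        obtain ⟨k, hk, hki⟩ := hcov i hsure hij
        refine ⟨k, Finset.mem_erase.2 ⟨fun h => ?_, hk⟩, hki⟩
        rw [h] at hki
        linarith [hg.D_pos hc, hg.half_C_lt hc]
  rwa [Finset.insert_erase hx] at this

theorem crit_insert_le (hW : Window S K O s e H) (hA : A ⊆ K) {k : ℕ} (hk : k ∈ K) (hkA : k ∉ A) :
    crit n (S.obs ε) ξ O N (insert k A) ≤ crit n (S.obs ε) ξ O N A + ξ := by
  have hn : (0 : ℝ) < n := by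
    have h1 := hW.lt
    have h2 := hW.le
    exact_mod_cast (by omega : 0 < n)
  have hkn : k ≤ n := (Finset.mem_Ioo.1 (hg.K_subset hk)).2.le
  have h1 := rss_insert_le (n := n) (A := A ∪ O) (S.obs ε) hkn
  rw [← Finset.insert_union] at h1
  have h2 := hg.rss_ge hc hW (Finset.insert_subset hk hA) ⟨k, hk⟩
  have h3 : 0 < rss n (S.obs ε) (insert k A ∪ O) := lt_of_lt_of_le (mul_pos hc.cl_pos hn) h2
  have h4 := Real.log_le_log (div_pos h3 hn) (div_le_div_of_nonneg_right h1 hn.le)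
  have h5 := mul_le_mul_of_nonneg_left h4 (half_pos hn).le
  unfold crit
  rw [Finset.card_insert_of_notMem hkA]
  push_cast
  linarith

/-- Several elements near `θ_j` can be replaced by a single valid candidate, at a gain. -/
theorem crit_insert_sdiff_le (hW : Window S K O s e H) (hA : A ⊆ K ∩ Finset.Ioo s e) {j k : ℕ}
    (hj : j ∈ Finset.Icc 1 S.q) (hk : k ∈ K ∩ Finset.Ioo s e) (hkA : k ∉ A)
    (hkj : S.scaledDist j k ≤ r) (hcov : Covers S s e C ξ A {j}ᶜ) {B : Finset ℕ} (hB : B ⊆ A)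
    (hBj : ∀ x ∈ B, S.scaledDist j x < ξ / η / 4) :
    crit n (S.obs ε) ξ O N (insert k A \ B) ≤
      crit n (S.obs ε) ξ O N A + ξ - 3 / 4 * B.card * ξ := by
  induction B using Finset.induction_on with
  | empty =>
    have := hg.crit_insert_le (N := N) hc hW (hA.trans Finset.inter_subset_left)
      (Finset.mem_inter.1 hk).1 hkA
    simpa using this
  | insert x B hxB ih =>
    have ih := ih (fun y hy => hB (Finset.mem_insert_of_mem hy))
      fun y hy => hBj y (Finset.mem_insert_of_mem hy)
    have hxA := hB (Finset.mem_insert_self _ _)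
    have hxk : x ≠ k := fun h => hkA (h ▸ hxA)
    have e1 : insert k A \ insert x B = (insert k A \ B).erase x := by
      ext y; simp only [Finset.mem_sdiff, Finset.mem_insert, Finset.mem_erase]; tauto
    have hkB : k ∉ B := fun h => hkA (hB (Finset.mem_insert_of_mem h))
    have hcov' : Covers S s e C ξ (insert k A \ B) {j}ᶜ := fun i hi hij => by
      obtain ⟨l, hl, hli⟩ := hcov i hi hij
      refine ⟨l, Finset.mem_sdiff.2 ⟨Finset.mem_insert_of_mem hl, fun h => hij ?_⟩, hli⟩
      exact hg.eq_of_near hc hi.1 hj (hli.trans_lt (hg.half_C_lt hc))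
        (hBj l (Finset.mem_insert_of_mem h))
    have := hg.crit_erase_le (N := N) hc hW
      (Finset.sdiff_subset.trans (Finset.insert_subset hk hA) : insert k A \ B ⊆ _) hj
      (Finset.mem_sdiff.2 ⟨Finset.mem_insert_self k A, hkB⟩) hkj
      (Finset.mem_sdiff.2 ⟨Finset.mem_insert_of_mem hxA, hxB⟩) hxk
      (hBj x (Finset.mem_insert_self _ _)) hcov'
    rw [e1, Finset.card_insert_of_notMem hxB]
    push_cast
    linarith

/-- Every element of a minimiser is near a detectable change point. -/
theorem exists_near_of_isCoveringMin (hW : Window S K O s e H)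
    (hA : IsCoveringMin S ε K O s e C ξ N A) {x : ℕ} (hx : x ∈ A) :
    ∃ j ∈ S.detectable s e (c * ξ), S.scaledDist j x < ξ / η / 4 := by
  by_contra hno
  push Not at hno
  obtain ⟨hAD, hcov, hmin⟩ := hA
  have hne : ∀ i ∈ S.detectable s e (C * ξ), ∃ k ∈ A.erase x, S.scaledDist i k ≤ C / 2 * ξ :=
    fun i hi => by
      obtain ⟨k, hk, hki⟩ := hcov i hi (Set.mem_univ _)
      refine ⟨k, Finset.mem_erase.2 ⟨fun h => ?_, hk⟩, hki⟩
      have := hno i (hg.detectable_of_sure hc hi)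
      rw [h] at hki
      linarith [hg.half_C_lt hc]
  have h1 := hg.crit_le_insert_of_edges (N := N) hc hW ((Finset.erase_subset x A).trans hAD)
    (hAD hx) (Finset.notMem_erase _ _) fun i hi => Or.inr ⟨hne i, hno i hi⟩
  rw [Finset.insert_erase hx] at h1
  have h2 := hmin (A.erase x) ((Finset.erase_subset x A).trans hAD) fun i hi _ => hne i hi
  linarith [hg.ξ_pos]

/-- If a minimiser has an element near a detectable change point, then it has an acceptable one. -/
theorem exists_acceptable_of_isCoveringMin (hW : Window S K O s e H)
    (hA : IsCoveringMin S ε K O s e C ξ N A) {j y : ℕ} (hj : j ∈ S.detectable s e (c * ξ))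
    (hy : y ∈ A) (hyj : S.scaledDist j y < ξ / η / 4) :
    ∃ p ∈ A, S.scaledDist j p ≤ r := by
  by_contra hno
  push Not at hno
  obtain ⟨hAD, hcov, hmin⟩ := hA
  have hξ := hg.ξ_pos
  obtain ⟨k, hk, hkρ⟩ := hg.exists_valid hc hj
  have hkr := hkρ.trans (hg.ρ_le_r hc)
  have hkA : k ∉ A := fun h => by linarith [hno k h]
  have hcov' : Covers S s e C ξ A {j}ᶜ := fun i hi _ => hcov i hi (Set.mem_univ _)
  set B := A.filter fun x => S.scaledDist j x < ξ / η / 4 with hB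
  have hyB : y ∈ B := Finset.mem_filter.2 ⟨hy, hyj⟩
  -- replacing all elements near `θ_j` by `k` keeps all surely detectable change points covered
  have hother : ∀ i ∈ S.detectable s e (C * ξ), i ≠ j →
      ∃ l ∈ A, l ∉ B ∧ S.scaledDist i l ≤ C / 2 * ξ := fun i hi hij => by
    obtain ⟨l, hl, hli⟩ := hcov i hi (Set.mem_univ _)
    refine ⟨l, hl, fun h => hij ?_, hli⟩
    exact hg.eq_of_near hc hi.1 hj.1 (hli.trans_lt (hg.half_C_lt hc)) (Finset.mem_filter.1 h).2
  have hcovk : Covers S s e C ξ (insert k A \ B) Set.univ := fun i hi _ => by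
    by_cases hij : i = j
    · subst hij
      exact ⟨k, Finset.mem_sdiff.2 ⟨Finset.mem_insert_self _ _,
        fun h => hkA (Finset.mem_filter.1 h).1⟩, hkr.trans (hg.r_le_half_C hc)⟩
    · obtain ⟨l, hl, hlB, hli⟩ := hother i hi hij
      exact ⟨l, Finset.mem_sdiff.2 ⟨Finset.mem_insert_of_mem hl, hlB⟩, hli⟩
  have hkAD : insert k A \ B ⊆ K ∩ Finset.Ioo s e :=
    Finset.sdiff_subset.trans (Finset.insert_subset hk hAD)
  rcases Nat.lt_or_ge 1 B.card with hcard | hcard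
  -- two or more elements near `θ_j`: one insertion is outweighed by the deletions
  · have h1 := hg.crit_insert_sdiff_le (N := N) hc hW hAD hj.1 hk hkA hkr hcov'
      (Finset.filter_subset _ _ : B ⊆ A) fun x hx => (Finset.mem_filter.1 hx).2
    have h2 := hmin _ hkAD hcovk
    have h3 : (2 : ℝ) ≤ B.card := by exact_mod_cast hcard
    have h4 := mul_le_mul_of_nonneg_right h3 hξ.le
    linarith
  -- otherwise `y` is the only one, and it can be moved to `k`
  · have hBy : B = {y} := by
      refine Finset.eq_singleton_iff_unique_mem.2 ⟨hyB, fun x hx => ?_⟩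
      exact Finset.card_le_one.1 hcard x hx y hyB
    rw [hBy] at hother hcovk hkAD
    have hky : k ≠ y := fun h => hkA (h ▸ hy)
    have e1 : insert k A \ {y} = insert k (A.erase y) := by
      ext x
      simp only [Finset.mem_sdiff, Finset.mem_insert, Finset.mem_erase, Finset.mem_singleton]
      constructor
      · rintro ⟨h1 | h1, h2⟩
        · exact Or.inl h1
        · exact Or.inr ⟨h2, h1⟩
      · rintro (h1 | ⟨h1, h2⟩)
        · exact ⟨Or.inl h1, h1 ▸ hky⟩
        · exact ⟨Or.inr h2, h1⟩
    rw [e1] at hcovk hkAD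
    have h1 := hmin _ hkAD hcovk
    have hED : A.erase y ⊆ K ∩ Finset.Ioo s e := (Finset.erase_subset _ _).trans hAD
    have hEj : ∀ x ∈ A.erase y, ξ / η / 4 ≤ S.scaledDist j x := fun x hx => by
      by_contra h
      have : x ∈ B := Finset.mem_filter.2 ⟨Finset.mem_of_mem_erase hx, not_le.1 h⟩
      rw [hBy, Finset.mem_singleton] at this
      exact (Finset.mem_erase.1 hx).1 this
    have hEcov : Covers S s e C ξ (A.erase y) {j}ᶜ := fun i hi hij => by
      obtain ⟨l, hl, hly, hli⟩ := hother i hi hij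
      exact ⟨l, Finset.mem_erase.2 ⟨fun h => hly (Finset.mem_singleton.2 h), hl⟩, hli⟩
    have h2 := hg.crit_insert_lt_insert (N := N) hc hW hED hj hEj (hAD hy) (hno y hy) hyj
      (Finset.mem_inter.1 hk).1 hkρ hEcov (by
        by_cases hsure : j ∈ S.detectable s e (C * ξ)
        · refine Or.inl ⟨?_, hsure⟩
          obtain ⟨l, hl, hlj⟩ := hcov j hsure (Set.mem_univ _)
          have : l ∈ B := Finset.mem_filter.2 ⟨hl, hlj.trans_lt (hg.half_C_lt hc)⟩
          rw [hBy, Finset.mem_singleton] at this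
          exact this ▸ hlj
        · refine Or.inr ⟨hsure, ?_⟩
          rw [Finset.insert_erase hy, not_lt]
          exact hmin _ hED fun i hi _ => hEcov i hi fun h => hsure (h ▸ hi))
    rw [Finset.insert_erase hy] at h2
    linarith

/-- A minimiser has at most one element near any detectable change point. -/
theorem unique_of_isCoveringMin (hW : Window S K O s e H)
    (hA : IsCoveringMin S ε K O s e C ξ N A) {j x y : ℕ} (hj : j ∈ S.detectable s e (c * ξ))
    (hx : x ∈ A) (hxj : S.scaledDist j x < ξ / η / 4) (hy : y ∈ A)
    (hyj : S.scaledDist j y < ξ / η / 4) : x = y := by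
  obtain ⟨p, hp, hpr⟩ := hg.exists_acceptable_of_isCoveringMin hc hW hA hj hx hxj
  obtain ⟨hAD, hcov, hmin⟩ := hA
  have key : ∀ x ∈ A, S.scaledDist j x < ξ / η / 4 → x = p := fun x hx hxj => by
    by_contra hxp
    have h1 := hg.crit_erase_le (N := N) hc hW hAD hj.1 hp hpr hx hxp hxj
      fun i hi _ => hcov i hi (Set.mem_univ _)
    have h2 := hmin (A.erase x) ((Finset.erase_subset x A).trans hAD) fun i hi _ => by
      by_cases hij : i = j
      · subst hij
        exact ⟨p, Finset.mem_erase.2 ⟨Ne.symm hxp, hp⟩, hpr.trans (hg.r_le_half_C hc)⟩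
      · obtain ⟨l, hl, hli⟩ := hcov i hi (Set.mem_univ _)
        refine ⟨l, Finset.mem_erase.2 ⟨fun h => hij ?_, hl⟩, hli⟩
        exact hg.eq_of_near hc hi.1 hj.1 (hli.trans_lt (hg.half_C_lt hc)) (h ▸ hxj)
    linarith [hg.ξ_pos]
  rw [key x hx hxj, key y hy hyj]

theorem exists_detectable_le_of_isCoveringMin (hW : Window S K O s e H)
    (hA : IsCoveringMin S ε K O s e C ξ N A) {x : ℕ} (hx : x ∈ A) :
    ∃ j ∈ S.detectable s e (c * ξ), S.scaledDist j x ≤ r := by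
  obtain ⟨j, hj, hxj⟩ := hg.exists_near_of_isCoveringMin hc hW hA hx
  obtain ⟨p, hp, hpr⟩ := hg.exists_acceptable_of_isCoveringMin hc hW hA hj hx hxj
  have hpj : S.scaledDist j p < ξ / η / 4 :=
    (hpr.trans (hg.r_le_half_C hc)).trans_lt (hg.half_C_lt hc)
  exact ⟨j, hj, hg.unique_of_isCoveringMin hc hW hA hj hx hxj hp hpj ▸ hpr⟩

/-- A minimiser among the covering sets is good. -/
theorem goodOutput_of_isCoveringMin (hW : Window S K O s e H)
    (hA : IsCoveringMin S ε K O s e C ξ N A) :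
    S.GoodOutput K s e (C * ξ) (c * ξ) r A := by
  have hrD : ∀ {j k}, S.scaledDist j k ≤ r → S.scaledDist j k < ξ / η / 4 := fun h =>
    (h.trans (hg.r_le_half_C hc)).trans_lt (hg.half_C_lt hc)
  have hone : ∀ j ∈ S.detectable s e (c * ξ), ((A : Set ℕ) ∩ S.acceptable K r j).ncard ≤ 1 :=
    fun j hj => by
      refine (Set.ncard_le_one_iff_subset_singleton
        (Set.Finite.inter_of_left A.finite_toSet _)).2 ?_
      by_cases hne : ((A : Set ℕ) ∩ S.acceptable K r j).Nonempty
      · obtain ⟨p, hp, hpj⟩ := hne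
        exact ⟨p, fun x hx => hg.unique_of_isCoveringMin hc hW hA hj hx.1 (hrD hx.2.2) hp
          (hrD hpj.2)⟩
      · exact ⟨0, by rw [Set.not_nonempty_iff_eq_empty.1 hne]; exact Set.empty_subset _⟩
  refine ⟨fun j hj => ?_, fun j hj => hone j hj.1, ?_⟩
  · have hdet := hg.detectable_of_sure hc hj
    refine le_antisymm (hone j hdet) ?_
    obtain ⟨l, hl, hlj⟩ := hA.2.1 j hj (Set.mem_univ _)
    obtain ⟨p, hp, hpr⟩ := hg.exists_acceptable_of_isCoveringMin hc hW hA hdet hl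
      (hlj.trans_lt (hg.half_C_lt hc))
    refine (Set.ncard_pos (Set.Finite.inter_of_left A.finite_toSet _)).2
      ⟨p, hp, (Finset.mem_inter.1 (hA.1 hp)).1, hpr⟩
  · rw [Set.sdiff_eq_empty]
    intro x hx
    obtain ⟨j, hj, hxj⟩ := hg.exists_detectable_le_of_isCoveringMin hc hW hA hx
    exact Set.mem_iUnion₂.2 ⟨j, hj, (Finset.mem_inter.1 (hA.1 hx)).1, hxj⟩

theorem exists_isCoveringMin :
    ∃ A, IsCoveringMin S ε K O s e C ξ N A := by
  classical
  obtain ⟨A, hA, hmin⟩ := Finset.exists_min_image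
    ((K ∩ Finset.Ioo s e).powerset.filter fun A => Covers S s e C ξ A Set.univ)
    (crit n (S.obs ε) ξ O N) ⟨K ∩ Finset.Ioo s e, by
      refine Finset.mem_filter.2 ⟨Finset.mem_powerset_self _, fun i hi _ => ?_⟩
      obtain ⟨k, hk, hkρ⟩ := hg.exists_valid hc (hg.detectable_of_sure hc hi)
      exact ⟨k, hk, hkρ.trans ((hg.ρ_le_r hc).trans (hg.r_le_half_C hc))⟩⟩
  rw [Finset.mem_filter, Finset.mem_powerset] at hA
  exact ⟨A, hA.1, hA.2, fun B hB hBcov =>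
    hmin B (Finset.mem_filter.2 ⟨Finset.mem_powerset.2 hB, hBcov⟩)⟩

/-- A stable set has at least as many elements as there are surely detectable change points, and
there are at most two further detectable ones, one near each end of the window. -/
theorem card_detectable_le (hW : Window S K O s e H)
    {T : Finset ℕ} (hT : ∀ j ∈ T, j ∈ S.detectable s e (c * ξ))
    (hA : A ∈ stable (crit n (S.obs ε) ξ O N) (K ∩ Finset.Ioo s e)) :
    T.card ≤ A.card + 2 := by
  classical
  have hcov := hg.covers_of_stable hc hW hA
  have h1 : (T.filter fun j => j ∈ S.detectable s e (C * ξ)).card ≤ A.card := by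
    have hcov' : ∀ j, ∃ k, j ∈ S.detectable s e (C * ξ) →
        k ∈ A ∧ S.scaledDist j k ≤ C / 2 * ξ := fun j => by
      by_cases hj : j ∈ S.detectable s e (C * ξ)
      · obtain ⟨k, hk⟩ := hcov j hj (Set.mem_univ _)
        exact ⟨k, fun _ => hk⟩
      · exact ⟨0, fun h => absurd h hj⟩
    choose f hf using hcov'
    refine Finset.card_le_card_of_injOn f (fun j hj => (hf j (Finset.mem_filter.1 hj).2).1) ?_
    intro i hi j hj hij
    have hi := (Finset.mem_filter.1 hi).2
    have hj := (Finset.mem_filter.1 hj).2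
    refine hg.eq_of_near hc hi.1 hj.1 ((hf i hi).2.trans_lt (hg.half_C_lt hc)) ?_
    rw [hij]
    exact (hf j hj).2.trans_lt (hg.half_C_lt hc)
  have h2 : (T.filter fun j => j ∉ S.detectable s e (C * ξ)).card ≤ 2 :=
    hg.separated.card_edge_le (τ := C * ξ) (by linarith [hg.C_mul_lt hc, hg.D_pos hc])
      (u := s) (v := e) fun j hj => by
        obtain ⟨hjT, hns⟩ := Finset.mem_filter.1 hj
        have hj := hT j hjT
        obtain ⟨h3, h4⟩ := lt_θ_of_detectable (hg.c_mul_pos hc) hj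
        exact ⟨hj.1, h3, h4, edge_le_of_not_detectable hj.1 hns le_rfl le_rfl⟩
  have := Finset.card_filter_add_card_filter_not (s := T) (fun j => j ∈ S.detectable s e (C * ξ))
  omega

/-- If `θ_j` is close to the left end of the window, then candidates near it precede all
candidates near other detectable change points. -/
theorem lt_of_near_left {i j x y : ℕ} (hi : i ∈ S.detectable s e (c * ξ))
    (hj : j ∈ S.detectable s e (c * ξ)) (hij : i ≠ j)
    (hleft : S.d j ^ 2 * ((S.θ j : ℝ) - s) < C * ξ) (hx : S.scaledDist i x < ξ / η / 4)
    (hy : S.scaledDist j y < ξ / η / 4) : y < x := by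
  have h1 := (hg.separated.far hi.1 hj.1 hij hy.le).1
  have h2 := (hg.separated.far hj.1 hi.1 hij.symm hx.le).1
  have h3 := hg.separated.le_dist hj.1 hi.1 hij.symm
  have h4 := hg.C_mul_lt hc
  have h5 := hg.D_pos hc
  have hs : (s : ℝ) < S.θ i := by exact_mod_cast (lt_θ_of_detectable (hg.c_mul_pos hc) hi).1
  have hd := Signal.d_sq_pos hj.1
  have hpos : 0 < |(S.θ j : ℝ) - S.θ i| := pos_of_mul_pos_right (h5.trans_le h3) hd.le
  have h6 := mul_lt_mul_of_pos_left hs hd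
  rw [abs_sub_comm (S.θ i : ℝ)] at h1
  rcases lt_or_gt_of_ne (sub_ne_zero.1 (abs_pos.1 hpos)) with h | h
  · rw [abs_of_neg (by linarith : (S.θ j : ℝ) - S.θ i < 0)] at *
    have a1 := le_abs_self ((y : ℝ) - S.θ j)
    have a2 := neg_abs_le ((x : ℝ) - S.θ i)
    have : (y : ℝ) < x := by linarith
    exact_mod_cast this
  · rw [abs_of_pos (by linarith : 0 < (S.θ j : ℝ) - S.θ i)] at *
    linarith

/-- If `θ_j` is close to the right end of the window, then candidates near it succeed all
candidates near other detectable change points. -/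
theorem lt_of_near_right {i j x y : ℕ} (hi : i ∈ S.detectable s e (c * ξ))
    (hj : j ∈ S.detectable s e (c * ξ)) (hij : i ≠ j)
    (hright : S.d j ^ 2 * ((e : ℝ) - S.θ j) < C * ξ) (hx : S.scaledDist i x < ξ / η / 4)
    (hy : S.scaledDist j y < ξ / η / 4) : x < y := by
  have h1 := (hg.separated.far hi.1 hj.1 hij hy.le).1
  have h2 := (hg.separated.far hj.1 hi.1 hij.symm hx.le).1
  have h3 := hg.separated.le_dist hj.1 hi.1 hij.symm
  have h4 := hg.C_mul_lt hc
  have h5 := hg.D_pos hc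
  have he : (S.θ i : ℝ) < e := by exact_mod_cast (lt_θ_of_detectable (hg.c_mul_pos hc) hi).2
  have hd := Signal.d_sq_pos hj.1
  have hpos : 0 < |(S.θ j : ℝ) - S.θ i| := pos_of_mul_pos_right (h5.trans_le h3) hd.le
  have h6 := mul_lt_mul_of_pos_left he hd
  rw [abs_sub_comm (S.θ i : ℝ)] at h1
  rcases lt_or_gt_of_ne (sub_ne_zero.1 (abs_pos.1 hpos)) with h | h
  · rw [abs_of_neg (by linarith : (S.θ j : ℝ) - S.θ i < 0)] at *
    linarith
  · rw [abs_of_pos (by linarith : 0 < (S.θ j : ℝ) - S.θ i)] at *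
    have a1 := le_abs_self ((x : ℝ) - S.θ i)
    have a2 := neg_abs_le ((y : ℝ) - S.θ j)
    have : (x : ℝ) < y := by linarith
    exact_mod_cast this

/-- A minimiser is a competitor: adding valid candidates for the detectable change points that it
misses yields a stable set, and the added candidates are the first or the last ones. -/
theorem mem_competitors_of_isCoveringMin (hW : Window S K O s e H)
    (hA : IsCoveringMin S ε K O s e C ξ N A) :
    A ∈ competitors (crit n (S.obs ε) ξ O N) (K ∩ Finset.Ioo s e) := by
  classical
  have hrD : ∀ {j k}, S.scaledDist j k ≤ r → S.scaledDist j k < ξ / η / 4 := fun h =>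
    (h.trans (hg.r_le_half_C hc)).trans_lt (hg.half_C_lt hc)
  have hval : ∀ j, ∃ k, j ∈ S.detectable s e (c * ξ) →
      k ∈ K ∩ Finset.Ioo s e ∧ S.scaledDist j k ≤ r := fun j => by
    by_cases hj : j ∈ S.detectable s e (c * ξ)
    · obtain ⟨k, hk, hkρ⟩ := hg.exists_valid hc hj
      exact ⟨k, fun _ => ⟨hk, hkρ.trans (hg.ρ_le_r hc)⟩⟩
    · exact ⟨0, fun h => absurd h hj⟩
  choose kv hkv using hval
  set T := (Finset.Icc 1 S.q).filter fun j => j ∈ S.detectable s e (c * ξ) with hT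
  -- the detectable change points that `A` misses, and `A` enlarged by candidates for them
  set U := T.filter fun j => ∀ x ∈ A, ξ / η / 4 ≤ S.scaledDist j x with hU
  set G := A ∪ U.image kv with hG
  have hTdet : ∀ j ∈ T, j ∈ S.detectable s e (c * ξ) := fun j hj => (Finset.mem_filter.1 hj).2
  have hUdet : ∀ j ∈ U, j ∈ S.detectable s e (c * ξ) := fun j hj =>
    hTdet j (Finset.mem_filter.1 hj).1
  have hGD : G ⊆ K ∩ Finset.Ioo s e := Finset.union_subset hA.1 fun x hx => by
    obtain ⟨j, hj, rfl⟩ := Finset.mem_image.1 hx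
    exact (hkv j (hUdet j hj)).1
  have hstab : G ∈ stable (crit n (S.obs ε) ξ O N) (K ∩ Finset.Ioo s e) := by
    refine hg.mem_stable hc hW hGD fun j hj => ?_
    by_cases hjU : j ∈ U
    · exact ⟨kv j, Finset.mem_union_right _ (Finset.mem_image_of_mem _ hjU), (hkv j hj).2⟩
    · have : ¬ ∀ x ∈ A, ξ / η / 4 ≤ S.scaledDist j x := fun h =>
        hjU (Finset.mem_filter.2 ⟨Finset.mem_filter.2 ⟨hj.1, hj⟩, h⟩)
      push Not at this
      obtain ⟨x, hx, hxj⟩ := this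
      obtain ⟨p, hp, hpr⟩ := hg.exists_acceptable_of_isCoveringMin hc hW hA hj hx hxj
      exact ⟨p, Finset.mem_union_left _ hp, hpr⟩
  have hnear : ∀ x ∈ G, ∃ j ∈ S.detectable s e (c * ξ), S.scaledDist j x ≤ r := fun x hx => by
    rcases Finset.mem_union.1 hx with h | h
    · exact hg.exists_detectable_le_of_isCoveringMin hc hW hA h
    · obtain ⟨j, hj, rfl⟩ := Finset.mem_image.1 h
      exact ⟨j, hUdet j hj, (hkv j (hUdet j hj)).2⟩
  -- an element of `G` near a change point that `A` misses is the candidate chosen for it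
  have hUeq : ∀ j ∈ U, ∀ x ∈ G, S.scaledDist j x < ξ / η / 4 → x = kv j := fun j hj x hx hxj => by
    rcases Finset.mem_union.1 hx with h | h
    · exact absurd hxj (not_lt.2 ((Finset.mem_filter.1 hj).2 x h))
    · obtain ⟨i, hi, rfl⟩ := Finset.mem_image.1 h
      rw [hg.eq_of_near hc (hUdet i hi).1 (hUdet j hj).1 (hrD (hkv i (hUdet i hi)).2) hxj]
  have hinj : ∀ j ∈ S.detectable s e (c * ξ), ∀ x ∈ G, ∀ y ∈ G, S.scaledDist j x < ξ / η / 4 →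
      S.scaledDist j y < ξ / η / 4 → x = y := fun j hj x hx y hy hxj hyj => by
    by_cases hjU : j ∈ U
    · rw [hUeq j hjU x hx hxj, hUeq j hjU y hy hyj]
    · have hmem : ∀ z ∈ G, S.scaledDist j z < ξ / η / 4 → z ∈ A := fun z hz hzj => by
        rcases Finset.mem_union.1 hz with h | h
        · exact h
        · obtain ⟨i, hi, rfl⟩ := Finset.mem_image.1 h
          exact absurd (hg.eq_of_near hc (hUdet i hi).1 hj.1 (hrD (hkv i (hUdet i hi)).2) hzj ▸ hi)
            hjU
      exact hg.unique_of_isCoveringMin hc hW hA hj (hmem x hx hxj) hxj (hmem y hy hyj) hyj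
  have hcardG : G.card ≤ T.card := by
    have hex : ∀ x, ∃ j, x ∈ G → j ∈ S.detectable s e (c * ξ) ∧ S.scaledDist j x ≤ r := fun x => by
      by_cases hx : x ∈ G
      · obtain ⟨j, hj⟩ := hnear x hx
        exact ⟨j, fun _ => hj⟩
      · exact ⟨0, fun h => absurd h hx⟩
    choose f hf using hex
    refine Finset.card_le_card_of_injOn f
      (fun x hx => Finset.mem_filter.2 ⟨(hf x hx).1.1, (hf x hx).1⟩) ?_
    intro x hx y hy hxy
    refine hinj (f x) (hf x hx).1 x hx y hy (hrD (hf x hx).2) ?_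
    rw [hxy]
    exact hrD (hf y hy).2
  refine ⟨G, hstab, Nat.sInf_le ⟨G, hstab, rfl⟩, ?_, Finset.subset_union_left, ?_⟩
  · obtain ⟨B, hB, hBcard⟩ := Nat.sInf_mem
      (⟨_, G, hstab, rfl⟩ :
        (Finset.card '' stable (crit n (S.obs ε) ξ O N) (K ∩ Finset.Ioo s e)).Nonempty)
    have := hg.card_detectable_le hc hW hTdet hB
    unfold minCard
    rw [← hBcard]
    omega
  · intro k hk hkA
    obtain ⟨j, hj, rfl⟩ := Finset.mem_image.1 ((Finset.mem_union.1 hk).resolve_left hkA)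
    have hjdet := hUdet j hj
    have hnot : ¬ C * ξ ≤ S.d j ^ 2 * min ((S.θ j : ℝ) - s) ((e : ℝ) - S.θ j) := fun h => by
      obtain ⟨l, hl, hlj⟩ := hA.2.1 j ⟨hjdet.1, h⟩ (Set.mem_univ _)
      exact absurd (hlj.trans_lt (hg.half_C_lt hc)) (not_lt.2 ((Finset.mem_filter.1 hj).2 l hl))
    have hkj := hrD (hkv j hjdet).2
    rw [mul_min_of_nonneg _ _ (sq_nonneg _), le_min_iff, not_and_or, not_le, not_le] at hnot
    rcases hnot with h | h
    · left
      intro x hx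
      obtain ⟨i, hi, hxi⟩ := hnear x hx
      by_cases hij : i = j
      · exact (hUeq j hj x hx (hij ▸ hrD hxi)).ge
      · exact (hg.lt_of_near_left hc hi hjdet hij h (hrD hxi) hkj).le
    · right
      intro x hx
      obtain ⟨i, hi, hxi⟩ := hnear x hx
      by_cases hij : i = j
      · exact (hUeq j hj x hx (hij ▸ hrD hxi)).le
      · exact (hg.lt_of_near_right hc hi hjdet hij h (hrD hxi) hkj).le

/-- Every output of the pruning algorithm is a minimiser, hence good. -/
theorem goodOutput_of_isPruned (hW : Window S K O s e H)
    (hA : IsPruned (crit n (S.obs ε) ξ O N) (K ∩ Finset.Ioo s e) A) :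
    S.GoodOutput K s e (C * ξ) (c * ξ) r A := by
  obtain ⟨A₀, hA₀⟩ := hg.exists_isCoveringMin (O := O) (s := s) (e := e) (N := N) hc
  have hle : crit n (S.obs ε) ξ O N A ≤ crit n (S.obs ε) ξ O N A₀ := by
    rcases hA.2 A₀ (hg.mem_competitors_of_isCoveringMin hc hW hA₀) with h | h
    · exact h.le
    · exact h.1.le
  -- the stable set `B` from which `A` arises
  obtain ⟨B, hB, -, -, hAB⟩ := hA.1
  by_cases hcov : Covers S s e C ξ A Set.univ
  · exact hg.goodOutput_of_isCoveringMin hc hW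
      ⟨hAB.1.trans hB.1, hcov, fun B hB hBcov => hle.trans (hA₀.2.2 B hB hBcov)⟩
  · exfalso
    unfold Covers at hcov
    push Not at hcov
    obtain ⟨j, hj, -, hjA⟩ := hcov
    have hBcov := hg.covers_of_stable hc hW hB
    obtain ⟨k, hk, hkρ⟩ := hg.exists_valid hc (hg.detectable_of_sure hc hj)
    -- exchanging the elements of `B` near `θ_j` for `k` leads to a covering set that beats `A`
    set B' := B.filter fun k => C / 2 * ξ < S.scaledDist j k with hB'
    have hB'B : B' ⊆ B := Finset.filter_subset _ _
    have hB'cov : Covers S s e C ξ B' {j}ᶜ := fun i hi hij => by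
      obtain ⟨l, hl, hli⟩ := hBcov i hi (Set.mem_univ _)
      refine ⟨l, Finset.mem_filter.2 ⟨hl, ?_⟩, hli⟩
      by_contra hlj
      exact hij (hg.eq_of_near hc hi.1 hj.1 (hli.trans_lt (hg.half_C_lt hc))
        ((not_lt.1 hlj).trans_lt (hg.half_C_lt hc)))
    have hcov' : Covers S s e C ξ (insert k B') Set.univ := fun i hi _ => by
      by_cases hij : i = j
      · exact ⟨k, Finset.mem_insert_self _ _,
          hij ▸ hkρ.trans ((hg.ρ_le_r hc).trans (hg.r_le_half_C hc))⟩
      · exact hB'cov.mono (Finset.subset_insert _ _) i hi hij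
    have hsub : insert k B' ⊆ K ∩ Finset.Ioo s e := Finset.insert_subset hk (hB'B.trans hB.1)
    have hrss := hg.rss_insert_add_le hc hW (hB'B.trans hB.1) hj
      (fun x hx => (Finset.mem_filter.1 hx).2) hkρ hB'cov
    have hanti : rss n (S.obs ε) (B' ∪ O) ≤ rss n (S.obs ε) (A ∪ O) :=
      rss_anti _ (Finset.union_subset_union_left fun x hx =>
        Finset.mem_filter.2 ⟨hAB.1 hx, hjA x hx⟩) fun x hx =>
          hW.le_of_mem hg.K_subset ((hB'B.trans hB.1).trans Finset.inter_subset_left) hx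
    have hcard : (insert k B').card ≤ A.card + 2 := by
      obtain ⟨l, hl, hlj⟩ := hBcov j hj (Set.mem_univ _)
      have h1 : B'.card < B.card := Finset.card_lt_card (Finset.ssubset_iff_subset_ne.2
        ⟨hB'B, fun h => absurd (Finset.mem_filter.1 (h ▸ hl : l ∈ B')).2 (not_lt.2 hlj)⟩)
      have h2 := Finset.card_insert_le k B'
      have h3 := hAB.card_le
      omega
    have h1 := hg.crit_lt_of_rss (N := N) hc hW (hsub.trans Finset.inter_subset_left)
      ⟨k, (Finset.mem_inter.1 hk).1⟩
      (hg.rss_le hc hW (hsub.trans Finset.inter_subset_left) hcov') (hg.ξ_le_n hc hj.1)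
      (hrss.trans hanti) hcard
    have h2 := hA₀.2.2 _ hsub hcov'
    linarith

theorem pruneEvent (hse : s < e) (hen : e ≤ n) :
    S.PruneEvent ε ξ H K (C * ξ) (c * ξ) r s e := by
  intro act acc A hadm hA
  obtain ⟨hact, hacc, hactI, haccI, hcover⟩ := hadm
  have hW : Window S K (acc ∪ (act \ (act ∩ Finset.Ioo s e)) ∪ {s, e}) s e H := by
    refine ⟨hse, hen, by simp, by simp, fun k hk hin => ?_, fun k hk => ?_, ?_⟩
    · have hI := Finset.mem_Ioo.2 hin
      simp only [Finset.mem_union, Finset.mem_sdiff, Finset.mem_inter, Finset.mem_insert,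
        Finset.mem_singleton] at hk
      rcases hk with (h | h) | h | h
      · have := Finset.mem_inter.2 ⟨h, hI⟩
        rw [haccI] at this
        exact Finset.notMem_empty _ this
      · exact h.2 ⟨h.1, hI⟩
      · omega
      · omega
    · simp only [Finset.mem_union, Finset.mem_sdiff, Finset.mem_insert,
        Finset.mem_singleton] at hk ⊢
      rcases hk with (h | h) | h
      · exact Or.inl (hacc h)
      · exact Or.inl (hact h.1)
      · exact Or.inr h
    · refine hcover.imp (fun h k hk hin => ?_) id
      rw [← h] at hk
      simp only [Finset.mem_union, Finset.mem_sdiff, Finset.mem_inter, Finset.mem_Ioo,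
        Finset.mem_insert, Finset.mem_singleton] at hk ⊢
      tauto
  have e1 : schwarz n (S.obs ε) ξ act acc s e =
      crit n (S.obs ε) ξ (acc ∪ (act \ (act ∩ Finset.Ioo s e)) ∪ {s, e})
        (acc.card + (act \ (act ∩ Finset.Ioo s e)).card) := by
    funext B
    unfold schwarz crit
    rw [Finset.union_assoc, Finset.union_assoc, Finset.union_assoc, add_assoc]
  rw [e1] at hA
  exact hg.goodOutput_of_isPruned hc hW hA

end GoodPath

end

/-! ### The mean ergodic theorem and the empirical second moment -/

section MeanErgodic

variable {α : Type*} [MeasurableSpace α] {P : Measure α} {T : α → α}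

lemma memLp_birkhoffSum {p : ENNReal} (hT : MeasurePreserving T P P) {g : α → ℝ}
    (hg : MemLp g p P) (n : ℕ) : MemLp (birkhoffSum T g n) p P := by
  have h : birkhoffSum T g n = ∑ i ∈ Finset.range n, g ∘ T^[i] := by
    ext x; simp [birkhoffSum]
  rw [h]
  exact memLp_finsetSum' _ fun i _ => hg.comp_measurePreserving (hT.iterate i)

lemma memLp_birkhoffAverage {p : ENNReal} (hT : MeasurePreserving T P P) {g : α → ℝ}
    (hg : MemLp g p P) (n : ℕ) : MemLp (birkhoffAverage ℝ T g n) p P :=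
  (memLp_birkhoffSum hT hg n).const_smul ((n : ℝ)⁻¹)

/-- Birkhoff sums of `g` along `T` are those of the Koopman operator on `L²`, which is composition
with `T`. -/
lemma toLp_birkhoffSum [IsProbabilityMeasure P] (hT : MeasurePreserving T P P) {g : α → ℝ}
    (hg : MemLp g 2 P) (n : ℕ) :
    (memLp_birkhoffSum hT hg n).toLp _ = birkhoffSum
      (Lp.compMeasurePreservingₗᵢ ℝ T hT).toContinuousLinearMap _root_.id n (hg.toLp g) := by
  induction n with
  | zero => simp
  | succ n ih =>
    have h : (Lp.compMeasurePreservingₗᵢ ℝ T hT).toContinuousLinearMap^[n] (hg.toLp g)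
        = (hg.comp_measurePreserving (hT.iterate n)).toLp _ := by
      have h1 := congrFun (Lp.compMeasurePreserving_iterate (E := ℝ) (p := 2) hT n) (hg.toLp g)
      exact h1
    rw [birkhoffSum_succ, ← ih, id_eq, h, ← MemLp.toLp_add]
    exact MemLp.toLp_congr _ _ (Filter.EventuallyEq.of_eq (by ext x; simp [birkhoffSum_succ]))

/-- Time averages of a square integrable function converge in `L²` to its mean: the fixed space
of the Koopman operator of an ergodic map consists of the constants. -/
lemma tendsto_eLpNorm_two_birkhoffAverage [IsProbabilityMeasure P] (hT : Ergodic T P) {g : α → ℝ}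
    (hg : MemLp g 2 P) :
    Tendsto (fun n => eLpNorm (birkhoffAverage ℝ T g n - fun _ => ∫ x, g x ∂P) 2 P) atTop
      (𝓝 0) := by
  have hTm := hT.toMeasurePreserving
  set F : Lp ℝ 2 P →L[ℝ] Lp ℝ 2 P := (Lp.compMeasurePreservingₗᵢ ℝ T hTm).toContinuousLinearMap
    with hF
  have hF1 : ‖F‖ ≤ 1 := LinearIsometry.norm_toContinuousLinearMap_le _
  have hlim := F.tendsto_birkhoffAverage_orthogonalProjection hF1 (hg.toLp g)
  set V := F.eqLocus (1 : Lp ℝ 2 P →L[ℝ] Lp ℝ 2 P) with hV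
  set y : Lp ℝ 2 P := (V.orthogonalProjectionOnto (hg.toLp g) : Lp ℝ 2 P) with hy
  have hyV : y ∈ V := (V.orthogonalProjectionOnto (hg.toLp g)).2
  have hconst : ∃ c : ℝ, (y : α → ℝ) =ᵐ[P] fun _ => c := by
    refine hT.ae_eq_const_of_ae_eq_comp_ae (Lp.aestronglyMeasurable y) ?_
    have h1 : F y = y := by simpa [hV] using hyV
    have h2 : (F y : α → ℝ) =ᵐ[P] (y : α → ℝ) ∘ T := Lp.coeFn_compMeasurePreserving y hTm
    rw [h1] at h2
    exact h2.symm
  obtain ⟨c, hc⟩ := hconst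
  have honeM : MemLp (fun _ : α => (1 : ℝ)) 2 P := memLp_const 1
  have hone : honeM.toLp _ ∈ V := by
    have : F (honeM.toLp _) = honeM.toLp _ := rfl
    simpa [hV] using this
  -- the constant is the mean of `g`: test the projection against the invariant function `1`
  have hinner : inner ℝ (hg.toLp g - y) (honeM.toLp _) = 0 :=
    V.starProjection_inner_eq_zero (hg.toLp g) (honeM.toLp _) hone
  have hcint : c = ∫ x, g x ∂P := by
    rw [inner_sub_left, sub_eq_zero, L2.inner_def, L2.inner_def] at hinner
    have h1 : ∫ a, inner ℝ ((hg.toLp g : α → ℝ) a) ((honeM.toLp _ : α → ℝ) a) ∂P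
        = ∫ x, g x ∂P := by
      refine integral_congr_ae ?_
      filter_upwards [hg.coeFn_toLp, honeM.coeFn_toLp] with a ha hb
      rw [ha, hb]; simp
    have h2 : ∫ a, inner ℝ ((y : α → ℝ) a) ((honeM.toLp _ : α → ℝ) a) ∂P = c := by
      have : ∫ a, inner ℝ ((y : α → ℝ) a) ((honeM.toLp _ : α → ℝ) a) ∂P = ∫ _, c ∂P := by
        refine integral_congr_ae ?_
        filter_upwards [hc, honeM.coeFn_toLp] with a ha hb
        rw [ha, hb]; simp
      rw [this]; simp
    rw [← h2, ← hinner, h1]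
  rw [Lp.tendsto_Lp_iff_tendsto_eLpNorm'] at hlim
  refine hlim.congr fun n => eLpNorm_congr_ae ?_
  have h3 : birkhoffAverage ℝ F _root_.id n (hg.toLp g)
      = (memLp_birkhoffAverage hTm hg n).toLp _ := by
    rw [birkhoffAverage, ← toLp_birkhoffSum hTm hg n]
    rfl
  rw [h3]
  refine EventuallyEq.sub (MemLp.coeFn_toLp _) ?_
  rw [← hcint]
  exact hc

lemma eLpNorm_birkhoffAverage_le {g : α → ℝ} (hT : MeasurePreserving T P P)
    (hg : AEStronglyMeasurable g P) (n : ℕ) :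
    eLpNorm (birkhoffAverage ℝ T g n) 1 P ≤ eLpNorm g 1 P := by
  rcases Nat.eq_zero_or_pos n with rfl | hn
  · simp
  have h : birkhoffAverage ℝ T g n = (n : ℝ)⁻¹ • ∑ i ∈ Finset.range n, g ∘ T^[i] := by
    ext x; simp [birkhoffAverage, birkhoffSum]
  rw [h, eLpNorm_const_smul]
  have h2 : eLpNorm (∑ i ∈ Finset.range n, g ∘ T^[i]) 1 P ≤ n * eLpNorm g 1 P := by
    refine (eLpNorm_sum_le (fun i _ => hg.comp_measurePreserving (hT.iterate i)) le_rfl).trans ?_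
    rw [Finset.sum_congr rfl fun i _ => eLpNorm_comp_measurePreserving hg (hT.iterate i)]
    simp
  refine (mul_le_mul_right h2 _).trans ?_
  rw [← mul_assoc]
  have h3 : ‖(n : ℝ)⁻¹‖ₑ * (n : ENNReal) = 1 := by
    have hn' : (0 : ℝ) < n := by exact_mod_cast hn
    rw [Real.enorm_eq_ofReal (by positivity), ← ENNReal.ofReal_natCast,
      ← ENNReal.ofReal_mul (by positivity), inv_mul_cancel₀ hn'.ne', ENNReal.ofReal_one]
  rw [h3, one_mul]

/-- The mean ergodic theorem in `L¹`, from the `L²` version by approximation. -/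
theorem tendsto_eLpNorm_one_birkhoffAverage [IsProbabilityMeasure P] (hT : Ergodic T P) {g : α → ℝ}
    (hg : Integrable g P) :
    Tendsto (fun n => eLpNorm (birkhoffAverage ℝ T g n - fun _ => ∫ x, g x ∂P) 1 P) atTop
      (𝓝 0) := by
  have hTm := hT.toMeasurePreserving
  have hg1 : MemLp g 1 P := memLp_one_iff_integrable.2 hg
  rw [ENNReal.tendsto_nhds_zero]
  intro δ hδ
  have hδ3 : δ / 3 ≠ 0 := (ENNReal.div_pos hδ.ne' (by norm_num)).ne'
  obtain ⟨h, hh, -⟩ := hg1.exists_simpleFunc_eLpNorm_sub_lt ENNReal.one_ne_top hδ3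
  have hh2 : MemLp h 2 P := h.memLp_of_isFiniteMeasure 2 P
  have hh1 : MemLp h 1 P := h.memLp_of_isFiniteMeasure 1 P
  have hL2 := ENNReal.tendsto_nhds_zero.1 (tendsto_eLpNorm_two_birkhoffAverage hT hh2) (δ / 3)
    (pos_iff_ne_zero.2 hδ3)
  filter_upwards [hL2] with n hn
  have hsplit : (birkhoffAverage ℝ T g n - fun _ => ∫ x, g x ∂P)
      = birkhoffAverage ℝ T (g - ⇑h) n + ((birkhoffAverage ℝ T h n - fun _ => ∫ x, h x ∂P)
        + fun _ => ∫ x, (h x - g x) ∂P) := by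
    have hi : ∫ x, (h x - g x) ∂P = ∫ x, h x ∂P - ∫ x, g x ∂P :=
      integral_sub (memLp_one_iff_integrable.1 hh1) hg
    ext x
    simp only [birkhoffAverage, birkhoffSum, Pi.sub_apply, Pi.add_apply, hi,
      Finset.sum_sub_distrib, smul_sub]
    ring
  have m1 := (memLp_birkhoffAverage hTm (hg1.sub hh1) n).1
  have m2 := (memLp_birkhoffAverage hTm hh1 n).1
  have mc : ∀ c : ℝ, AEStronglyMeasurable (fun _ : α => c) P := fun c =>
    aestronglyMeasurable_const
  rw [hsplit]
  refine (eLpNorm_add_le m1 ((m2.sub (mc _)).add (mc _)) le_rfl).trans ?_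
  have b1 := (eLpNorm_birkhoffAverage_le hTm (hg1.sub hh1).1 n).trans hh.le
  have b2 := (eLpNorm_add_le (m2.sub (mc (∫ x, h x ∂P))) (mc (∫ x, (h x - g x) ∂P))
    (le_refl (1 : ENNReal)))
  have b3 : eLpNorm (birkhoffAverage ℝ T h n - fun _ => ∫ x, h x ∂P) 1 P ≤ δ / 3 :=
    (eLpNorm_le_eLpNorm_of_exponent_le (by norm_num) (m2.sub (mc _))).trans hn
  have b4 : eLpNorm (fun _ : α => ∫ x, (h x - g x) ∂P) 1 P ≤ δ / 3 := by
    rw [eLpNorm_const _ one_ne_zero (IsProbabilityMeasure.ne_zero P)]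
    simp only [measure_univ, ENNReal.one_rpow, mul_one]
    refine (enorm_integral_le_lintegral_enorm _).trans ?_
    have : eLpNorm (g - ⇑h) 1 P = ∫⁻ a, ‖h a - g a‖ₑ ∂P := by
      rw [eLpNorm_one_eq_lintegral_enorm]
      refine lintegral_congr fun a => ?_
      rw [Pi.sub_apply, ← enorm_neg, neg_sub]
    rw [← this]; exact hh.le
  calc _ ≤ δ / 3 + (δ / 3 + δ / 3) := add_le_add b1 (b2.trans (add_le_add b3 b4))
    _ = δ := by rw [← add_assoc]; exact ENNReal.add_thirds δ

end MeanErgodic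

variable {Ω : Type*} [MeasurableSpace Ω] {μ : Measure Ω}

/-- If the shift is ergodic for the law of `ε 1, ε 2, …`, then the empirical second moment converges
in probability to the second moment of `ε 1`. -/
lemma tendstoInMeasure_sq_of_ergodic [IsProbabilityMeasure μ] {ε : ℕ → Ω → ℝ}
    (hm : ∀ t, 1 ≤ t → Measurable (ε t)) (hL2 : ∀ t, 1 ≤ t → MemLp (ε t) 2 μ)
    (he : Ergodic (fun (x : ℕ → ℝ) (t : ℕ) => x (t + 1)) (μ.map (fun ω t => ε (t + 1) ω))) :
    TendstoInMeasure μ (fun (n : ℕ) ω => (∑ t ∈ Finset.Icc 1 n, ε t ω ^ 2) / (n : ℝ)) atTop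
      (fun _ => ∫ ω, ε 1 ω ^ 2 ∂μ) := by
  set Y : Ω → ℕ → ℝ := fun ω t => ε (t + 1) ω with hY
  have hYm : Measurable Y := measurable_pi_lambda _ fun t => hm (t + 1) (by omega)
  have : IsProbabilityMeasure (μ.map Y) := Measure.isProbabilityMeasure_map hYm.aemeasurable
  have hgm : Measurable fun x : ℕ → ℝ => x 0 ^ 2 := (measurable_pi_apply 0).pow_const 2
  have hgi : Integrable (fun x : ℕ → ℝ => x 0 ^ 2) (μ.map Y) := by
    rw [integrable_map_measure hgm.aestronglyMeasurable hYm.aemeasurable]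
    exact (hL2 1 le_rfl).integrable_sq
  have hint : ∫ x, (x 0) ^ 2 ∂(μ.map Y) = ∫ ω, ε 1 ω ^ 2 ∂μ :=
    integral_map hYm.aemeasurable hgm.aestronglyMeasurable
  have hiter : ∀ (i : ℕ) (x : ℕ → ℝ), (fun (x : ℕ → ℝ) (t : ℕ) => x (t + 1))^[i] x
      = fun t => x (t + i) := by
    intro i
    induction i with
    | zero => intro x; rfl
    | succ i ih =>
      intro x
      rw [Function.iterate_succ_apply, ih]
      ext t
      exact congrArg x (by omega)
  have hlim := tendsto_eLpNorm_one_birkhoffAverage he hgi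
  refine tendstoInMeasure_of_tendsto_eLpNorm one_ne_zero (fun n => ?_)
    aestronglyMeasurable_const (hlim.congr fun n => ?_)
  · refine Measurable.aestronglyMeasurable ?_
    exact (Finset.measurable_sum _ fun t ht =>
      (hm t (Finset.mem_Icc.1 ht).1).pow_const 2).div_const _
  · have hav : AEStronglyMeasurable (birkhoffAverage ℝ (fun (x : ℕ → ℝ) (t : ℕ) => x (t + 1))
        (fun x : ℕ → ℝ => x 0 ^ 2) n - fun _ => ∫ x, x 0 ^ 2 ∂(μ.map Y)) (μ.map Y) :=
      ((memLp_birkhoffAverage he.toMeasurePreserving (memLp_one_iff_integrable.2 hgi) n).1).sub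
        aestronglyMeasurable_const
    rw [eLpNorm_map_measure hav hYm.aemeasurable]
    congr 1
    ext ω
    have hs : ∑ t ∈ Finset.Icc 1 n, ε t ω ^ 2 = ∑ i ∈ Finset.range n, ε (i + 1) ω ^ 2 := by
      rw [Finset.range_eq_Ico, Finset.sum_Ico_add' (fun t => ε t ω ^ 2) 0 n 1]
      rfl
    simp only [Function.comp_apply, Pi.sub_apply, birkhoffAverage, birkhoffSum, hiter, hs,
      smul_eq_mul, zero_add]
    rw [hint, div_eq_inv_mul]

/-- The empirical second moment of the errors lies between `cVar / 2` and `CVar + 1` with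
probability tending to one. -/
lemma tendsto_measure_energy [IsProbabilityMeasure μ] {ε : ℕ → Ω → ℝ} {cVar CVar : ℝ}
    (hcVar : 0 < cVar) (hm : ∀ t, 1 ≤ t → Measurable (ε t)) (hL2 : ∀ t, 1 ≤ t → MemLp (ε t) 2 μ)
    (h0 : ∀ t, 1 ≤ t → ∫ ω, ε t ω ∂μ = 0)
    (hv : ∀ t, 1 ≤ t → cVar ≤ variance (ε t) μ ∧ variance (ε t) μ ≤ CVar)
    (he : ErgodicErrors μ ε) :
    Tendsto (fun n : ℕ => μ {ω | cVar / 2 * n ≤ ∑ t ∈ Finset.Ioc 0 n, ε t ω ^ 2 ∧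
      ∑ t ∈ Finset.Ioc 0 n, ε t ω ^ 2 ≤ (CVar + 1) * n}ᶜ) atTop (𝓝 0) := by
  have hsq : ∀ t, 1 ≤ t → cVar ≤ ∫ ω, ε t ω ^ 2 ∂μ ∧ ∫ ω, ε t ω ^ 2 ∂μ ≤ CVar := by
    intro t ht
    have := hv t ht
    rwa [variance_of_integral_eq_zero (hm t ht).aemeasurable (h0 t ht)] at this
  -- in both cases the empirical second moment approaches an average `m n` of variances
  obtain ⟨m, hm1, hm2⟩ : ∃ m : ℕ → ℝ, (∀ n, 1 ≤ n → cVar ≤ m n ∧ m n ≤ CVar) ∧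
      ∀ δ : ℝ, 0 < δ → Tendsto (fun n : ℕ =>
        μ {ω | δ ≤ ‖(∑ t ∈ Finset.Icc 1 n, ε t ω ^ 2) / (n : ℝ) - m n‖}) atTop (𝓝 0) := by
    rcases he with he | he
    · exact ⟨fun _ => ∫ ω, ε 1 ω ^ 2 ∂μ, fun _ _ => hsq 1 le_rfl,
        tendstoInMeasure_iff_norm.1 (tendstoInMeasure_sq_of_ergodic hm hL2 he)⟩
    · refine ⟨fun n => (∑ t ∈ Finset.Icc 1 n, ∫ ω, ε t ω ^ 2 ∂μ) / n, fun n hn => ?_, ?_⟩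
      · have hn' : (0 : ℝ) < n := by exact_mod_cast hn
        rw [le_div_iff₀ hn', div_le_iff₀ hn']
        have h1 := Finset.card_nsmul_le_sum (Finset.Icc 1 n) (fun t => ∫ ω, ε t ω ^ 2 ∂μ) cVar
          fun t ht => (hsq t (Finset.mem_Icc.1 ht).1).1
        have h2 := Finset.sum_le_card_nsmul (Finset.Icc 1 n) (fun t => ∫ ω, ε t ω ^ 2 ∂μ) CVar
          fun t ht => (hsq t (Finset.mem_Icc.1 ht).1).2
        simp only [Nat.card_Icc, Nat.add_sub_cancel, nsmul_eq_mul] at h1 h2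
        constructor <;> linarith
      · simpa only [Finset.sum_sub_distrib, sub_div, sub_zero] using tendstoInMeasure_iff_norm.1 he
  have hlim := hm2 (min (cVar / 2) 1) (by positivity)
  refine tendsto_of_tendsto_of_tendsto_of_le_of_le' tendsto_const_nhds hlim
    (Eventually.of_forall fun _ => bot_le) ?_
  filter_upwards [eventually_ge_atTop 1] with n hn
  refine measure_mono fun ω hω => ?_
  by_contra hcon
  refine hω ?_
  have hn' : (0 : ℝ) < n := by exact_mod_cast hn
  simp only [Set.mem_ofPred_eq, not_le, Real.norm_eq_abs, lt_min_iff, abs_lt] at hcon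
  obtain ⟨⟨h1, -⟩, -, h2⟩ := hcon
  obtain ⟨h3, h4⟩ := hm1 n hn
  have h5 : cVar / 2 ≤ (∑ t ∈ Finset.Icc 1 n, ε t ω ^ 2) / n := by linarith
  have h6 : (∑ t ∈ Finset.Icc 1 n, ε t ω ^ 2) / n ≤ CVar + 1 := by linarith
  exact ⟨(le_div_iff₀ hn').1 h5, (div_le_iff₀ hn').1 h6⟩

/-! ### Measurability of the events -/

lemma measurable_sum_errors {ε : ℕ → Ω → ℝ} (hm : ∀ t, 1 ≤ t → Measurable (ε t)) (u v : ℕ) :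
    Measurable fun ω => ∑ t ∈ Finset.Ioc u v, ε t ω :=
  Finset.measurable_sum _ fun t ht => hm t (by have := (Finset.mem_Ioc.1 ht).1; omega)

lemma measurableSet_mul_abs_sum_le {ε : ℕ → Ω → ℝ} (hm : ∀ t, 1 ≤ t → Measurable (ε t))
    (u v : ℕ) (x w : ℝ) : MeasurableSet {ω | x * |∑ t ∈ Finset.Ioc u v, ε t ω| ≤ w} :=
  measurableSet_le (((measurable_sum_errors hm u v).norm).const_mul x) measurable_const

lemma measurableSet_noiseAll {ε : ℕ → Ω → ℝ} (hm : ∀ t, 1 ≤ t → Measurable (ε t)) (n : ℕ)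
    (w : ℝ) : MeasurableSet {ω | NoiseAll n (fun t => ε t ω) w} := by
  simp only [NoiseAll, Set.ofPred_forall]
  exact .iInter fun s => .iInter fun e => .iInter fun _ => .iInter fun _ =>
    measurableSet_mul_abs_sum_le hm _ _ _ _

lemma measurableSet_noiseFar {ε : ℕ → Ω → ℝ} (hm : ∀ t, 1 ≤ t → Measurable (ε t)) {n : ℕ}
    (S : Signal n) (a w : ℝ) : MeasurableSet {ω | NoiseFar S (fun t => ε t ω) a w} := by
  simp only [NoiseFar, Set.ofPred_forall, Set.ofPred_and]
  exact .iInter fun j => .iInter fun _ => .inter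
    (.iInter fun l => .iInter fun _ => .iInter fun _ => measurableSet_mul_abs_sum_le hm _ _ _ _)
    (.iInter fun l => .iInter fun _ => .iInter fun _ => measurableSet_mul_abs_sum_le hm _ _ _ _)

lemma measurableSet_noiseNear {ε : ℕ → Ω → ℝ} (hm : ∀ t, 1 ≤ t → Measurable (ε t)) {n : ℕ}
    (S : Signal n) (b w : ℝ) : MeasurableSet {ω | NoiseNear S (fun t => ε t ω) b w} := by
  simp only [NoiseNear, Set.ofPred_forall, Set.ofPred_and]
  exact .iInter fun j => .iInter fun _ => .iInter fun l => .iInter fun _ => .iInter fun _ => .inter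
    (measurableSet_mul_abs_sum_le hm _ _ _ _) (measurableSet_mul_abs_sum_le hm _ _ _ _)

lemma measurableSet_hasValid {K : Ω → Finset ℕ} (hK : ∀ k, MeasurableSet {ω | k ∈ K ω}) {n : ℕ}
    (S : Signal n) (ρ : ℝ) : MeasurableSet {ω | HasValid S (K ω) ρ} := by
  simp only [HasValid, Set.ofPred_forall, Set.ofPred_exists, Set.ofPred_and]
  exact .iInter fun j => .iInter fun _ => .iUnion fun k => (hK k).inter (.const _)

lemma tendsto_measure_compl_zero [IsProbabilityMeasure μ] {E : ℕ → Set Ω}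
    (hE : ∀ n, MeasurableSet (E n)) (h : Tendsto (fun n => μ (E n)) atTop (𝓝 1)) :
    Tendsto (fun n => μ (E n)ᶜ) atTop (𝓝 0) := by
  simp only [prob_compl_eq_one_sub (hE _)]
  have := ENNReal.Tendsto.sub (tendsto_const_nhds (x := (1 : ENNReal))) h (.inl ENNReal.one_ne_top)
  simpa using this

/-- No measurability is needed here, only subadditivity. -/
lemma tendsto_measure_one_of_compl [IsProbabilityMeasure μ] {E : ℕ → Set Ω}
    (h : Tendsto (fun n => μ (E n)ᶜ) atTop (𝓝 0)) : Tendsto (fun n => μ (E n)) atTop (𝓝 1) := by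
  have h1 := ENNReal.Tendsto.sub (tendsto_const_nhds (x := (1 : ENNReal))) h
    (.inl ENNReal.one_ne_top)
  rw [tsub_zero] at h1
  refine tendsto_of_tendsto_of_tendsto_of_le_of_le h1 tendsto_const_nhds (fun n => ?_)
    fun n => prob_le_one
  refine tsub_le_iff_right.2 ?_
  rw [← measure_univ (μ := μ), ← Set.union_compl_self (E n)]
  exact measure_union_le _ _

/-! ### The good path with probability tending to one -/

/-- All smallness conditions on `η` are continuous in `η` and strict at `η = 0`. -/
lemma exists_constants {cl Cu C : ℝ} (M : ℝ) (hcl : 0 < cl) (hCu : 0 < Cu) (hC : 512 * Cu ≤ C)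
    (hcC : cl ≤ C) : ∃ η, Constants (cl / 32) C cl Cu M η := by
  have hC0 : 0 < C := hcl.trans_le hcC
  have key : ∀ f : ℝ → ℝ, Continuous f → ∀ b, f 0 < b → ∀ᶠ η in 𝓝[>] (0 : ℝ), f η < b :=
    fun f hf b hb => (hf.continuousAt.eventually_lt continuousAt_const hb).filter_mono
      nhdsWithin_le_nhds
  have e1 := key (fun η => η) (by fun_prop) (1 / 2) (by norm_num)
  have e2 := key (fun η => 4 * η) (by fun_prop) (cl / 32) (by simpa using hcl)
  have e3 := key (fun η => 4 * C * η) (by fun_prop) 1 (by simp)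
  have e4 := key (fun η => 4 * C ^ 2 * η) (by fun_prop) (cl / 32) (by simpa using hcl)
  have e5 := key (fun η => 8 * C * η / 3 + 2 * Real.sqrt (η / (C / 4))) (by fun_prop) (1 / 4)
    (by simp)
  have e6 := key (fun η => 12 * η + 8 * C * η + 4 * Real.sqrt (η / (cl / 32))) (by fun_prop)
    (cl / 32 / (2 * C)) (by simpa using by positivity)
  have e7 := key (fun η => 13 * η + 4 * η ^ 2 * M ^ 2) (by fun_prop) cl (by simpa using hcl)
  have e8 := key (fun η => 2 * C * η * M ^ 2) (by fun_prop) 1 (by simp)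
  have e9 := key (fun η => 16 * η * M ^ 2) (by fun_prop) 1 (by simp)
  obtain ⟨η, h1, h2, h3, h4, h5, h6, h7, h8, h9, h10⟩ :=
    (e1.and (e2.and (e3.and (e4.and (e5.and (e6.and (e7.and (e8.and
      (e9.and self_mem_nhdsWithin))))))))).exists
  have h10' : 0 < η := h10
  exact ⟨η, by positivity, hCu, by linarith, hC, by linarith, h10', h1.le, h2.le, h3, h4.le, h5.le,
    h6, h7.le, h8.le, h9.le⟩

section

variable {n : ℕ} {S : Signal n} {ε : ℕ → ℝ}

lemma abs_le_of_sqrt_div_mul_le {r d w η s x : ℝ} (hr : 0 < r) (hd : d ≠ 0) (hx : 0 < x)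
    (hw : w ≤ η * Real.sqrt r) (h : Real.sqrt (r / d ^ 2) / x * |s| ≤ w) :
    |s| ≤ η * |d| * x := by
  have hd' : 0 < |d| := abs_pos.2 hd
  have hs : 0 < Real.sqrt r := Real.sqrt_pos.2 hr
  rw [Real.sqrt_div hr.le, Real.sqrt_sq_eq_abs] at h
  have h1 := h.trans hw
  have h2 : Real.sqrt r / |d| / x * |s| = Real.sqrt r * (|s| / (|d| * x)) := by
    field_simp
  rw [h2, mul_comm η] at h1
  have h3 := le_of_mul_le_mul_left h1 hs
  rw [div_le_iff₀ (by positivity)] at h3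
  linarith

/-- On the scale `1 / d_j ^ 2`, the bound of `NoiseFar` applies up to the nearest change point. -/
lemma NoiseFar.abs_psum_sub_le {r w η D : ℝ} (h : NoiseFar S ε r w) (hr : 0 < r)
    (hw : w ≤ η * Real.sqrt r) (hS : S.Separated D) (j : ℕ) (hj : j ∈ Finset.Icc 1 S.q) (y : ℕ)
    (h1 : r ≤ S.scaledDist j y) (h2 : S.scaledDist j y ≤ D) :
    |psum ε y - psum ε (S.θ j)| ≤ η * |S.d j| * |(y : ℝ) - S.θ j| := by
  have hd := S.d_ne j hj
  have hd2 : 0 < S.d j ^ 2 := by positivity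
  have hgap : |(y : ℝ) - S.θ j| ≤ S.gap j :=
    le_of_mul_le_mul_left (h2.trans (hS j hj)) hd2
  have hpos : 0 < |(y : ℝ) - S.θ j| := by
    by_contra hcon
    have : |(y : ℝ) - S.θ j| = 0 := le_antisymm (not_lt.1 hcon) (abs_nonneg _)
    simp only [Signal.scaledDist, this, mul_zero] at h1
    linarith
  have hfar : r / S.d j ^ 2 ≤ |(y : ℝ) - S.θ j| := by
    rw [div_le_iff₀ hd2, mul_comm]; exact h1
  rcases le_total (S.θ j) y with hy | hy
  · have hc : ((y - S.θ j : ℕ) : ℝ) = |(y : ℝ) - S.θ j| := by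
      rw [Nat.cast_sub hy, abs_of_nonneg (sub_nonneg.2 (Nat.cast_le.2 hy))]
    rw [← hc] at hgap hfar hpos ⊢
    have hl : y - S.θ j ≤ S.θ (j + 1) - S.θ j :=
      le_trans (by exact_mod_cast hgap) (min_le_right _ _)
    have := (h j hj).2 _ hfar hl
    rw [Nat.add_sub_cancel' hy, sum_Ioc_eq_psum_sub ε hy] at this
    exact abs_le_of_sqrt_div_mul_le hr hd hpos hw this
  · have hc : ((S.θ j - y : ℕ) : ℝ) = |(y : ℝ) - S.θ j| := by
      rw [Nat.cast_sub hy, abs_sub_comm, abs_of_nonneg (sub_nonneg.2 (Nat.cast_le.2 hy))]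
    rw [← hc] at hgap hfar hpos ⊢
    have hl : S.θ j - y ≤ S.θ j - S.θ (j - 1) :=
      le_trans (by exact_mod_cast hgap) (min_le_left _ _)
    have := (h j hj).1 _ hfar hl
    rw [Nat.sub_sub_self hy, sum_Ioc_eq_psum_sub ε hy] at this
    rw [abs_sub_comm]
    exact abs_le_of_sqrt_div_mul_le hr hd hpos hw this

lemma abs_le_of_inv_sqrt_mul_le {r d w η s : ℝ} (hr : 0 < r) (hd : d ≠ 0)
    (hw : w ≤ η * Real.sqrt r) (h : 1 / Real.sqrt (r / d ^ 2) * |s| ≤ w) :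
    |s| ≤ η * r / |d| := by
  have hd' : 0 < |d| := abs_pos.2 hd
  have hs : 0 < Real.sqrt r := Real.sqrt_pos.2 hr
  rw [Real.sqrt_div hr.le, Real.sqrt_sq_eq_abs] at h
  have h1 := h.trans hw
  have h2 : 1 / (Real.sqrt r / |d|) * |s| = |s| * |d| / Real.sqrt r := by
    field_simp
  rw [h2, div_le_iff₀ hs, mul_assoc, Real.mul_self_sqrt hr.le] at h1
  rwa [le_div_iff₀ hd']

lemma NoiseNear.abs_psum_sub_le {r w η : ℝ} (h : NoiseNear S ε r w) (hr : 0 < r) (hη : 0 < η)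
    (hw : w ≤ η * Real.sqrt r) (j : ℕ) (hj : j ∈ Finset.Icc 1 S.q) (k : ℕ)
    (hk : S.scaledDist j k ≤ r) : |psum ε k - psum ε (S.θ j)| ≤ η * r / |S.d j| := by
  have hd := S.d_ne j hj
  have hd2 : 0 < S.d j ^ 2 := by positivity
  have hnear : |(k : ℝ) - S.θ j| ≤ r / S.d j ^ 2 := by
    rw [le_div_iff₀ hd2, mul_comm]; exact hk
  rcases lt_trichotomy (S.θ j) k with hy | rfl | hy
  · have hc : ((k - S.θ j : ℕ) : ℝ) = |(k : ℝ) - S.θ j| := by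
      rw [Nat.cast_sub hy.le, abs_of_nonneg (sub_nonneg.2 (Nat.cast_le.2 hy.le))]
    rw [← hc] at hnear
    have := (h j hj _ (by omega) hnear).2
    rw [Nat.add_sub_cancel' hy.le, sum_Ioc_eq_psum_sub ε hy.le] at this
    exact abs_le_of_inv_sqrt_mul_le hr hd hw this
  · rw [sub_self, abs_zero]; positivity
  · have hc : ((S.θ j - k : ℕ) : ℝ) = |(k : ℝ) - S.θ j| := by
      rw [Nat.cast_sub hy.le, abs_sub_comm, abs_of_nonneg (sub_nonneg.2 (Nat.cast_le.2 hy.le))]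
    rw [← hc] at hnear
    have := (h j hj _ (by omega) hnear).1
    rw [Nat.sub_sub_self hy.le, sum_Ioc_eq_psum_sub ε hy.le] at this
    rw [abs_sub_comm]
    exact abs_le_of_inv_sqrt_mul_le hr hd hw this

lemma NoiseAll.nonneg {w : ℝ} (h : NoiseAll n ε w) (hn : 1 ≤ n) : 0 ≤ w :=
  le_trans (by positivity) (h 0 1 one_pos hn)

/-- The junk value `0 / 0 = 0` does no harm: the claim is trivial for `ξ ≤ 0`. -/
lemma Signal.separated_of_div_strength_le {ξ η : ℝ} (hη : 0 < η)
    (h : ENNReal.ofReal ξ / S.strength ≤ ENNReal.ofReal η) : S.Separated (ξ / η) := by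
  intro j hj
  have hle : S.strength ≤ ENNReal.ofReal (S.d j ^ 2 * (S.gap j : ℝ)) := iInf₂_le j hj
  have hne : S.strength ≠ ⊤ := ne_top_of_le_ne_top ENNReal.ofReal_ne_top hle
  by_cases h0 : S.strength = 0
  · rw [h0] at h
    by_cases hx : ENNReal.ofReal ξ = 0
    · have : ξ ≤ 0 := ENNReal.ofReal_eq_zero.1 hx
      exact (div_nonpos_of_nonpos_of_nonneg this hη.le).trans (by positivity)
    · rw [ENNReal.div_zero hx] at h
      exact absurd h (by simp)
  · have h1 := (ENNReal.div_le_iff h0 hne).1 h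
    have h2 := h1.trans (mul_le_mul_right hle _)
    rw [← ENNReal.ofReal_mul hη.le,
      ENNReal.ofReal_le_ofReal_iff (by positivity)] at h2
    rw [div_le_iff₀ hη, mul_comm]
    exact h2

lemma Signal.Separated.ofReal_le_strength {r D : ℝ} (h : S.Separated D) (hr : r ≤ D) :
    ENNReal.ofReal r ≤ S.strength :=
  le_iInf₂ fun j hj => ENNReal.ofReal_le_ofReal (hr.trans (h j hj))

end

end LocalPruning

theorem mainTheorem2 (cVar CVar dMax H : ℝ) (hcVar : 0 < cVar) :
    ∃ cs Cs : ℝ, 0 < cs ∧ cs < Cs ∧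
    ∀ (Ω : Type*) [MeasurableSpace Ω] (μ : Measure Ω) [IsProbabilityMeasure μ]
      (ε : ℕ → Ω → ℝ) (S : ∀ n : ℕ, LocalPruning.Signal n) (K : ℕ → Ω → Finset ℕ)
      (w w1 w2 ξ ρ ν : ℕ → ℝ),
      -- the errors: centred, variances bounded away from zero and infinity, ergodic
      (∀ t, 1 ≤ t → Measurable (ε t)) →
      (∀ t, 1 ≤ t → MemLp (ε t) 2 μ) →
      (∀ t, 1 ≤ t → ∫ ω, ε t ω ∂μ = 0) →
      (∀ t, 1 ≤ t → cVar ≤ variance (ε t) μ ∧ variance (ε t) μ ≤ CVar) →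
      LocalPruning.ErgodicErrors μ ε →
      -- the noise levels
      (fun n : ℕ => Real.sqrt (Real.log n)) =O[atTop] w →
      Tendsto (fun n => μ {ω | LocalPruning.NoiseAll n (fun t => ε t ω) (w n)}) atTop (𝓝 1) →
      (∀ a b : ℕ → ℝ,
        (∀ᶠ n in atTop, 1 ≤ a n ∧ ENNReal.ofReal (a n) ≤ (S n).strength) →
        (∀ᶠ n in atTop, 1 ≤ b n ∧ ENNReal.ofReal (b n) ≤ (S n).strength) →
        Tendsto (fun n => μ {ω | LocalPruning.NoiseFar (S n) (fun t => ε t ω) (a n) (w1 n) ∧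
          LocalPruning.NoiseNear (S n) (fun t => ε t ω) (b n) (w2 n)}) atTop (𝓝 1)) →
      -- the size of the changes
      (∀ n, ∀ j ∈ Finset.Icc 1 (S n).q, |(S n).d j| ≤ dMax) →
      Tendsto (fun n => ENNReal.ofReal (w n ^ 2) / (S n).strength) atTop (𝓝 0) →
      -- the penalty
      (∀ n, 0 < ξ n) →
      Tendsto (fun n => ENNReal.ofReal (ξ n) / (S n).strength) atTop (𝓝 0) →
      Tendsto (fun n => w n ^ 2 / ξ n) atTop (𝓝 0) →
      -- the candidates and their precision
      (∀ n k, MeasurableSet {ω | k ∈ K n ω}) →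
      (∀ n ω, K n ω ⊆ Finset.Ioo 0 n) →
      Tendsto (fun n => μ {ω | LocalPruning.HasValid (S n) (K n ω) (ρ n)}) atTop (𝓝 1) →
      (fun n => max (w1 n) (w2 n) ^ 2) =O[atTop] ρ →
      ρ =O[atTop] (fun n => w n ^ 2) →
      (∃ r : ℝ, 0 < r ∧ ∀ᶠ n in atTop, r ≤ ρ n) →
      TendstoInMeasure μ (fun (n : ℕ) ω => w n ^ 2 * ((K n ω).card : ℝ) / (n : ℝ)) atTop
        (fun _ => 0) →
      -- the slowly diverging sequence
      Tendsto ν atTop atTop →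
      Tendsto (fun n => ρ n * ν n / ξ n) atTop (𝓝 0) →
      ∀ a b : ℕ → ℝ,
        (∀ᶠ n in atTop, 1 ≤ a n ∧ ENNReal.ofReal (a n) ≤ (S n).strength) →
        (∀ᶠ n in atTop, 1 ≤ b n ∧ ENNReal.ofReal (b n) ≤ (S n).strength) →
        Tendsto (fun n => μ {ω |
            (∀ s e : ℕ, s < e → e ≤ n →
              (S n).PruneEvent (fun t => ε t ω) (ξ n) H (K n ω) (Cs * ξ n) (cs * ξ n)
                (ρ n * ν n) s e) ∧
            LocalPruning.NoiseAll n (fun t => ε t ω) (w n) ∧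
            LocalPruning.NoiseFar (S n) (fun t => ε t ω) (a n) (w1 n) ∧
            LocalPruning.NoiseNear (S n) (fun t => ε t ω) (b n) (w2 n) ∧
            LocalPruning.HasValid (S n) (K n ω) (ρ n)}) atTop (𝓝 1) := by
  -- bounds for the residual variance: the energy of the errors is at least `cVar / 2 * n` and at
  -- most `(CVar + 1) * n`, and a factor of two is spent on the fit
  set cl : ℝ := cVar / 4 with hcl
  set Cu : ℝ := 2 * (|CVar| + 1) + 2 * H ^ 2 + 1 with hCu
  have hcl0 : 0 < cl := by positivity
  have hCu0 : 0 < Cu := by positivity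
  obtain ⟨η, hc⟩ := LocalPruning.exists_constants (C := 512 * Cu + cl) dMax hcl0 hCu0
    (by linarith) (by linarith)
  have hη := hc.η_pos
  refine ⟨cl / 32, 512 * Cu + cl, hc.c_pos, by linarith, ?_⟩
  intro Ω _ μ _ ε S K w w1 w2 ξ ρ ν hm hL2 h0 hv he _ hAll hFN hd _ hξ hξD hwξ hKm hK hV hwρ _ hρ0
    hcard hν hρν a b ha hb
  obtain ⟨r₀, hr₀, hρ0⟩ := hρ0
  obtain ⟨A, hwρ⟩ := hwρ.bound
  -- deterministic bounds valid for large samples, with the precision `r = ρ ν`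
  have e1 : ∀ᶠ n in atTop, 1 ≤ ρ n * ν n ∧ ρ n ≤ η * (ρ n * ν n) ∧
      w1 n ≤ η * Real.sqrt (ρ n * ν n) ∧ w2 n ≤ η * Real.sqrt (ρ n * ν n) := by
    filter_upwards [hρ0, hwρ, hν.eventually_ge_atTop (1 / r₀), hν.eventually_ge_atTop (1 / η),
      hν.eventually_ge_atTop (A / η ^ 2)] with n h1 h2 h3 h4 h5
    have hρn : 0 < ρ n := hr₀.trans_le h1
    have hνn : 0 < ν n := lt_of_lt_of_le (by positivity) h3
    rw [div_le_iff₀ (by positivity)] at h3 h4 h5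
    have h6 : max (w1 n) (w2 n) ^ 2 ≤ η ^ 2 * (ρ n * ν n) := by
      rw [Real.norm_of_nonneg (sq_nonneg _), Real.norm_of_nonneg hρn.le] at h2
      nlinarith
    have h7 : max (w1 n) (w2 n) ≤ η * Real.sqrt (ρ n * ν n) := by
      refine le_of_abs_le (abs_le_of_sq_le_sq ?_ (by positivity))
      rwa [mul_pow, Real.sq_sqrt (by positivity)]
    exact ⟨by nlinarith, by nlinarith, (le_max_left _ _).trans h7, (le_max_right _ _).trans h7⟩
  have e2 : ∀ᶠ n in atTop, ρ n * ν n ≤ η * ξ n := by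
    filter_upwards [hρν.eventually_lt_const hη] with n hn
    exact ((div_lt_iff₀ (hξ n)).1 hn).le
  have e3 : ∀ᶠ n in atTop, w n ^ 2 ≤ η * ξ n := by
    filter_upwards [hwξ.eventually_lt_const hη] with n hn
    exact ((div_lt_iff₀ (hξ n)).1 hn).le
  have e4 : ∀ᶠ n in atTop, (S n).Separated (ξ n / η) := by
    filter_upwards [hξD.eventually_lt_const (ENNReal.ofReal_pos.2 hη)] with n hn
    exact LocalPruning.Signal.separated_of_div_strength_le hη hn.le
  have hr : ∀ᶠ n in atTop, 1 ≤ ρ n * ν n ∧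
      ENNReal.ofReal (ρ n * ν n) ≤ (S n).strength := by
    filter_upwards [e1, e2, e4] with n h1 h2 h4
    refine ⟨h1.1, h4.ofReal_le_strength ?_⟩
    rw [le_div_iff₀ hη]
    nlinarith [hξ n, hc.η_le_half]
  -- events whose complements have vanishing probability
  have hFNm : ∀ (a b : ℕ → ℝ) (n : ℕ), MeasurableSet
      {ω | LocalPruning.NoiseFar (S n) (fun t => ε t ω) (a n) (w1 n) ∧
        LocalPruning.NoiseNear (S n) (fun t => ε t ω) (b n) (w2 n)} := fun a b n =>
    (LocalPruning.measurableSet_noiseFar hm _ _ _).inter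
      (LocalPruning.measurableSet_noiseNear hm _ _ _)
  have p1 := LocalPruning.tendsto_measure_compl_zero
    (fun n => LocalPruning.measurableSet_noiseAll hm n (w n)) hAll
  have p2 := LocalPruning.tendsto_measure_compl_zero (hFNm _ _) (hFN _ _ hr hr)
  have p3 := LocalPruning.tendsto_measure_compl_zero (hFNm _ _) (hFN a b ha hb)
  have p4 := LocalPruning.tendsto_measure_compl_zero
    (fun n => LocalPruning.measurableSet_hasValid (hKm n) (S n) (ρ n)) hV
  have p5 := LocalPruning.tendsto_measure_energy hcVar hm hL2 h0 hv he
  have p6 := tendstoInMeasure_iff_norm.1 hcard η hη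
  have psum := ((((p1.add p2).add p3).add p4).add p5).add p6
  simp only [add_zero] at psum
  refine LocalPruning.tendsto_measure_one_of_compl
    (tendsto_of_tendsto_of_tendsto_of_le_of_le' tendsto_const_nhds psum
      (Eventually.of_forall fun _ => bot_le) ?_)
  filter_upwards [e1, e2, e3, e4, eventually_ge_atTop 1] with n h1 h2 h3 h4 hn
  refine le_trans (measure_mono fun ω hω => ?_) ((measure_union_le _ _).trans
    (add_le_add_left ((measure_union_le _ _).trans (add_le_add_left ((measure_union_le _ _).trans
      (add_le_add_left ((measure_union_le _ _).trans
        (add_le_add_left (measure_union_le _ _) _)) _)) _)) _))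
  by_contra hcon
  simp only [Set.mem_union, Set.mem_compl_iff, Set.mem_ofPred_eq, not_or, not_not, not_le, sub_zero,
    Real.norm_eq_abs] at hcon
  obtain ⟨⟨⟨⟨⟨g1, g2⟩, g3⟩, g4⟩, g5⟩, g6⟩ := hcon
  refine hω ⟨?_, g1, g3.1, g3.2, g4⟩
  have hn' : (0 : ℝ) < n := by exact_mod_cast hn
  have hr0 : 0 < ρ n * ν n := one_pos.trans_le h1.1
  have hg : LocalPruning.GoodPath (S n) (fun t => ε t ω) (K n ω) (ξ n) (ρ n) (ρ n * ν n) (w n) η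
      dMax cl Cu H :=
    { ξ_pos := hξ n
      r_pos := hr0
      r_le := h2
      ρ_le := h1.2.1
      w_nonneg := g1.nonneg hn
      w_sq_le := h3
      separated := h4
      d_le := hd n
      noise := g1
      noise_far := fun j hj y hy1 hy2 => by
        have := div_pos (hξ n) hη
        exact g2.1.abs_psum_sub_le hr0 h1.2.2.1 h4 j hj y hy1 (hy2.trans (by linarith))
      noise_near := fun j hj k hk => g2.2.abs_psum_sub_le hr0 hη h1.2.2.2 j hj k
        (hk.trans (h1.2.1.trans (by nlinarith [hc.η_le_half])))
      K_subset := hK n ω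
      valid := g4
      card_le := (div_le_iff₀ hn').1 ((le_abs_self _).trans g6.le)
      energy_ge := by
        have := g5.1
        rw [hcl]; linarith
      energy_le := by
        have h5 := g5.2
        have h6 := mul_le_mul_of_nonneg_right (le_abs_self CVar) hn'.le
        rw [hCu]; nlinarith }
  exact fun s e hse hen => hg.pruneEvent hc hse hen
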